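/- Conventions. Fix a class $\mathbf{Dia}$ of small categories (a full sub-2-category of $\mathbf{Cat}$) that contains all posets and is closed under products, coproducts and slice categories, for instance all small categories or all posets. A prederivator is a strict 2-functor $\mathbb D\colon\mathbf{Dia}^{\mathrm{op}}\to\mathbf{CAT}$; it is a derivator if it satisfies the usual axioms (Der1)–(Der4), and $u_!\dashv u^\ast\dashv u_\ast$ denote the Kan extensions along $u$. A derivator is pointed if $\mathbb D(e)$ has a zero object, where $e$ is the terminal category. It is regular if filtered colimits commute with finite limits: for every filtered $A$ and every (homotopy) finite $B$ in $\mathbf{Dia}$ (i.e. the nerve of $B$ has finitely many nondegenerate simplices), the canonical morphism $\pi_{A,!}(\mathrm{id}_A\times\pi_B)_\ast Y\to\pi_{B,\ast}(\pi_A\times\mathrm{id}_B)_!Y$ is an isomorphism for all $Y\in\mathbb D(A\times B)$. We write $\mathbb D^J$ for the shifted prederivator $K\mapsto\mathbb D(K\times J)$. Morphisms of prederivators are pseudonatural transformations, and an adjunction of morphisms has modifications as unit and counit. A full subprederivator is a localization of $\mathbb E$ if its inclusion into $\mathbb E$ admits a left adjoint morphism. Let $\square=\{0<1\}^2$, let $\urcorner\subset\square$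 be the full subcategory lacking $(0,0)$, with inclusion $i_\urcorner$, and let $\Omega=(0,0)^\ast\, i_{\urcorner,\ast}\,(1,1)_!$ be the loop endomorphism. Let $V\subset\mathbb Z^2$ be the poset of all $(i,j)$ with $|i-j|\le 1$, and $\partial V$ the full subposet with $|i-j|=1$. The prederivator $\mathrm{Sp}\,\mathbb D$ of prespectra is the full subprederivator of $\mathbb D^V$ on the objects whose restriction to $\partial V$ is zero. Let $\sigma\colon V\to V$, $(i,j)\mapsto(j+1,i+1)$, and let $w\colon\square\times V\to V$ be given by $$w(0,0,i,j)=(i,j),\quad w(1,0,i,j)=(j+1,j),\quad w(0,1,i,j)=(i,i+1),\quad w(1,1,i,j)=(j+1,i+1).$$ Let $\square^{\triangleleft}$ be $\square$ with a new initial object $\varnothing$ added, and let $s\colon\square\to\square^{\triangleleft}$ send $(0,0)$ to $\varnothing$ and be the identity elsewhere. For $X\in\mathrm{Sp}\,\mathbb D$, the map $\phi_X\colon X\to\Omega\sigma^\ast X$ is the restriction of $s_\ast w^\ast X$ to the arrow $\varnothing\to(0,0)$. An $\Omega$-spectrum is a prespectrum $X$ such that $\phi_X$ is an isomorphism, and $\mathrm{St}\,\mathbb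 D\subset\mathrm{Sp}\,\mathbb D$ is the full subprederivator of $\Omega$-spectra. Let $V^{\ge0}\subset V$ be the part with $i,j\ge0$, and let $\omega\colon V^{\ge 0}\times V\to V$ send $((a,b),(i,j))$ to $(x+a,y+b)$, where $x=i$ for $a$ even and $x=j$ for $a$ odd, while $y=j$ for $b$ even and $y=i$ for $b$ odd. Let $Z\subset V^{\ge0}\times\mathbb N$ be the full subposet of all $(a,b,k)$ with $a\neq b$ or $k\le a$, with inclusion $f\colon Z\to V^{\ge 0}\times\mathbb N$ and projection $\zeta\colon Z\to V^{\ge0}$. Let $F$ be the composite of $\omega^\ast$, $\zeta^\ast$, $f_\ast$ and restriction to $\{(0,0)\}\times\mathbb N$, which sends $X$ to a coherent diagram of shape $\mathbb N$, and let $\pi\colon\mathbb N\to e$ be the projection. Theorem. Let $\mathbb D$ be a regular pointed derivator. Then $\Omega$-spectra are stable under restriction, so that $\mathrm{St}\,\mathbb D$ is a prederivator, and the inclusion $i\colon\mathrm{St}\,\mathbb D\to\mathrm{Sp}\,\mathbb D$ admits a left adjoint morphism $\mathrm{loc}\colon\mathrm{Sp}\,\mathbb D\to\mathrm{St}\,\mathbb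 D$. That is, $\mathrm{St}\,\mathbb D$ is a localization of $\mathrm{Sp}\,\mathbb D$. The left adjoint is given by $\mathrm{loc}\,X\cong\pi_!F(X)$, by an invertible modification; it is the sequential homotopy colimit of $$X\to\Omega\sigma^\ast X\to\Omega^2(\sigma^\ast)^2X\to\cdots.$$ More precisely, for every $n\ge0$ the $n$-th object of $F(X)$ is naturally isomorphic to $\Omega^n(\sigma^\ast)^nX$, and the $n$-th transition map of $F(X)$ is naturally isomorphic, as an arrow, to $\Omega^n(\sigma^\ast)^n\phi_X$. -/

import Mathlib

open CategoryTheory CategoryTheory.Limits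

universe w v u

/-! ### Classes of diagram shapes and prederivators -/

/-- A class `Dia` of small categories (a full sub-2-category of `Cat`) containing all posets and
closed under products, coproducts and slices.  The class of all small categories and the class of
all posets are the two main examples. -/
structure DiagramClass where
  /-- the small categories that belong to the class -/
  Mem : ∀ (K : Type w) [SmallCategory K], Prop
  poset_mem : ∀ (P : Type w) [PartialOrder P], Mem P
  prod_mem : ∀ (J K : Type w) [SmallCategory J] [SmallCategory K], Mem J → Mem K → Mem (J × K)
  sigma_mem : ∀ (I : Type w) (K : I → Type w) [∀ i, SmallCategory (K i)],
    (∀ i, Mem (K i)) → Mem (Σ i, K i)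
  over_mem : ∀ (J K : Type w) [SmallCategory J] [SmallCategory K] (u : J ⥤ K) (k : K),
    Mem J → Mem K → Mem (CostructuredArrow u k)
  under_mem : ∀ (J K : Type w) [SmallCategory J] [SmallCategory K] (u : J ⥤ K) (k : K),
    Mem J → Mem K → Mem (StructuredArrow k u)

/-- `K` belongs to the class of diagram shapes `𝒟`. -/
class DiagramClass.Has (𝒟 : DiagramClass.{w}) (K : Type w) [SmallCategory K] : Prop where
  mem : 𝒟.Mem K

section closure

variable (𝒟 : DiagramClass.{w})

instance DiagramClass.hasPoset (P : Type w) [PartialOrder P] : 𝒟.Has P := ⟨𝒟.poset_mem P⟩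

instance DiagramClass.hasProd (J K : Type w) [SmallCategory J] [SmallCategory K] [𝒟.Has J]
    [𝒟.Has K] : 𝒟.Has (J × K) := ⟨𝒟.prod_mem J K Has.mem Has.mem⟩

instance DiagramClass.hasSigma (I : Type w) (K : I → Type w) [∀ i, SmallCategory (K i)]
    [∀ i, 𝒟.Has (K i)] : 𝒟.Has (Σ i, K i) := ⟨𝒟.sigma_mem I K fun _ => Has.mem⟩

instance DiagramClass.hasOver (J K : Type w) [SmallCategory J] [SmallCategory K] [𝒟.Has J]
    [𝒟.Has K] (u : J ⥤ K) (k : K) : 𝒟.Has (CostructuredArrow u k) :=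
  ⟨𝒟.over_mem J K u k Has.mem Has.mem⟩

instance DiagramClass.hasUnder (J K : Type w) [SmallCategory J] [SmallCategory K] [𝒟.Has J]
    [𝒟.Has K] (u : J ⥤ K) (k : K) : 𝒟.Has (StructuredArrow k u) :=
  ⟨𝒟.under_mem J K u k Has.mem Has.mem⟩

end closure

/-- A prederivator: a strict 2-functor `Diaᵒᵖ → CAT` (contravariant on functors, covariant on
natural transformations). -/
structure Prederivator (𝒟 : DiagramClass.{w}) where
  /-- the category of coherent `K`-shaped diagrams -/
  obj : ∀ (K : Type w) [SmallCategory K] [𝒟.Has K], Type u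
  [cat : ∀ (K : Type w) [SmallCategory K] [𝒟.Has K], Category.{v} (obj K)]
  /-- the restriction functor `u^*` -/
  map : ∀ {J K : Type w} [SmallCategory J] [SmallCategory K] [𝒟.Has J] [𝒟.Has K] (_ : J ⥤ K),
    obj K ⥤ obj J
  /-- the natural transformation `α^* : u^* ⟶ u'^*` -/
  map₂ : ∀ {J K : Type w} [SmallCategory J] [SmallCategory K] [𝒟.Has J] [𝒟.Has K] {u u' : J ⥤ K}
    (_ : u ⟶ u'), map u ⟶ map u'
  map_id : ∀ (K : Type w) [SmallCategory K] [𝒟.Has K], map (𝟭 K) = 𝟭 (obj K)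
  map_comp : ∀ {I J K : Type w} [SmallCategory I] [SmallCategory J] [SmallCategory K] [𝒟.Has I]
    [𝒟.Has J] [𝒟.Has K] (t : I ⥤ J) (u : J ⥤ K), map (t ⋙ u) = map u ⋙ map t
  map₂_id : ∀ {J K : Type w} [SmallCategory J] [SmallCategory K] [𝒟.Has J] [𝒟.Has K] (u : J ⥤ K),
    map₂ (𝟙 u) = 𝟙 (map u)
  map₂_comp : ∀ {J K : Type w} [SmallCategory J] [SmallCategory K] [𝒟.Has J] [𝒟.Has K]
    {u u' u'' : J ⥤ K} (α : u ⟶ u') (β : u' ⟶ u''), map₂ (α ≫ β) = map₂ α ≫ map₂ β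
  map₂_whiskerLeft : ∀ {I J K : Type w} [SmallCategory I] [SmallCategory J] [SmallCategory K]
    [𝒟.Has I] [𝒟.Has J] [𝒟.Has K] (t : I ⥤ J) {u u' : J ⥤ K} (α : u ⟶ u'),
    map₂ (Functor.whiskerLeft t α) =
      eqToHom (map_comp t u) ≫ Functor.whiskerRight (map₂ α) (map t) ≫
        eqToHom (map_comp t u').symm
  map₂_whiskerRight : ∀ {I J K : Type w} [SmallCategory I] [SmallCategory J] [SmallCategory K]
    [𝒟.Has I] [𝒟.Has J] [𝒟.Has K] {t t' : I ⥤ J} (β : t ⟶ t') (u : J ⥤ K),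
    map₂ (Functor.whiskerRight β u) =
      eqToHom (map_comp t u) ≫ Functor.whiskerLeft (map u) (map₂ β) ≫
        eqToHom (map_comp t' u).symm

attribute [instance] Prederivator.cat

namespace Prederivator

variable {𝒟 : DiagramClass.{w}}

/-! ### Morphisms, modifications and adjunctions -/

/-- A morphism of prederivators: a pseudonatural transformation, with structure isomorphisms
`γ_u : u^* Φ_K ≅ Φ_J u^*`. -/
structure Morphism (D E : Prederivator.{w, v, u} 𝒟) where
  /-- the functor `Φ_K` -/
  app : ∀ (K : Type w) [SmallCategory K] [𝒟.Has K], D.obj K ⥤ E.obj K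
  /-- the isomorphism `γ_u` -/
  γ : ∀ {J K : Type w} [SmallCategory J] [SmallCategory K] [𝒟.Has J] [𝒟.Has K] (t : J ⥤ K),
    app K ⋙ E.map t ≅ D.map t ⋙ app J
  γ_id : ∀ (K : Type w) [SmallCategory K] [𝒟.Has K] (X : D.obj K),
    (γ (𝟭 K)).hom.app X =
      eqToHom (by
        show (E.map (𝟭 K)).obj ((app K).obj X) = (app K).obj ((D.map (𝟭 K)).obj X)
        rw [E.map_id, D.map_id]; rfl)
  γ_comp : ∀ {I J K : Type w} [SmallCategory I] [SmallCategory J] [SmallCategory K] [𝒟.Has I]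
    [𝒟.Has J] [𝒟.Has K] (s : I ⥤ J) (t : J ⥤ K) (X : D.obj K),
    (γ (s ⋙ t)).hom.app X =
      eqToHom (Functor.congr_obj (E.map_comp s t) _) ≫ (E.map s).map ((γ t).hom.app X) ≫
        (γ s).hom.app ((D.map t).obj X) ≫
          eqToHom (congrArg (app I).obj (Functor.congr_obj (D.map_comp s t) X).symm)
  γ_map₂ : ∀ {J K : Type w} [SmallCategory J] [SmallCategory K] [𝒟.Has J] [𝒟.Has K]
    {t t' : J ⥤ K} (α : t ⟶ t') (X : D.obj K),
    (E.map₂ α).app ((app K).obj X) ≫ (γ t').hom.app X =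
      (γ t).hom.app X ≫ (app J).map ((D.map₂ α).app X)

/-- The identity morphism. -/
def Morphism.id (D : Prederivator.{w, v, u} 𝒟) : Morphism D D where
  app K := 𝟭 (D.obj K)
  γ t := Iso.refl (D.map t)
  γ_id := by intros; rfl
  γ_comp s t X := by
    simp
  γ_map₂ α X := by simp

/-- The composite `Φ` followed by `Ψ`. -/
def Morphism.comp {D E F : Prederivator.{w, v, u} 𝒟} (Φ : Morphism D E) (Ψ : Morphism E F) :
    Morphism D F where
  app K := Φ.app K ⋙ Ψ.app K
  γ {J K} _ _ _ _ t :=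
    Functor.isoWhiskerLeft (Φ.app K) (Ψ.γ t) ≪≫ Functor.isoWhiskerRight (Φ.γ t) (Ψ.app J)
  γ_id K X := by
    simp [Φ.γ_id, Ψ.γ_id, eqToHom_map]
  γ_comp s t X := by
    have h := (Ψ.γ s).hom.naturality ((Φ.γ t).hom.app X)
    simp only [Functor.comp_map] at h
    simp [Φ.γ_comp, Ψ.γ_comp, eqToHom_map, reassoc_of% h]
  γ_map₂ α X := by
    simp [reassoc_of% (Ψ.γ_map₂ α ((Φ.app _).obj X)), ← Functor.map_comp, Φ.γ_map₂]

/-- A modification between morphisms of prederivators.  (Compatibility with 2-cells follows from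
`comm` and the naturality of the structure isomorphisms in 2-cells.) -/
structure Modification {D E : Prederivator.{w, v, u} 𝒟} (Φ Ψ : Morphism D E) where
  /-- the component `ρ_K` -/
  app : ∀ (K : Type w) [SmallCategory K] [𝒟.Has K], Φ.app K ⟶ Ψ.app K
  comm : ∀ {J K : Type w} [SmallCategory J] [SmallCategory K] [𝒟.Has J] [𝒟.Has K] (t : J ⥤ K)
    (X : D.obj K), (E.map t).map ((app K).app X) ≫ (Ψ.γ t).hom.app X =
      (Φ.γ t).hom.app X ≫ (app J).app ((D.map t).obj X)

/-- An adjunction of morphisms of prederivators, `Φ` left adjoint to `Ψ`: unit and counit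
modifications satisfying the triangle identities. -/
structure MorphismAdjunction {D E : Prederivator.{w, v, u} 𝒟} (Φ : Morphism D E)
    (Ψ : Morphism E D) where
  /-- the unit -/
  unit : Modification (Morphism.id D) (Φ.comp Ψ)
  /-- the counit -/
  counit : Modification (Ψ.comp Φ) (Morphism.id E)
  left_triangle : ∀ (K : Type w) [SmallCategory K] [𝒟.Has K] (X : D.obj K),
    (Φ.app K).map ((unit.app K).app X) ≫ (counit.app K).app ((Φ.app K).obj X) =
      𝟙 ((Φ.app K).obj X)
  right_triangle : ∀ (K : Type w) [SmallCategory K] [𝒟.Has K] (Y : E.obj K),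
    (unit.app K).app ((Ψ.app K).obj Y) ≫ (Ψ.app K).map ((counit.app K).app Y) =
      𝟙 ((Ψ.app K).obj Y)

/-- `ι : E ⟶ D` exhibits `E` as a localization of `D`: it is levelwise fully faithful and admits
a left adjoint. -/
def Morphism.IsLocalization {E D : Prederivator.{w, v, u} 𝒟} (ι : Morphism E D) : Prop :=
  (∀ (K : Type w) [SmallCategory K] [𝒟.Has K], (ι.app K).Full ∧ (ι.app K).Faithful) ∧
    ∃ loc : Morphism D E, Nonempty (MorphismAdjunction loc ι)

/-! ### Kan extensions and derivators -/

/-- (Der3) Every restriction functor has a left and a right adjoint. -/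
class HasKan (D : Prederivator.{w, v, u} 𝒟) : Prop where
  isRightAdjoint : ∀ {J K : Type w} [SmallCategory J] [SmallCategory K] [𝒟.Has J] [𝒟.Has K]
    (t : J ⥤ K), (D.map t).IsRightAdjoint
  isLeftAdjoint : ∀ {J K : Type w} [SmallCategory J] [SmallCategory K] [𝒟.Has J] [𝒟.Has K]
    (t : J ⥤ K), (D.map t).IsLeftAdjoint

attribute [instance] HasKan.isRightAdjoint HasKan.isLeftAdjoint

section kan

variable (D : Prederivator.{w, v, u} 𝒟) [D.HasKan] {J K : Type w} [SmallCategory J]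
  [SmallCategory K] [𝒟.Has J] [𝒟.Has K]

/-- The left Kan extension `t_!`. -/
noncomputable def lan (t : J ⥤ K) : D.obj J ⥤ D.obj K := (D.map t).leftAdjoint

/-- The adjunction `t_! ⊣ t^*`. -/
noncomputable def lanAdj (t : J ⥤ K) : D.lan t ⊣ D.map t := Adjunction.ofIsRightAdjoint (D.map t)

/-- The right Kan extension `t_*`. -/
noncomputable def ran (t : J ⥤ K) : D.obj J ⥤ D.obj K := (D.map t).rightAdjoint

/-- The adjunction `t^* ⊣ t_*`. -/
noncomputable def ranAdj (t : J ⥤ K) : D.map t ⊣ D.ran t := Adjunction.ofIsLeftAdjoint (D.map t)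

end kan

section mates

variable (D : Prederivator.{w, v, u} 𝒟) {J₁ J₂ K₁ K₂ : Type w} [SmallCategory J₁]
  [SmallCategory J₂] [SmallCategory K₁] [SmallCategory K₂] [𝒟.Has J₁] [𝒟.Has J₂] [𝒟.Has K₁]
  [𝒟.Has K₂]

/-- The image `b^* a^* ⟶ d^* c^*` (as composites: first `b^*`, then `a^*`; first `d^*`, then
`c^*`) of a 2-cell `δ : b ∘ a ⟶ d ∘ c`. -/
def cell {a : J₁ ⥤ J₂} {b : J₂ ⥤ K₂} {c : J₁ ⥤ K₁} {d : K₁ ⥤ K₂} (δ : a ⋙ b ⟶ c ⋙ d) :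
    D.map b ⋙ D.map a ⟶ D.map d ⋙ D.map c :=
  eqToHom (D.map_comp a b).symm ≫ D.map₂ δ ≫ eqToHom (D.map_comp c d)

/-- The left mate `c_! a^* ⟶ d^* b_!` of `δ : b ∘ a ⟶ d ∘ c`. -/
noncomputable def leftMate [D.HasKan] {a : J₁ ⥤ J₂} {b : J₂ ⥤ K₂} {c : J₁ ⥤ K₁} {d : K₁ ⥤ K₂}
    (δ : a ⋙ b ⟶ c ⋙ d) : D.map a ⋙ D.lan c ⟶ D.lan b ⋙ D.map d :=
  ((mateEquiv (D.lanAdj b) (D.lanAdj c)).symm (TwoSquare.mk _ _ _ _ (D.cell δ))).natTrans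

/-- The right mate `b^* d_* ⟶ a_* c^*` of `δ : b ∘ a ⟶ d ∘ c`. -/
noncomputable def rightMate [D.HasKan] {a : J₁ ⥤ J₂} {b : J₂ ⥤ K₂} {c : J₁ ⥤ K₁} {d : K₁ ⥤ K₂}
    (δ : a ⋙ b ⟶ c ⋙ d) : D.ran d ⋙ D.map b ⟶ D.map c ⋙ D.ran a :=
  (mateEquiv (D.ranAdj d) (D.ranAdj a) (TwoSquare.mk _ _ _ _ (D.cell δ))).natTrans

end mates

/-- The terminal category `e`. -/
abbrev Pt : Type w := PUnit.{w + 1}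

/-- The functor `e ⥤ K` classifying an object `k`. -/
abbrev pt {K : Type w} [SmallCategory K] (k : K) : Pt.{w} ⥤ K := (Functor.const Pt.{w}).obj k

/-- The projection `K ⥤ e`. -/
abbrev toPt (K : Type w) [SmallCategory K] : K ⥤ Pt.{w} := (Functor.const K).obj PUnit.unit

section slices

variable {J K : Type w} [SmallCategory J] [SmallCategory K] (t : J ⥤ K) (k : K)

/-- The canonical 2-cell of the slice square over `k`, with component `f` at `(j, f : t j ⟶ k)`. -/
def overCell : CostructuredArrow.proj t k ⋙ t ⟶ toPt (CostructuredArrow t k) ⋙ pt k where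
  app x := x.hom
  naturality _ _ f := (CostructuredArrow.w f).trans (Category.comp_id _).symm

/-- The canonical 2-cell of the slice square under `k`, with component `f` at
`(j, f : k ⟶ t j)`. -/
def underCell : toPt (StructuredArrow k t) ⋙ pt k ⟶ StructuredArrow.proj k t ⋙ t where
  app x := x.hom
  naturality _ _ f := (Category.id_comp _).trans (StructuredArrow.w f).symm

end slices

/-- A derivator: a prederivator satisfying (Der1)-(Der4). -/
class IsDerivator (D : Prederivator.{w, v, u} 𝒟) : Prop extends HasKan D where
  der1 : ∀ (I : Type w) (K : I → Type w) [∀ i, SmallCategory (K i)] [∀ i, 𝒟.Has (K i)],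
    (Functor.pi' fun i => D.map (Sigma.incl (C := K) i)).IsEquivalence
  der2 : ∀ {K : Type w} [SmallCategory K] [𝒟.Has K] {X Y : D.obj K} (f : X ⟶ Y),
    (∀ k : K, IsIso ((D.map (pt k)).map f)) → IsIso f
  der4_left : ∀ {J K : Type w} [SmallCategory J] [SmallCategory K] [𝒟.Has J] [𝒟.Has K]
    (t : J ⥤ K) (k : K), IsIso (D.leftMate (overCell t k))
  der4_right : ∀ {J K : Type w} [SmallCategory J] [SmallCategory K] [𝒟.Has J] [𝒟.Has K]
    (t : J ⥤ K) (k : K), IsIso (D.rightMate (underCell t k))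

/-- A (pre)derivator is pointed if its base has a zero object. -/
def IsPointed (D : Prederivator.{w, v, u} 𝒟) : Prop := HasZeroObject (D.obj Pt.{w})

/-- A (homotopy) finite category: it has finitely many objects and morphisms, and no morphisms
going in circles except identities.  Equivalently, its nerve has finitely many nondegenerate
simplices. -/
structure IsFiniteShape (K : Type w) [SmallCategory K] : Prop where
  finite_obj : Finite K
  finite_hom : ∀ x y : K, Finite (x ⟶ y)
  endo_eq_id : ∀ (x : K) (f : x ⟶ x), f = 𝟙 x
  eq_of_hom : ∀ (x y : K), (x ⟶ y) → (y ⟶ x) → x = y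

/-- `c : π_{A,!} p_* Y ⟶ π_{B,*} q_! Y`, where `p : A × B ⥤ A` and `q : A × B ⥤ B` are the
projections, is the canonical comparison morphism from the colimit of the limit to the limit of
the colimit: its transpose `π_B^* π_{A,!} p_* Y ⟶ q_! Y` corresponds to
`q_!(counit) : q_! p^* p_* Y ⟶ q_! Y` under the base change isomorphism
`q_! p^* ⟶ π_B^* π_{A,!}`.  In a derivator there is exactly one such `c`. -/
def IsInterchange (D : Prederivator.{w, v, u} 𝒟) [D.HasKan] (A B : Type w) [SmallCategory A]
    [SmallCategory B] [𝒟.Has A] [𝒟.Has B] (Y : D.obj (A × B))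
    (c : (D.lan (toPt A)).obj ((D.ran (CategoryTheory.Prod.fst A B)).obj Y) ⟶
      (D.ran (toPt B)).obj ((D.lan (CategoryTheory.Prod.snd A B)).obj Y)) : Prop :=
  (D.leftMate (a := CategoryTheory.Prod.fst A B) (b := toPt A) (c := CategoryTheory.Prod.snd A B)
      (d := toPt B) (𝟙 _)).app ((D.ran (CategoryTheory.Prod.fst A B)).obj Y) ≫
    (D.map (toPt B)).map c ≫ (D.ranAdj (toPt B)).counit.app _ =
  (D.lan (CategoryTheory.Prod.snd A B)).map
    ((D.ranAdj (CategoryTheory.Prod.fst A B)).counit.app Y)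

/-- A derivator is regular if filtered colimits commute with finite limits, i.e. the canonical
comparison morphism is an isomorphism. -/
def IsRegular (D : Prederivator.{w, v, u} 𝒟) [D.HasKan] : Prop :=
  ∀ (A B : Type w) [SmallCategory A] [SmallCategory B] [𝒟.Has A] [𝒟.Has B] [IsFiltered A],
    IsFiniteShape B → ∀ Y : D.obj (A × B), ∃ c, D.IsInterchange A B Y c ∧ IsIso c

/-! ### Shifted prederivators and full subprederivators -/

/-- The shifted prederivator `D^A`, with `D^A(K) = D(K × A)`. -/
@[reducible]
def shift (D : Prederivator.{w, v, u} 𝒟) (A : Type w) [SmallCategory A] [𝒟.Has A] :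
    Prederivator.{w, v, u} 𝒟 where
  obj K := D.obj (K × A)
  map t := D.map (t.prod (𝟭 A))
  map₂ α := D.map₂ (NatTrans.prod α (𝟙 (𝟭 A)))
  map_id K := D.map_id (K × A)
  map_comp s t := D.map_comp (s.prod (𝟭 A)) (t.prod (𝟭 A))
  map₂_id t := D.map₂_id (t.prod (𝟭 A))
  map₂_comp α β := by
    rw [← D.map₂_comp]
    congr 1
    ext x <;> simp
  map₂_whiskerLeft t _ _ α :=
    D.map₂_whiskerLeft (t.prod (𝟭 A)) (NatTrans.prod α (𝟙 (𝟭 A)))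
  map₂_whiskerRight β t := by
    refine Eq.trans ?_
      (D.map₂_whiskerRight (NatTrans.prod β (𝟙 (𝟭 A))) (t.prod (𝟭 A)))
    congr 1

instance shift_hasKan (D : Prederivator.{w, v, u} 𝒟) [D.HasKan] (A : Type w) [SmallCategory A]
    [𝒟.Has A] : (D.shift A).HasKan where
  isRightAdjoint t := HasKan.isRightAdjoint (D := D) (t.prod (𝟭 A))
  isLeftAdjoint t := HasKan.isLeftAdjoint (D := D) (t.prod (𝟭 A))

/-- A levelwise property of the objects of `D` is stable under restriction along functors. -/
def PullbackStable (D : Prederivator.{w, v, u} 𝒟)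
    (P : ∀ (K : Type w) [SmallCategory K] [𝒟.Has K], ObjectProperty (D.obj K)) : Prop :=
  ∀ {J K : Type w} [SmallCategory J] [SmallCategory K] [𝒟.Has J] [𝒟.Has K] (t : J ⥤ K)
    (X : D.obj K), P K X → P J ((D.map t).obj X)

section sub

theorem functor_ext_of_comp_ι {B : Type*} [Category* B] {C : Type*} [Category* C]
    {P : ObjectProperty C} {F G : B ⥤ P.FullSubcategory} (h : F ⋙ P.ι = G ⋙ P.ι) : F = G :=
  CategoryTheory.Functor.ext (fun X => ObjectProperty.FullSubcategory.ext (Functor.congr_obj h X))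
    fun X Y f => by
      apply P.ι.map_injective
      simpa [eqToHom_map] using Functor.congr_hom h f

variable (D : Prederivator.{w, v, u} 𝒟)
  (P : ∀ (K : Type w) [SmallCategory K] [𝒟.Has K], ObjectProperty (D.obj K))

/-- The full subprederivator on the objects satisfying a restriction-stable property. -/
@[reducible]
def sub (hP : D.PullbackStable P) : Prederivator.{w, v, u} 𝒟 where
  obj K := (P K).FullSubcategory
  map {J K} _ _ _ _ t := (P J).lift ((P K).ι ⋙ D.map t) fun X => hP t X.obj X.property
  map₂ {J K} _ _ _ _ _ _ α :=
    { app := fun X => ObjectProperty.homMk ((D.map₂ α).app X.obj)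
      naturality := fun X Y f => by
        ext
        exact (D.map₂ α).naturality f.hom }
  map_id K := functor_ext_of_comp_ι (by
    change (P K).ι ⋙ D.map (𝟭 K) = (P K).ι
    rw [D.map_id]; rfl)
  map_comp {I J K} _ _ _ _ _ _ s t := functor_ext_of_comp_ι (by
    change (P K).ι ⋙ D.map (s ⋙ t) = (P K).ι ⋙ D.map t ⋙ D.map s
    rw [D.map_comp])
  map₂_id t := by
    ext X
    simp [D.map₂_id]
  map₂_comp α β := by
    ext X
    simp [D.map₂_comp]
  map₂_whiskerLeft {I J K} _ _ _ _ _ _ t _ _ α := by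
    refine NatTrans.ext (funext fun X => (P I).ι.map_injective ?_)
    refine (congrArg (fun η => η.app X.obj) (D.map₂_whiskerLeft t α)).trans ?_
    simp only [NatTrans.comp_app, Functor.map_comp, eqToHom_app, eqToHom_map]
    rfl
  map₂_whiskerRight {I J K} _ _ _ _ _ _ _ _ β t := by
    refine NatTrans.ext (funext fun X => (P I).ι.map_injective ?_)
    refine (congrArg (fun η => η.app X.obj) (D.map₂_whiskerRight β t)).trans ?_
    simp only [NatTrans.comp_app, Functor.map_comp, eqToHom_app, eqToHom_map]
    rfl

/-- The inclusion of a full subprederivator. -/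
def subIncl (hP : D.PullbackStable P) : Morphism (D.sub P hP) D where
  app K := (P K).ι
  γ {J K} _ _ _ _ t := Iso.refl ((P K).ι ⋙ D.map t)
  γ_id := by intros; rfl
  γ_comp s t X := by
    simp
  γ_map₂ α X := by
    simp

end sub

end Prederivator

/-! ### The diagram shapes -/

/-- The square `□ = {0 < 1} × {0 < 1}`. -/
@[ext]
structure Sq : Type w where
  /-- the first coordinate -/
  a : Bool
  /-- the second coordinate -/
  b : Bool

instance : PartialOrder Sq.{w} where
  le p q := p.a ≤ q.a ∧ p.b ≤ q.b
  le_refl _ := ⟨le_rfl, le_rfl⟩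
  le_trans _ _ _ h h' := ⟨h.1.trans h'.1, h.2.trans h'.2⟩
  le_antisymm _ _ h h' := Sq.ext (le_antisymm h.1 h'.1) (le_antisymm h.2 h'.2)

/-- The full subcategory `⌝` of `□` lacking `(0,0)`. -/
abbrev SqUR : Type w := {p : Sq.{w} // p ≠ ⟨false, false⟩}

/-- The inclusion of `⌝` in `□`. -/
def SqUR.incl : SqUR.{w} ⥤ Sq.{w} := Monotone.functor (f := Subtype.val) fun _ _ h => h

/-- The cone on `□`: an initial object `⊥` is added to `□`. -/
abbrev SqCone : Type w := WithBot Sq.{w}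

/-- The functor from `□` to its cone which sends `(0,0)` to the new initial object and is the
identity elsewhere. -/
def Sq.toCone : Sq.{w} ⥤ SqCone.{w} :=
  Monotone.functor (f := fun p => if p.a = false ∧ p.b = false then ⊥ else (p : SqCone.{w}))
    (by
      rintro ⟨a, b⟩ ⟨a', b'⟩ ⟨h, h'⟩
      have key : (⟨a, b⟩ : Sq.{w}) ≤ ⟨a', b'⟩ := ⟨h, h'⟩
      dsimp only
      split_ifs with h₁ h₂ h₂
      · exact bot_le
      · exact bot_le
      · exact (h₁ ⟨le_bot_iff.1 (h.trans_eq h₂.1), le_bot_iff.1 (h'.trans_eq h₂.2)⟩).elim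
      · exact WithBot.coe_le_coe.2 key)

/-- The poset `V` of the pairs `(i, j)` of integers with `|i - j| ≤ 1`. -/
@[ext]
structure Strip : Type w where
  /-- the first coordinate -/
  i : ℤ
  /-- the second coordinate -/
  j : ℤ
  near : |i - j| ≤ 1

instance : PartialOrder Strip.{w} where
  le p q := p.i ≤ q.i ∧ p.j ≤ q.j
  le_refl _ := ⟨le_rfl, le_rfl⟩
  le_trans _ _ _ h h' := ⟨h.1.trans h'.1, h.2.trans h'.2⟩
  le_antisymm _ _ h h' := Strip.ext (le_antisymm h.1 h'.1) (le_antisymm h.2 h'.2)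

theorem Strip.le_iff {v v' : Strip.{w}} : v ≤ v' ↔ v.i ≤ v'.i ∧ v.j ≤ v'.j := Iff.rfl

/-- The full subposet `∂V` of `V` of the pairs with `|i - j| = 1`. -/
abbrev StripBd : Type w := {v : Strip.{w} // |v.i - v.j| = 1}

/-- The inclusion of `∂V` in `V`. -/
def StripBd.incl : StripBd.{w} ⥤ Strip.{w} := Monotone.functor (f := Subtype.val) fun _ _ h => h

/-- The shift with a twist `σ : V ⥤ V`, `(i, j) ↦ (j + 1, i + 1)`. -/
def Strip.σ : Strip.{w} ⥤ Strip.{w} :=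
  Monotone.functor
    (f := fun v => ⟨v.j + 1, v.i + 1, by have := abs_le.1 v.near; rw [abs_le]; omega⟩)
    (by
      intro v v' h
      obtain ⟨h₁, h₂⟩ := Strip.le_iff.1 h
      exact Strip.le_iff.2 ⟨by simpa using h₂, by simpa using h₁⟩)

/-- The map `w : □ × V ⥤ V` on objects. -/
def Strip.w (p : Sq.{w}) (v : Strip.{w}) : Strip.{w} :=
  match p.a, p.b with
  | false, false => v
  | true, true => ⟨v.j + 1, v.i + 1, by have := abs_le.1 v.near; rw [abs_le]; omega⟩
  | true, false => ⟨v.j + 1, v.j, by simp⟩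
  | false, true => ⟨v.i, v.i + 1, by simp⟩

theorem Strip.w_mono {p q : Sq.{w}} {v v' : Strip.{w}} (hp : p ≤ q) (hv : v ≤ v') :
    Strip.w p v ≤ Strip.w q v' := by
  obtain ⟨a, b⟩ := p
  obtain ⟨a', b'⟩ := q
  obtain ⟨h₁, h₂⟩ := hp
  obtain ⟨h₃, h₄⟩ := Strip.le_iff.1 hv
  have h₅ := abs_le.1 v.near
  have h₆ := abs_le.1 v'.near
  rw [Strip.le_iff]
  cases a <;> cases b <;> cases a' <;> cases b' <;>
    first
    | exact absurd h₁ (by decide)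
    | exact absurd h₂ (by decide)
    | (simp only [Strip.w]; omega)

/-- The full subposet `V^{≥ 0}` of `V` of the pairs with nonnegative coordinates. -/
abbrev StripNonneg : Type w := {v : Strip.{w} // 0 ≤ v.i ∧ 0 ≤ v.j}

/-- The object `(0, 0)` of `V^{≥ 0}`. -/
def StripNonneg.zero : StripNonneg.{w} := ⟨⟨0, 0, by simp⟩, le_rfl, le_rfl⟩

/-- The map `ω : V^{≥ 0} × V ⥤ V` on objects: for fixed `(i, j)` it is the diagram of shape
`V^{≥ 0}` with entries
`(n, n) ↦ (i + n, j + n)`, `(n + 1, n) ↦ (j + n + 1, j + n)`, `(n, n + 1) ↦ (i + n, i + n + 1)`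
for `n` even, and the same with `i` and `j` exchanged for `n` odd. -/
def Strip.ω (p : StripNonneg.{w}) (v : Strip.{w}) : Strip.{w} where
  i := (if Even p.1.i then v.i else v.j) + p.1.i
  j := (if Even p.1.j then v.j else v.i) + p.1.j
  near := by
    have h₁ := abs_le.1 p.1.near
    have h₂ := abs_le.1 v.near
    rw [abs_le]
    simp only [Int.even_iff]
    split_ifs <;> omega

theorem Strip.ω_mono {p q : StripNonneg.{w}} {v v' : Strip.{w}} (hp : p ≤ q) (hv : v ≤ v') :
    Strip.ω p v ≤ Strip.ω q v' := by
  obtain ⟨h₁, h₂⟩ := Strip.le_iff.1 (show p.1 ≤ q.1 from hp)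
  obtain ⟨h₃, h₄⟩ := Strip.le_iff.1 hv
  have h₅ := abs_le.1 v.near
  have h₆ := abs_le.1 v'.near
  rw [Strip.le_iff]
  simp only [Strip.ω, Int.even_iff]
  constructor <;> split_ifs <;> omega

/-- The poset `ℕ`. -/
abbrev NatShape : Type w := ULift.{w} ℕ

/-- The poset `V^{≥ 0} × ℕ`. -/
@[ext]
structure StripNat : Type w where
  /-- the component in `V^{≥ 0}` -/
  p : StripNonneg.{w}
  /-- the component in `ℕ` -/
  k : ℕ

instance : PartialOrder StripNat.{w} where
  le x y := x.p ≤ y.p ∧ x.k ≤ y.k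
  le_refl _ := ⟨le_rfl, le_rfl⟩
  le_trans _ _ _ h h' := ⟨h.1.trans h'.1, h.2.trans h'.2⟩
  le_antisymm _ _ h h' := StripNat.ext (le_antisymm h.1 h'.1) (le_antisymm h.2 h'.2)

/-- The full subposet `Z` of `V^{≥ 0} × ℕ` of the `(i, j, k)` with `k ≤ i` if `i = j`. -/
abbrev StripZ : Type w := {x : StripNat.{w} // x.p.1.i = x.p.1.j → (x.k : ℤ) ≤ x.p.1.i}

/-- The inclusion `f : Z ⥤ V^{≥ 0} × ℕ`. -/
def StripZ.incl : StripZ.{w} ⥤ StripNat.{w} := Monotone.functor (f := Subtype.val) fun _ _ h => h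

/-- The projection `ζ : Z ⥤ V^{≥ 0}`. -/
def StripZ.ζ : StripZ.{w} ⥤ StripNonneg.{w} :=
  Monotone.functor (f := fun x => x.1.p) fun _ _ h => h.1

/-- The inclusion of the column `{(0, 0)} × ℕ` in `V^{≥ 0} × ℕ`. -/
def StripNat.column : NatShape.{w} ⥤ StripNat.{w} :=
  Monotone.functor (f := fun k => ⟨StripNonneg.zero, k.down⟩) fun _ _ h => ⟨le_rfl, h⟩

/-- The functor `(K × P) × V ⥤ K × V`, `((k, p), v) ↦ (k, m p v)`, for a monotone map
`m : P × V → V`. -/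
def twist {P : Type w} [PartialOrder P] (m : P → Strip.{w} → Strip.{w})
    (hm : ∀ {p q : P} {v v' : Strip.{w}}, p ≤ q → v ≤ v' → m p v ≤ m q v')
    (K : Type w) [SmallCategory K] : (K × P) × Strip.{w} ⥤ K × Strip.{w} where
  obj x := (x.1.1, m x.1.2 x.2)
  map f := CategoryTheory.Prod.mkHom f.1.1 (homOfLE (hm (leOfHom f.1.2) (leOfHom f.2)))

/-- The natural transformation between the inclusions `k ↦ (k, p)` and `k ↦ (k, q)` given by a
relation `p ≤ q`. -/
def sectHom (K : Type w) [SmallCategory K] {P : Type w} [PartialOrder P] {p q : P} (h : p ≤ q) :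
    CategoryTheory.Prod.sectL K p ⟶ CategoryTheory.Prod.sectL K q where
  app k := CategoryTheory.Prod.mkHom (𝟙 k) (homOfLE h)
  naturality _ _ f := CategoryTheory.Prod.hom_ext
    ((Category.comp_id f).trans (Category.id_comp f).symm) (Subsingleton.elim _ _)

/-- The iterates of an endofunctor. -/
def iterFunctor {C : Type u} [Category.{v} C] (T : C ⥤ C) : ℕ → (C ⥤ C)
  | 0 => 𝟭 C
  | n + 1 => iterFunctor T n ⋙ T

/-- Horizontal pasting of two squares of functors. -/
def pasteSquares {A₀ A₁ A₂ B₀ B₁ B₂ : Type*} [Category* A₀] [Category* A₁] [Category* A₂]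
    [Category* B₀] [Category* B₁] [Category* B₂] {F : A₀ ⥤ A₁} {G : A₁ ⥤ A₂} {F' : B₀ ⥤ B₁}
    {G' : B₁ ⥤ B₂} {m₀ : A₀ ⥤ B₀} {m₁ : A₁ ⥤ B₁} {m₂ : A₂ ⥤ B₂} (α : F ⋙ m₁ ⟶ m₀ ⋙ F')
    (β : G ⋙ m₂ ⟶ m₁ ⋙ G') : (F ⋙ G) ⋙ m₂ ⟶ m₀ ⋙ (F' ⋙ G') :=
  Functor.whiskerLeft F β ≫ Functor.whiskerRight α G'

namespace Prederivator

variable {𝒟 : DiagramClass.{w}}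

/-! ### Loops, prespectra and spectra -/

/-- The loop functor `Ω`: extend by zero along `(1,1) : e ⥤ ⌝`, then right Kan extend along
`⌝ ⥤ □`, then evaluate at `(0,0)`. -/
noncomputable def loop (E : Prederivator.{w, v, u} 𝒟) [E.HasKan] (K : Type w) [SmallCategory K]
    [𝒟.Has K] : E.obj K ⥤ E.obj K :=
  E.lan (CategoryTheory.Prod.sectL K (⟨⟨true, true⟩, by simp⟩ : SqUR.{w})) ⋙
    E.ran ((𝟭 K).prod SqUR.incl.{w}) ⋙
      E.map (CategoryTheory.Prod.sectL K (⟨false, false⟩ : Sq.{w}))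

/-- Objects of `D^V` that vanish on `∂V`. -/
def IsPrespectrum (D : Prederivator.{w, v, u} 𝒟) (K : Type w) [SmallCategory K] [𝒟.Has K] :
    ObjectProperty ((D.shift Strip.{w}).obj K) :=
  fun X => IsZero ((D.map ((𝟭 K).prod StripBd.incl.{w})).obj X)

theorem isZero_obj_of_adjoints {C C' : Type*} [Category* C] [Category* C'] (F : C ⥤ C')
    [F.IsLeftAdjoint] [F.IsRightAdjoint] {X : C} (hX : IsZero X) : IsZero (F.obj X) where
  unique_to Y :=
    have := (hX.unique_to (F.rightAdjoint.obj Y)).some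
    ⟨((Adjunction.ofIsLeftAdjoint F).homEquiv X Y).unique⟩
  unique_from Y :=
    have := (hX.unique_from (F.leftAdjoint.obj Y)).some
    ⟨((Adjunction.ofIsRightAdjoint F).homEquiv Y X).symm.unique⟩

theorem isPrespectrum_stable (D : Prederivator.{w, v, u} 𝒟) [D.HasKan] :
    (D.shift Strip.{w}).PullbackStable D.IsPrespectrum := by
  intro J K _ _ _ _ t X hX
  have h := Functor.congr_obj (D.map_comp ((𝟭 J).prod StripBd.incl.{w}) (t.prod (𝟭 Strip.{w}))) X
  have h' := Functor.congr_obj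
    (D.map_comp (t.prod (𝟭 StripBd.{w})) ((𝟭 K).prod StripBd.incl.{w})) X
  have h'' := isZero_obj_of_adjoints (D.map (t.prod (𝟭 StripBd.{w}))) hX
  change IsZero ((D.map ((𝟭 J).prod StripBd.incl.{w})).obj ((D.map (t.prod (𝟭 Strip.{w}))).obj X))
  exact (congrArg IsZero (h.symm.trans h')).mpr h''

/-- The prederivator of prespectrum objects `Sp D`, the full subprederivator of `D^V` on the
objects that vanish on `∂V`. -/
@[reducible]
def Sp (D : Prederivator.{w, v, u} 𝒟) [D.HasKan] : Prederivator.{w, v, u} 𝒟 :=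
  (D.shift Strip.{w}).sub D.IsPrespectrum D.isPrespectrum_stable

section spectra

variable (D : Prederivator.{w, v, u} 𝒟) (K : Type w) [SmallCategory K] [𝒟.Has K]

/-- The endofunctor `σ^*`. -/
def sigmaStar : (D.shift Strip.{w}).obj K ⥤ (D.shift Strip.{w}).obj K :=
  D.map ((𝟭 K).prod Strip.σ.{w})

/-- Restriction along `((k, p), v) ↦ (k, m p v)`. -/
def twistStar {P : Type w} [PartialOrder P] (m : P → Strip.{w} → Strip.{w})
    (hm : ∀ {p q : P} {v v' : Strip.{w}}, p ≤ q → v ≤ v' → m p v ≤ m q v') :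
    (D.shift Strip.{w}).obj K ⥤ (D.shift Strip.{w}).obj (K × P) :=
  D.map (twist m hm K)

variable [D.HasKan]

/-- The coherent diagram of shape the cone on `□` from which `φ_X` is read off: the right Kan
extension along `□ ⥤ SqCone` of `w^* X`. -/
noncomputable def phiDiagram :
    (D.shift Strip.{w}).obj K ⥤ (D.shift Strip.{w}).obj (K × SqCone.{w}) :=
  D.twistStar K Strip.w Strip.w_mono ⋙ (D.shift Strip.{w}).ran ((𝟭 K).prod Sq.toCone.{w})

/-- The source of `φ`, which is canonically isomorphic to `X` on prespectra. -/
noncomputable def phiSource : (D.shift Strip.{w}).obj K ⥤ (D.shift Strip.{w}).obj K :=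
  D.phiDiagram K ⋙ (D.shift Strip.{w}).map (CategoryTheory.Prod.sectL K (⊥ : SqCone.{w}))

/-- The target of `φ`, which is canonically isomorphic to `Ω σ^* X` on prespectra. -/
noncomputable def phiTarget : (D.shift Strip.{w}).obj K ⥤ (D.shift Strip.{w}).obj K :=
  D.phiDiagram K ⋙ (D.shift Strip.{w}).map
    (CategoryTheory.Prod.sectL K (((⟨false, false⟩ : Sq.{w}) : SqCone.{w})))

/-- The canonical map `φ_X : X ⟶ Ω σ^* X`. -/
noncomputable def phi : D.phiSource K ⟶ D.phiTarget K :=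
  Functor.whiskerLeft (D.phiDiagram K) ((D.shift Strip.{w}).map₂ (sectHom K bot_le))

/-! ### The tower `X ⟶ Ω σ^* X ⟶ Ω² (σ^*)² X ⟶ ⋯` and its homotopy colimit -/

/-- The coherent diagram `F X` of shape `ℕ`, given incoherently by
`X ⟶ Ω σ^* X ⟶ Ω² (σ^*)² X ⟶ ⋯`: the composite of `ω^*`, `ζ^*`, `f_*` and restriction to the
column over `(0, 0)`. -/
noncomputable def tower :
    (D.shift Strip.{w}).obj K ⥤ (D.shift Strip.{w}).obj (K × NatShape.{w}) :=
  D.twistStar K Strip.ω Strip.ω_mono ⋙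
    (D.shift Strip.{w}).map ((𝟭 K).prod StripZ.ζ.{w}) ⋙
      (D.shift Strip.{w}).ran ((𝟭 K).prod StripZ.incl.{w}) ⋙
        (D.shift Strip.{w}).map ((𝟭 K).prod StripNat.column.{w})

/-- The `n`-th object of the tower. -/
noncomputable def towerObj (n : ℕ) : (D.shift Strip.{w}).obj K ⥤ (D.shift Strip.{w}).obj K :=
  D.tower K ⋙ (D.shift Strip.{w}).map (CategoryTheory.Prod.sectL K (ULift.up n : NatShape.{w}))

/-- The `n`-th transition map of the tower. -/
noncomputable def towerMap (n : ℕ) : D.towerObj K n ⟶ D.towerObj K (n + 1) :=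
  Functor.whiskerLeft (D.tower K)
    ((D.shift Strip.{w}).map₂
      (sectHom K (show (ULift.up n : NatShape.{w}) ≤ ULift.up (n + 1) from Nat.le_succ n)))

/-- The endofunctor `Ωⁿ (σ^*)ⁿ`. -/
noncomputable def loopShift (n : ℕ) : (D.shift Strip.{w}).obj K ⥤ (D.shift Strip.{w}).obj K :=
  iterFunctor (D.sigmaStar K) n ⋙ iterFunctor ((D.shift Strip.{w}).loop K) n

/-- The sequential homotopy colimit `π_! F X` of the tower, where `π : K × ℕ ⥤ K`. -/
noncomputable def towerColim : (D.shift Strip.{w}).obj K ⥤ (D.shift Strip.{w}).obj K :=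
  D.tower K ⋙ (D.shift Strip.{w}).lan (CategoryTheory.Prod.fst K NatShape.{w})

end spectra

/-- The Ω-spectra: the prespectra `X` for which `φ_X` is an isomorphism. -/
def IsOmegaSpectrum (D : Prederivator.{w, v, u} 𝒟) [D.HasKan] (K : Type w) [SmallCategory K]
    [𝒟.Has K] : ObjectProperty (D.Sp.obj K) :=
  fun X => IsIso ((D.phi K).app X.obj)

section baseChange

variable (D : Prederivator.{w, v, u} 𝒟) [D.HasKan] {J K : Type w} [SmallCategory J]
  [SmallCategory K] [𝒟.Has J] [𝒟.Has K] (t : J ⥤ K)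

/-- The canonical comparison `(t × id)^* F_K ⟶ F_J t^*` for the tower `F`, composed of the
identities for the restriction functors and of the mate for the right Kan extension. -/
noncomputable def towerBaseChange :
    D.tower K ⋙ (D.shift Strip.{w}).map (t.prod (𝟭 NatShape.{w})) ⟶
      (D.shift Strip.{w}).map t ⋙ D.tower J :=
  pasteSquares (m₁ := (D.shift Strip.{w}).map (t.prod (𝟭 StripNonneg.{w})))
    (D.cell (a := (t.prod (𝟭 StripNonneg.{w})).prod (𝟭 Strip.{w}))
      (b := twist Strip.ω Strip.ω_mono K) (c := twist Strip.ω Strip.ω_mono J)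
      (d := t.prod (𝟭 Strip.{w})) (𝟙 _)) <|
  pasteSquares (m₁ := (D.shift Strip.{w}).map (t.prod (𝟭 StripZ.{w})))
    ((D.shift Strip.{w}).cell (a := t.prod (𝟭 StripZ.{w})) (b := (𝟭 K).prod StripZ.ζ.{w})
      (c := (𝟭 J).prod StripZ.ζ.{w}) (d := t.prod (𝟭 StripNonneg.{w})) (𝟙 _)) <|
  pasteSquares (m₁ := (D.shift Strip.{w}).map (t.prod (𝟭 StripNat.{w})))
    ((D.shift Strip.{w}).rightMate (a := (𝟭 J).prod StripZ.incl.{w})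
      (b := t.prod (𝟭 StripNat.{w})) (c := t.prod (𝟭 StripZ.{w}))
      (d := (𝟭 K).prod StripZ.incl.{w}) (𝟙 _))
    ((D.shift Strip.{w}).cell (a := t.prod (𝟭 NatShape.{w}))
      (b := (𝟭 K).prod StripNat.column.{w}) (c := (𝟭 J).prod StripNat.column.{w})
      (d := t.prod (𝟭 StripNat.{w})) (𝟙 _))

/-- The canonical comparison `π_! (t × id)^* ⟶ t^* π_!`. -/
noncomputable def colimBaseChange :
    (D.shift Strip.{w}).map (t.prod (𝟭 NatShape.{w})) ⋙
        (D.shift Strip.{w}).lan (CategoryTheory.Prod.fst J NatShape.{w}) ⟶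
      (D.shift Strip.{w}).lan (CategoryTheory.Prod.fst K NatShape.{w}) ⋙
        (D.shift Strip.{w}).map t :=
  (D.shift Strip.{w}).leftMate (a := t.prod (𝟭 NatShape.{w}))
    (b := CategoryTheory.Prod.fst K NatShape.{w}) (c := CategoryTheory.Prod.fst J NatShape.{w})
    (d := t) (𝟙 _)

end baseChange

/-- The prederivator `St D` of Ω-spectra, given that Ω-spectra are stable under restriction. -/
@[reducible]
def St (D : Prederivator.{w, v, u} 𝒟) [D.HasKan] (h : D.Sp.PullbackStable D.IsOmegaSpectrum) :
    Prederivator.{w, v, u} 𝒟 :=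
  D.Sp.sub D.IsOmegaSpectrum h

/-- The inclusion `i : St D ⟶ Sp D`. -/
def stIncl (D : Prederivator.{w, v, u} 𝒟) [D.HasKan]
    (h : D.Sp.PullbackStable D.IsOmegaSpectrum) : Morphism (D.St h) D.Sp :=
  D.Sp.subIncl D.IsOmegaSpectrum h

/-- The family `θ` of natural isomorphisms from `π_! F` to `loc` (both seen as functors from
`Sp D (K)` to `D^V (K)`) is an isomodification: it is compatible with the structure isomorphisms
of `loc` and the canonical comparisons for `π_!` and `F`. -/
def IsTowerColimIso (D : Prederivator.{w, v, u} 𝒟) [D.HasKan]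
    {h : D.Sp.PullbackStable D.IsOmegaSpectrum} (loc : Morphism D.Sp (D.St h))
    (θ : ∀ (K : Type w) [SmallCategory K] [𝒟.Has K],
      (D.IsPrespectrum K).ι ⋙ D.towerColim K ≅
        loc.app K ⋙ (D.IsOmegaSpectrum K).ι ⋙ (D.IsPrespectrum K).ι) : Prop :=
  ∀ {J K : Type w} [SmallCategory J] [SmallCategory K] [𝒟.Has J] [𝒟.Has K] (t : J ⥤ K)
    (X : D.Sp.obj K),
    (D.colimBaseChange t).app ((D.tower K).obj X.obj) ≫
        ((D.shift Strip.{w}).map t).map ((θ K).hom.app X) ≫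
          ((D.IsOmegaSpectrum J).ι ⋙ (D.IsPrespectrum J).ι).map ((loc.γ t).hom.app X) =
      ((D.shift Strip.{w}).lan (CategoryTheory.Prod.fst J NatShape.{w})).map
          ((D.towerBaseChange t).app X.obj) ≫
        (θ J).hom.app ((D.Sp.map t).obj X)

end Prederivator

/-! A prespectrum `X` is an Ω-spectrum exactly when all squares of `w^* X` are cartesian:
`phiSquare` maps `w^* X` to the cartesian square on the same corner, and `φ` is its component at the
lower left (`isIso_phi_app_iff`). This concerns individual squares of `X`, so it is stable under
restriction.

For the localization, `F X` is compared with a diagram `straight` having one more coordinate `m` in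
`ℤ`. In height `m` it keeps the values of `X` at the points off the diagonal and at `(i,i)` with `i
≥ m`, and it is right Kan extended from there. For a prespectrum its value at `(i,i)` with `i < m`
is therefore the `(m-i)`-fold loop object of the value of `X` at `(m,m)`, and the squares at `(i,i)`
with `i < m` are cartesian (`isCartSq_straight`). Let `L` be its colimit in the direction of `m`.

`L` is an Ω-spectrum: for fixed `i` the heights `m > i` are cofinal, the squares there are
cartesian, and regularity carries this finite limit to the colimit (`isCartSq_diag_of_isLan`);
squares based on the boundary consist of zeros.

`L` is universal: a map from `L` to an Ω-spectrum `Y` is a map from `straight` to the constant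
diagram on `Y`. That constant diagram is itself right Kan extended from the part where `straight`
agrees with `X` (`isRanExt_intProj`), so such maps are the maps between the constant diagrams on `X`
and `Y`, that is, the maps from `X` to `Y`. Regularity is not needed for this half
(`IsPointed.toColim_bijective`).

`L` is `π_! F X`: at `v = (i,i)` the `n`-th stage of the tower is `straight` in height `i + n`, and
on the boundary both vanish (`isIso_map_pt_comparison`). Everything commutes with restriction in the
parameter `K`, and a reflection with this compatibility is automatically a left adjoint morphism
(`Reflection`).

For the terms of the tower, the square at the origin in height `n+1` is cartesian with zeros at the
off-diagonal corners, and its upper right corner is the `n`-th stage for `σ^* X`, because a shift of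
`V^{≥0} × ℕ` turns the tower diagram of `X` into that of `σ^* X`. This gives the induction step. In
height `0` the square is `w^* X`; its transition to the cartesian square in height `1` is invertible
on corners, and such a map is determined by its source (`nonempty_arrow_iso`), so it yields `φ`. The
induction also uses that `σ^*` commutes with `φ`, by the symmetry of the square.

Technically, Kan extensions are universal arrows (`IsRan`, `IsLan`), evaluated by (Der4). Slices are
replaced by posets adjoint to them, and over a product of `K` with posets this amounts to finding a
greatest or least element (`RanData.of_poset`, `LanData.of_poset`). -/

namespace Prederivator

variable {𝒟 : DiagramClass.{w}} (D : Prederivator.{w, v, u} 𝒟)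

/-! ### Calculus in a strict 2-functor -/

section calculus

variable {I J K : Type w} [SmallCategory I] [SmallCategory J] [SmallCategory K]
  [𝒟.Has I] [𝒟.Has J] [𝒟.Has K]

/-- The identity of `(u ∘ t)^*` with `t^* u^*`, as an isomorphism. -/
def mapComp (t : I ⥤ J) (u : J ⥤ K) : D.map (t ⋙ u) ≅ D.map u ⋙ D.map t :=
  eqToIso (D.map_comp t u)

theorem map_comp_obj (t : I ⥤ J) (u : J ⥤ K) (X : D.obj K) :
    (D.map (t ⋙ u)).obj X = (D.map t).obj ((D.map u).obj X) :=
  Functor.congr_obj (D.map_comp t u) X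

theorem map_id_obj (X : D.obj K) : (D.map (𝟭 K)).obj X = X :=
  Functor.congr_obj (D.map_id K) X

@[simp]
theorem mapComp_hom_app (t : I ⥤ J) (u : J ⥤ K) (X : D.obj K) :
    (D.mapComp t u).hom.app X = eqToHom (D.map_comp_obj t u X) := by
  simp [mapComp]

theorem map_comp_map (t : I ⥤ J) (u : J ⥤ K) {X Y : D.obj K} (f : X ⟶ Y) :
    (D.map (t ⋙ u)).map f = eqToHom (D.map_comp_obj t u X) ≫ (D.map t).map ((D.map u).map f) ≫
      eqToHom (D.map_comp_obj t u Y).symm :=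
  Functor.congr_hom (D.map_comp t u) f

theorem map_id_map {X Y : D.obj K} (f : X ⟶ Y) :
    (D.map (𝟭 K)).map f = eqToHom (D.map_id_obj X) ≫ f ≫ eqToHom (D.map_id_obj Y).symm :=
  Functor.congr_hom (D.map_id K) f

theorem map₂_whiskerLeft_app (t : I ⥤ J) {u u' : J ⥤ K} (α : u ⟶ u') (X : D.obj K) :
    (D.map₂ (Functor.whiskerLeft t α)).app X = eqToHom (D.map_comp_obj t u X) ≫
      (D.map t).map ((D.map₂ α).app X) ≫ eqToHom (D.map_comp_obj t u' X).symm := by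
  simp [D.map₂_whiskerLeft]

theorem map₂_whiskerRight_app {t t' : I ⥤ J} (β : t ⟶ t') (u : J ⥤ K) (X : D.obj K) :
    (D.map₂ (Functor.whiskerRight β u)).app X = eqToHom (D.map_comp_obj t u X) ≫
      (D.map₂ β).app ((D.map u).obj X) ≫ eqToHom (D.map_comp_obj t' u X).symm := by
  simp [D.map₂_whiskerRight]

theorem map₂_comp_app {u u' u'' : J ⥤ K} (α : u ⟶ u') (β : u' ⟶ u'') (X : D.obj K) :
    (D.map₂ (α ≫ β)).app X = (D.map₂ α).app X ≫ (D.map₂ β).app X := by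
  simp [D.map₂_comp]

theorem map₂_id_app (u : J ⥤ K) (X : D.obj K) :
    (D.map₂ (𝟙 u)).app X = 𝟙 _ := by
  simp [D.map₂_id]

instance isIso_map₂ {u u' : J ⥤ K} (α : u ⟶ u') [IsIso α] : IsIso (D.map₂ α) :=
  ⟨D.map₂ (inv α), by simp [← D.map₂_comp, D.map₂_id], by simp [← D.map₂_comp, D.map₂_id]⟩

/-- The functoriality of restriction in natural transformations. -/
def mapFunctor (J K : Type w) [SmallCategory J] [SmallCategory K] [𝒟.Has J] [𝒟.Has K] :
    (J ⥤ K) ⥤ (D.obj K ⥤ D.obj J) where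
  obj t := D.map t
  map α := D.map₂ α
  map_id t := D.map₂_id t
  map_comp α β := D.map₂_comp α β

/-- Restriction along isomorphic functors. -/
def mapIso {u u' : J ⥤ K} (α : u ≅ u') : D.map u ≅ D.map u' := (D.mapFunctor J K).mapIso α

/-- An adjunction between shapes induces an adjunction between the restriction functors. -/
def mapAdj {l : J ⥤ K} {r : K ⥤ J} (h : l ⊣ r) : D.map r ⊣ D.map l :=
  Adjunction.mkOfUnitCounit
    { unit := eqToHom (D.map_id J).symm ≫ D.map₂ h.unit ≫ eqToHom (D.map_comp l r)
      counit := eqToHom (D.map_comp r l).symm ≫ D.map₂ h.counit ≫ eqToHom (D.map_id K)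
      left_triangle := by
        ext X
        have h0 : Functor.whiskerLeft r h.unit ≫ Functor.whiskerRight h.counit r = 𝟙 (r ⋙ 𝟭 J) := by
          ext; simp
        have h1 := congrArg (fun β => (D.map₂ β).app X) h0
        erw [D.map₂_comp_app, map₂_whiskerLeft_app, map₂_whiskerRight_app, D.map₂_id_app] at h1
        simp only [Category.assoc, eqToHom_trans_assoc, eqToHom_comp_iff] at h1
        simp [eqToHom_map, h1]
      right_triangle := by
        ext X
        have h0 : Functor.whiskerRight h.unit l ≫ Functor.whiskerLeft l h.counit = 𝟙 (𝟭 J ⋙ l) := by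
          ext; simp
        have h1 := congrArg (fun β => (D.map₂ β).app X) h0
        erw [D.map₂_comp_app, map₂_whiskerLeft_app, map₂_whiskerRight_app, D.map₂_id_app] at h1
        simp only [Category.assoc, eqToHom_trans_assoc, eqToHom_comp_iff] at h1
        simp [eqToHom_map, h1] }

end calculus

/-! ### Kan extensions as universal arrows, and mates -/

section ran

variable {D} {I J K : Type w} [SmallCategory I] [SmallCategory J] [SmallCategory K]
  [𝒟.Has I] [𝒟.Has J] [𝒟.Has K]

/-- `κ : u^* E ⟶ Y` exhibits `E` as the right Kan extension of `Y` along `u`. -/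
def IsRan (u : J ⥤ K) {E : D.obj K} {Y : D.obj J} (κ : (D.map u).obj E ⟶ Y) : Prop :=
  ∀ Z : D.obj K, Function.Bijective fun h : Z ⟶ E => (D.map u).map h ≫ κ

/-- `κ : Y ⟶ u^* E` exhibits `E` as the left Kan extension of `Y` along `u`. -/
def IsLan (u : J ⥤ K) {E : D.obj K} {Y : D.obj J} (κ : Y ⟶ (D.map u).obj E) : Prop :=
  ∀ Z : D.obj K, Function.Bijective fun h : E ⟶ Z => κ ≫ (D.map u).map h

/-- The counit `u^* u_* Y ⟶ Y`. -/
noncomputable def ranCounit [D.HasKan] (u : J ⥤ K) (Y : D.obj J) :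
    (D.map u).obj ((D.ran u).obj Y) ⟶ Y := (D.ranAdj u).counit.app Y

/-- The unit `Y ⟶ u^* u_! Y`. -/
noncomputable def lanUnit [D.HasKan] (u : J ⥤ K) (Y : D.obj J) :
    Y ⟶ (D.map u).obj ((D.lan u).obj Y) := (D.lanAdj u).unit.app Y

theorem isRan_counit [D.HasKan] (u : J ⥤ K) (Y : D.obj J) : IsRan u (ranCounit u Y) := fun Z => by
  have := ((D.ranAdj u).homEquiv Z Y).symm.bijective
  convert this using 2
  exact (Adjunction.homEquiv_counit _ _ _ _).symm

theorem isLan_unit [D.HasKan] (u : J ⥤ K) (Y : D.obj J) : IsLan u (lanUnit u Y) := fun Z => by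
  have := ((D.lanAdj u).homEquiv Y Z).bijective
  convert this using 2
  exact (Adjunction.homEquiv_unit _ _ _ _).symm

theorem ranCounit_naturality [D.HasKan] (u : J ⥤ K) {Y Y' : D.obj J} (f : Y ⟶ Y') :
    (D.map u).map ((D.ran u).map f) ≫ ranCounit u Y' = ranCounit u Y ≫ f :=
  (D.ranAdj u).counit.naturality f

theorem lanUnit_naturality [D.HasKan] (u : J ⥤ K) {Y Y' : D.obj J} (f : Y ⟶ Y') :
    f ≫ lanUnit u Y' = lanUnit u Y ≫ (D.map u).map ((D.lan u).map f) :=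
  (D.lanAdj u).unit.naturality f

variable {u : J ⥤ K} {E E' : D.obj K} {Y Y' : D.obj J}

theorem IsRan.hom_ext {κ : (D.map u).obj E ⟶ Y} (hκ : IsRan u κ) {Z : D.obj K} {f g : Z ⟶ E}
    (h : (D.map u).map f ≫ κ = (D.map u).map g ≫ κ) : f = g := (hκ Z).1 h

theorem IsLan.hom_ext {κ : Y ⟶ (D.map u).obj E} (hκ : IsLan u κ) {Z : D.obj K} {f g : E ⟶ Z}
    (h : κ ≫ (D.map u).map f = κ ≫ (D.map u).map g) : f = g := (hκ Z).1 h

/-- A map of right Kan extensions over an isomorphism is an isomorphism. -/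
theorem IsRan.isIso {κ : (D.map u).obj E ⟶ Y} (hκ : IsRan u κ) {κ' : (D.map u).obj E' ⟶ Y'}
    (hκ' : IsRan u κ') (m : E ⟶ E') (y : Y ⟶ Y') [IsIso y]
    (h : (D.map u).map m ≫ κ' = κ ≫ y) : IsIso m := by
  obtain ⟨n, hn⟩ := (hκ E').2 (κ' ≫ inv y)
  dsimp only at hn
  refine ⟨n, hκ.hom_ext ?_, hκ'.hom_ext ?_⟩
  · simp [hn, reassoc_of% h]
  · simp [h, reassoc_of% hn]

theorem IsLan.isIso {κ : Y ⟶ (D.map u).obj E} (hκ : IsLan u κ) {κ' : Y' ⟶ (D.map u).obj E'}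
    (hκ' : IsLan u κ') (m : E ⟶ E') (y : Y ⟶ Y') [IsIso y]
    (h : κ ≫ (D.map u).map m = y ≫ κ') : IsIso m := by
  obtain ⟨n, hn⟩ := (hκ' E).2 (inv y ≫ κ)
  dsimp only at hn
  refine ⟨n, hκ.hom_ext ?_, hκ'.hom_ext ?_⟩
  · simp [hn, reassoc_of% h]
  · simp [h, reassoc_of% hn]

/-- Right Kan extensions are invariant under isomorphism. -/
theorem IsRan.of_iso {κ : (D.map u).obj E ⟶ Y} (hκ : IsRan u κ) {κ' : (D.map u).obj E' ⟶ Y'}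
    (m : E ⟶ E') [IsIso m] (y : Y ⟶ Y') [IsIso y]
    (h : (D.map u).map m ≫ κ' = κ ≫ y) : IsRan u κ' := fun Z => by
  have h' : κ' = (D.map u).map (inv m) ≫ κ ≫ y := by simp [← h]
  constructor
  · intro f g hfg
    have : f ≫ inv m = g ≫ inv m := hκ.hom_ext (by
      have := congrArg (· ≫ inv y) hfg
      simpa [h'] using this)
    simpa using this
  · intro f
    obtain ⟨n, hn⟩ := (hκ Z).2 (f ≫ inv y)
    dsimp only at hn
    exact ⟨n ≫ m, by simp [h, reassoc_of% hn]⟩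

theorem IsLan.of_iso {κ : Y ⟶ (D.map u).obj E} (hκ : IsLan u κ) {κ' : Y' ⟶ (D.map u).obj E'}
    (m : E ⟶ E') [IsIso m] (y : Y ⟶ Y') [IsIso y]
    (h : κ ≫ (D.map u).map m = y ≫ κ') : IsLan u κ' := fun Z => by
  have h' : κ' = inv y ≫ κ ≫ (D.map u).map m := by simp [h]
  constructor
  · intro f g hfg
    have : m ≫ f = m ≫ g := hκ.hom_ext (by simpa [h'] using hfg)
    exact (cancel_epi m).1 this
  · intro f
    obtain ⟨n, hn⟩ := (hκ Z).2 (y ≫ f)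
    dsimp only at hn
    exact ⟨inv m ≫ n, by simp [h', hn]⟩

theorem IsRan.comp {t : I ⥤ J} {W : D.obj I} {κ : (D.map u).obj E ⟶ Y} (hκ : IsRan u κ)
    {ν : (D.map t).obj Y ⟶ W} (hν : IsRan t ν) :
    IsRan (t ⋙ u) (eqToHom (D.map_comp_obj t u E) ≫ (D.map t).map κ ≫ ν) := fun Z => by
  have h := ((hν ((D.map u).obj Z)).comp (hκ Z))
  have h2 := (Equiv.bijective (Iso.homCongr ((D.mapComp t u).app Z).symm (Iso.refl W))).comp h
  convert h2 using 2
  simp [map_comp_map]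

section pull

variable {J₁ J₂ K₁ K₂ : Type w} [SmallCategory J₁]
  [SmallCategory J₂] [SmallCategory K₁] [SmallCategory K₂] [𝒟.Has J₁] [𝒟.Has J₂] [𝒟.Has K₁]
  [𝒟.Has K₂] {a : J₁ ⥤ J₂} {b : J₂ ⥤ K₂} {c : J₁ ⥤ K₁} {d : K₁ ⥤ K₂}

/-- The restriction of a cone `d^* E ⟶ Y` along a 2-cell. -/
def pull (δ : a ⋙ b ⟶ c ⋙ d) {E : D.obj K₂} {Y : D.obj K₁} (κ : (D.map d).obj E ⟶ Y) :
    (D.map a).obj ((D.map b).obj E) ⟶ (D.map c).obj Y :=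
  (D.cell δ).app E ≫ (D.map c).map κ

/-- The restriction of a cocone `Y ⟶ b^* E` along a 2-cell. -/
def push (δ : a ⋙ b ⟶ c ⋙ d) {E : D.obj K₂} {Y : D.obj J₂} (κ : Y ⟶ (D.map b).obj E) :
    (D.map a).obj Y ⟶ (D.map c).obj ((D.map d).obj E) :=
  (D.map a).map κ ≫ (D.cell δ).app E

theorem cell_app (δ : a ⋙ b ⟶ c ⋙ d) (E : D.obj K₂) : (D.cell δ).app E =
    eqToHom (D.map_comp_obj a b E).symm ≫ (D.map₂ δ).app E ≫ eqToHom (D.map_comp_obj c d E) := by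
  simp [cell]

theorem map_pull (δ : a ⋙ b ⟶ c ⋙ d) {E E' : D.obj K₂} {Y Y' : D.obj K₁}
    {κ : (D.map d).obj E ⟶ Y} {κ' : (D.map d).obj E' ⟶ Y'} {m : E ⟶ E'} {y : Y ⟶ Y'}
    (h : (D.map d).map m ≫ κ' = κ ≫ y) :
    (D.map a).map ((D.map b).map m) ≫ pull δ κ' = pull δ κ ≫ (D.map c).map y := by
  have := (D.cell δ).naturality m
  simp only [Functor.comp_map] at this
  simp only [pull, Category.assoc, ← Functor.map_comp, ← h]
  rw [reassoc_of% this, Functor.map_comp]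

theorem map_push (δ : a ⋙ b ⟶ c ⋙ d) {E E' : D.obj K₂} {Y Y' : D.obj J₂}
    {κ : Y ⟶ (D.map b).obj E} {κ' : Y' ⟶ (D.map b).obj E'} {m : E ⟶ E'} {y : Y ⟶ Y'}
    (h : κ ≫ (D.map b).map m = y ≫ κ') :
    push δ κ ≫ (D.map c).map ((D.map d).map m) = (D.map a).map y ≫ push δ κ' := by
  have := (D.cell δ).naturality m
  simp only [Functor.comp_map] at this
  simp only [push, Category.assoc, ← this, ← Functor.map_comp_assoc, h]

theorem map_rightMate_app [D.HasKan] (δ : a ⋙ b ⟶ c ⋙ d) (Y : D.obj K₁) :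
    (D.map a).map ((D.rightMate δ).app Y) ≫ ranCounit a ((D.map c).obj Y) =
      pull δ (ranCounit d Y) :=
  mateEquiv_counit (D.ranAdj d) (D.ranAdj a) (TwoSquare.mk _ _ _ _ (D.cell δ)) Y

theorem lanUnit_leftMate_app [D.HasKan] (δ : a ⋙ b ⟶ c ⋙ d) (Y : D.obj J₂) :
    lanUnit c ((D.map a).obj Y) ≫ (D.map c).map ((D.leftMate δ).app Y) =
      push δ (lanUnit b Y) :=
  (unit_mateEquiv_symm (D.lanAdj b) (D.lanAdj c) (TwoSquare.mk _ _ _ _ (D.cell δ)) Y).symm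

/-- The right mate is the map to the standard Kan extension that the restricted cone induces, so its
invertibility and the universality of that cone are the same thing. Base change questions thereby
become questions about `IsRan`. -/
theorem isIso_rightMate_app_iff [D.HasKan] (δ : a ⋙ b ⟶ c ⋙ d) (Y : D.obj K₁) :
    IsIso ((D.rightMate δ).app Y) ↔ IsRan a (pull δ (ranCounit d Y)) := by
  have h := (map_rightMate_app δ Y).trans (Category.comp_id _).symm
  constructor
  · intro _
    exact (isRan_counit a _).of_iso (E := (D.ran a).obj ((D.map c).obj Y))
      (E' := (D.map b).obj ((D.ran d).obj Y)) (inv ((D.rightMate δ).app Y)) (𝟙 _) (by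
        rw [Category.comp_id] at h ⊢
        rw [← h]
        simp)
  · intro h3
    exact h3.isIso (isRan_counit a _) _ _ h

theorem isIso_leftMate_app_iff [D.HasKan] (δ : a ⋙ b ⟶ c ⋙ d) (Y : D.obj J₂) :
    IsIso ((D.leftMate δ).app Y) ↔ IsLan c (push δ (lanUnit b Y)) := by
  have h := (lanUnit_leftMate_app δ Y).trans (Category.id_comp _).symm
  constructor
  · intro _
    exact (isLan_unit c _).of_iso (E := (D.lan c).obj ((D.map a).obj Y))
      (E' := (D.map d).obj ((D.lan b).obj Y)) ((D.leftMate δ).app Y) (𝟙 _) h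
  · intro h3
    exact (isLan_unit c _).isIso h3 _ _ h

/-- A right Kan extension is the standard one. -/
theorem IsRan.exists_iso [D.HasKan] {u : J ⥤ K} {E : D.obj K} {Y : D.obj J}
    {κ : (D.map u).obj E ⟶ Y} (hκ : IsRan u κ) :
    ∃ m : (D.ran u).obj Y ⟶ E, IsIso m ∧ (D.map u).map m ≫ κ = ranCounit u Y := by
  obtain ⟨m, hm⟩ := (hκ ((D.ran u).obj Y)).2 (ranCounit u Y)
  exact ⟨m, (isRan_counit u Y).isIso hκ m (𝟙 Y) (by simpa using hm), hm⟩

theorem IsLan.exists_iso [D.HasKan] {u : J ⥤ K} {E : D.obj K} {Y : D.obj J}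
    {κ : Y ⟶ (D.map u).obj E} (hκ : IsLan u κ) :
    ∃ m : (D.lan u).obj Y ⟶ E, IsIso m ∧ lanUnit u Y ≫ (D.map u).map m = κ := by
  obtain ⟨m, hm⟩ := (isLan_unit u Y E).2 κ
  exact ⟨m, (isLan_unit u Y).isIso hκ m (𝟙 Y) (by simpa using hm), hm⟩

end pull
end ran
end Prederivator

namespace Prederivator

variable {𝒟 : DiagramClass.{w}} {D : Prederivator.{w, v, u} 𝒟}

section paste

variable {I₁ I₂ J₁ J₂ K₁ K₂ : Type w} [SmallCategory I₁] [SmallCategory I₂] [SmallCategory J₁]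
  [SmallCategory J₂] [SmallCategory K₁] [SmallCategory K₂] [𝒟.Has I₁] [𝒟.Has I₂] [𝒟.Has J₁]
  [𝒟.Has J₂] [𝒟.Has K₁] [𝒟.Has K₂]

/-- Needed to restrict a Kan extension first along a square and then to a point: the outcome is a
single restriction along the pasted 2-cell. The `eqToHom` terms are the strict functoriality
equations, which hold only propositionally. -/
theorem pull_pull {a' : I₁ ⥤ I₂} {b' : I₂ ⥤ J₂} {c' : I₁ ⥤ J₁} {a : J₁ ⥤ J₂} {b : J₂ ⥤ K₂}
    {c : J₁ ⥤ K₁} {d : K₁ ⥤ K₂} (δ' : a' ⋙ b' ⟶ c' ⋙ a) (δ : a ⋙ b ⟶ c ⋙ d)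
    {E : D.obj K₂} {Y : D.obj K₁} (κ : (D.map d).obj E ⟶ Y) :
    pull (a := a') (b := b' ⋙ b) (c := c' ⋙ c) (d := d)
      (Functor.whiskerRight δ' b ≫ Functor.whiskerLeft c' δ) κ =
      (D.map a').map (eqToHom (D.map_comp_obj b' b E)) ≫ pull δ' (pull δ κ) ≫
        eqToHom (D.map_comp_obj c' c Y).symm := by
  have h := (D.map₂ δ').naturality
  simp only [pull, cell_app, map_comp_map, Functor.map_comp, Category.assoc, eqToHom_map,
    eqToHom_trans_assoc]
  have e := D.map₂_comp_app (Functor.whiskerRight δ' b) (Functor.whiskerLeft c' δ) E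
  rw [map₂_whiskerRight_app, map₂_whiskerLeft_app] at e
  erw [e]
  simp

theorem push_push {a' : I₁ ⥤ J₁} {b' : J₁ ⥤ K₁} {c' : I₁ ⥤ I₂} {d' : I₂ ⥤ K₁} {a : J₁ ⥤ J₂}
    {b : J₂ ⥤ K₂} {d : K₁ ⥤ K₂} (δ' : a' ⋙ b' ⟶ c' ⋙ d') (δ : a ⋙ b ⟶ b' ⋙ d)
    {E : D.obj K₂} {Y : D.obj J₂} (κ : Y ⟶ (D.map b).obj E) :
    push (a := a' ⋙ a) (b := b) (c := c') (d := d' ⋙ d)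
      (Functor.whiskerLeft a' δ ≫ Functor.whiskerRight δ' d) κ =
      eqToHom (D.map_comp_obj a' a Y) ≫ push δ' (push δ κ) ≫
        (D.map c').map (eqToHom (D.map_comp_obj d' d E).symm) := by
  simp only [push, cell_app, map_comp_map, Functor.map_comp, Category.assoc, eqToHom_map,
    eqToHom_trans, eqToHom_trans_assoc]
  have e := D.map₂_comp_app (Functor.whiskerLeft a' δ) (Functor.whiskerRight δ' d) E
  rw [map₂_whiskerRight_app, map₂_whiskerLeft_app] at e
  erw [e]
  simp

end paste

/-! ### Replacing slices by posets -/

section data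

variable {A B S : Type w} [SmallCategory A] [SmallCategory B] [PartialOrder S]

/-- The functor from `S` to the slice of `u` under `x` given by `g` and `γ` has a right adjoint. -/
def RanData (u : A ⥤ B) (x : Pt.{w} ⥤ B) (g : S ⥤ A) (γ : toPt S ⋙ x ⟶ g ⋙ u) : Prop :=
  ∀ (a : A) (f : x.obj PUnit.unit ⟶ u.obj a), ∃ (r : S) (ε : g.obj r ⟶ a),
    (γ.app r : x.obj PUnit.unit ⟶ u.obj (g.obj r)) ≫ u.map ε = f ∧
      ∀ (s : S) (h : g.obj s ⟶ a),
        (γ.app s : x.obj PUnit.unit ⟶ u.obj (g.obj s)) ≫ u.map h = f →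
          ∃ e : s ⟶ r, g.map e ≫ ε = h

/-- The functor from `S` to the slice of `u` over `x` given by `g` and `γ` has a left adjoint. -/
def LanData (u : A ⥤ B) (x : Pt.{w} ⥤ B) (g : S ⥤ A) (γ : g ⋙ u ⟶ toPt S ⋙ x) : Prop :=
  ∀ (a : A) (f : u.obj a ⟶ x.obj PUnit.unit), ∃ (l : S) (ε : a ⟶ g.obj l),
    u.map ε ≫ (γ.app l : u.obj (g.obj l) ⟶ x.obj PUnit.unit) = f ∧
      ∀ (s : S) (h : a ⟶ g.obj s),
        u.map h ≫ (γ.app s : u.obj (g.obj s) ⟶ x.obj PUnit.unit) = f →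
          ∃ e : l ⟶ s, ε ≫ g.map e = h

/-- The functor from `S` to the slice under `x`. -/
def underLift (u : A ⥤ B) (x : Pt.{w} ⥤ B) (g : S ⥤ A) (γ : toPt S ⋙ x ⟶ g ⋙ u) :
    S ⥤ StructuredArrow (x.obj PUnit.unit) u where
  obj s := StructuredArrow.mk (Y := g.obj s) (γ.app s)
  map e := StructuredArrow.homMk (g.map e) (by
    have := γ.naturality e
    simp at this
    exact this.symm)

/-- The functor from `S` to the slice over `x`. -/
def overLift (u : A ⥤ B) (x : Pt.{w} ⥤ B) (g : S ⥤ A) (γ : g ⋙ u ⟶ toPt S ⋙ x) :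
    S ⥤ CostructuredArrow u (x.obj PUnit.unit) where
  obj s := CostructuredArrow.mk (Y := g.obj s) (γ.app s)
  map e := CostructuredArrow.homMk (g.map e) (by
    have := γ.naturality e
    simp at this
    exact this)

/-- The right adjoint exists once each comma category has a terminal object. `RanData` supplies a
weakly terminal one, and uniqueness is free because `S` is a poset. -/
theorem RanData.isLeftAdjoint {u : A ⥤ B} {x : Pt.{w} ⥤ B} {g : S ⥤ A}
    {γ : toPt S ⋙ x ⟶ g ⋙ u} (h : RanData u x g γ) : (underLift u x g γ).IsLeftAdjoint := by
  rw [isLeftAdjoint_iff_hasTerminal_costructuredArrow]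
  intro t
  obtain ⟨r, ε, h1, h2⟩ := h t.right t.hom
  let T : CostructuredArrow (underLift u x g γ) t :=
    CostructuredArrow.mk (Y := r) (StructuredArrow.homMk ε h1)
  refine (IsTerminal.ofUniqueHom (Y := T) (fun Z => CostructuredArrow.homMk
    (h2 Z.left Z.hom.right (StructuredArrow.w Z.hom)).choose ?_) ?_).hasTerminal
  · ext
    exact (h2 Z.left Z.hom.right (StructuredArrow.w Z.hom)).choose_spec
  · intro Z m
    ext
    exact Subsingleton.elim _ _

theorem LanData.isRightAdjoint {u : A ⥤ B} {x : Pt.{w} ⥤ B} {g : S ⥤ A}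
    {γ : g ⋙ u ⟶ toPt S ⋙ x} (h : LanData u x g γ) : (overLift u x g γ).IsRightAdjoint := by
  rw [isRightAdjoint_iff_hasInitial_structuredArrow]
  intro t
  obtain ⟨r, ε, h1, h2⟩ := h t.left t.hom
  let T : StructuredArrow t (overLift u x g γ) :=
    StructuredArrow.mk (Y := r) (CostructuredArrow.homMk ε h1)
  refine (IsInitial.ofUniqueHom (X := T) (fun Z => StructuredArrow.homMk
    (h2 Z.right Z.hom.left (CostructuredArrow.w Z.hom)).choose ?_) ?_).hasInitial
  · ext
    exact (h2 Z.right Z.hom.left (CostructuredArrow.w Z.hom)).choose_spec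
  · intro Z m
    ext
    exact Subsingleton.elim _ _

end data

section adjoint

variable {S T : Type w} [SmallCategory S] [SmallCategory T] [𝒟.Has S] [𝒟.Has T]

/-- All functors from `S` to `T` agree after projection to the point, so every 2-cell between them
becomes an identity on diagrams pulled back from the point. -/
theorem isIso_map₂_app_toPt {t t' : S ⥤ T} (β : t ⟶ t') (Z : D.obj Pt.{w}) :
    IsIso ((D.map₂ β).app ((D.map (toPt T)).obj Z)) := by
  have h := D.map₂_whiskerRight_app β (toPt T) Z
  have : IsIso (Functor.whiskerRight β (toPt T)) :=
    ⟨⟨fun _ => 𝟙 _, fun _ _ _ => rfl⟩, rfl, rfl⟩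
  have h2 : (D.map₂ β).app ((D.map (toPt T)).obj Z) = eqToHom (D.map_comp_obj t (toPt T) Z).symm ≫
    (D.map₂ (Functor.whiskerRight β (toPt T))).app Z ≫ eqToHom (D.map_comp_obj t' (toPt T) Z) := by
    rw [h]; simp
  rw [h2]
  infer_instance

/-- Restriction along a left adjoint is bijective on maps out of a constant diagram. -/
theorem map_bijective_of_isLeftAdjoint (l : S ⥤ T) [l.IsLeftAdjoint] (Z : D.obj Pt.{w})
    (N : D.obj T) : Function.Bijective fun f : (D.map (toPt T)).obj Z ⟶ N => (D.map l).map f := by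
  let adj := Adjunction.ofIsLeftAdjoint l
  -- Pullback reverses the adjunction: `r^*` is left adjoint to `l^*`. Its counit is invertible at
  -- constant diagrams, and then `l^*` on maps out of such a diagram is the adjunction bijection.
  have : IsIso ((D.mapAdj adj).counit.app ((D.map (toPt T)).obj Z)) := by
    have := isIso_map₂_app_toPt (D := D) adj.counit Z
    simp only [mapAdj, Adjunction.mkOfUnitCounit_counit, NatTrans.comp_app, eqToHom_app]
    infer_instance
  have h : ∀ f : (D.map (toPt T)).obj Z ⟶ N, (D.map l).map f =
      (D.mapAdj adj).homEquiv _ N ((D.mapAdj adj).counit.app ((D.map (toPt T)).obj Z) ≫ f) := by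
    intro f
    simp [Adjunction.homEquiv_unit]
  constructor
  · intro f g hfg
    simp only [h, EmbeddingLike.apply_eq_iff_eq] at hfg
    exact (cancel_epi ((D.mapAdj adj).counit.app ((D.map (toPt T)).obj Z))).1 hfg
  · intro f
    refine ⟨inv ((D.mapAdj adj).counit.app ((D.map (toPt T)).obj Z)) ≫
      ((D.mapAdj adj).homEquiv _ N).symm f, ?_⟩
    dsimp only
    rw [h, IsIso.hom_inv_id_assoc, Equiv.apply_symm_apply]

/-- Restriction along a right adjoint is bijective on maps to a constant diagram. -/
theorem map_bijective_of_isRightAdjoint (r : S ⥤ T) [r.IsRightAdjoint] (Z : D.obj Pt.{w})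
    (N : D.obj T) : Function.Bijective fun f : N ⟶ (D.map (toPt T)).obj Z => (D.map r).map f := by
  let adj := Adjunction.ofIsRightAdjoint r
  have : IsIso ((D.mapAdj adj).unit.app ((D.map (toPt T)).obj Z)) := by
    have := isIso_map₂_app_toPt (D := D) adj.unit Z
    simp only [mapAdj, Adjunction.mkOfUnitCounit_unit, NatTrans.comp_app, eqToHom_app]
    infer_instance
  have h : ∀ f : N ⟶ (D.map (toPt T)).obj Z, (D.map r).map f =
      ((D.mapAdj adj).homEquiv N _).symm (f ≫ (D.mapAdj adj).unit.app ((D.map (toPt T)).obj Z)) := by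
    intro f
    simp [Adjunction.homEquiv_counit]
  constructor
  · intro f g hfg
    simp only [h, EmbeddingLike.apply_eq_iff_eq] at hfg
    exact (cancel_mono ((D.mapAdj adj).unit.app ((D.map (toPt T)).obj Z))).1 hfg
  · intro f
    refine ⟨(D.mapAdj adj).homEquiv N _ f ≫
      inv ((D.mapAdj adj).unit.app ((D.map (toPt T)).obj Z)), ?_⟩
    dsimp only
    rw [h, Category.assoc, IsIso.inv_hom_id, Category.comp_id, Equiv.symm_apply_apply]

end adjoint

/-! ### The pointwise formula for Kan extensions -/

section pointwise

variable {J K : Type w} [SmallCategory J] [SmallCategory K] [𝒟.Has J] [𝒟.Has K]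

/-- The functor classifying `x *` is isomorphic to `x`. -/
def ptIso (x : Pt.{w} ⥤ K) : pt (x.obj PUnit.unit) ≅ x :=
  NatIso.ofComponents (fun _ => Iso.refl _) (fun f => by
    have : x.map f = 𝟙 _ := by rw [← x.map_id]; rfl
    simpa using this.symm)

theorem map₂_whiskerLeft_assoc_app {I J A B C : Type w} [SmallCategory I] [SmallCategory J]
    [SmallCategory A] [SmallCategory B] [SmallCategory C] [𝒟.Has I] [𝒟.Has J] [𝒟.Has A] [𝒟.Has B]
    [𝒟.Has C] (l : I ⥤ J) {a : J ⥤ A} {b : A ⥤ C} {a' : J ⥤ B} {b' : B ⥤ C}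
    (γ : a ⋙ b ⟶ a' ⋙ b') (X : D.obj C) :
    (D.map₂ (show (l ⋙ a) ⋙ b ⟶ (l ⋙ a') ⋙ b' from Functor.whiskerLeft l γ)).app X =
      eqToHom (D.map_comp_obj l (a ⋙ b) X) ≫ (D.map l).map ((D.map₂ γ).app X) ≫
        eqToHom (D.map_comp_obj l (a' ⋙ b') X).symm :=
  D.map₂_whiskerLeft_app l γ X

/-- Cones have constant domain, and restriction along a left adjoint is bijective on maps out of
constant diagrams. Hence the limit over `T` is also the limit over `S`. -/
theorem IsRan.comp_isLeftAdjoint {S T : Type w} [SmallCategory S] [SmallCategory T] [𝒟.Has S]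
    [𝒟.Has T] (l : S ⥤ T) [l.IsLeftAdjoint] {W : D.obj Pt.{w}} {N : D.obj T}
    {κ : (D.map (toPt T)).obj W ⟶ N} (hκ : IsRan (toPt T) κ) :
    IsRan (l ⋙ toPt T) (eqToHom (D.map_comp_obj l (toPt T) W) ≫ (D.map l).map κ) := fun Z => by
  have h := ((eqToIso (D.map_comp_obj l (toPt T) Z)).symm.homFromEquiv
    (Z := (D.map l).obj N)).bijective.comp ((map_bijective_of_isLeftAdjoint l Z N).comp (hκ Z))
  have e : (fun f : Z ⟶ W => (D.map (l ⋙ toPt T)).map f ≫ eqToHom (D.map_comp_obj l (toPt T) W) ≫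
      (D.map l).map κ) = fun f => eqToHom (D.map_comp_obj l (toPt T) Z) ≫
        (D.map l).map ((D.map (toPt T)).map f ≫ κ) := by
    funext f
    have : (D.map (l ⋙ toPt T)).map f = _ := D.map_comp_map l (toPt T) f
    rw [this]
    simp
  rw [e]
  exact h

theorem IsLan.comp_isRightAdjoint {S T : Type w} [SmallCategory S] [SmallCategory T] [𝒟.Has S]
    [𝒟.Has T] (r : S ⥤ T) [r.IsRightAdjoint] {W : D.obj Pt.{w}} {N : D.obj T}
    {κ : N ⟶ (D.map (toPt T)).obj W} (hκ : IsLan (toPt T) κ) :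
    IsLan (r ⋙ toPt T) ((D.map r).map κ ≫ eqToHom (D.map_comp_obj r (toPt T) W).symm) := fun Z => by
  have h := ((eqToIso (D.map_comp_obj r (toPt T) Z)).symm.homToEquiv
    (Z := (D.map r).obj N)).bijective.comp ((map_bijective_of_isRightAdjoint r Z N).comp (hκ Z))
  have e : (fun f : W ⟶ Z => ((D.map r).map κ ≫ eqToHom (D.map_comp_obj r (toPt T) W).symm) ≫
      (D.map (r ⋙ toPt T)).map f) = fun f =>
        (D.map r).map (κ ≫ (D.map (toPt T)).map f) ≫
          eqToHom (D.map_comp_obj r (toPt T) Z).symm := by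
    funext f
    have : (D.map (r ⋙ toPt T)).map f = _ := D.map_comp_map r (toPt T) f
    rw [this]
    simp
  rw [e]
  exact h

theorem IsRan.pull_isLeftAdjoint {S T : Type w} [SmallCategory S] [SmallCategory T] [𝒟.Has S]
    [𝒟.Has T] (l : S ⥤ T) [l.IsLeftAdjoint] {u : J ⥤ K} {E : D.obj K} {Y : D.obj J}
    {κ : (D.map u).obj E ⟶ Y} {x x' : Pt.{w} ⥤ K} (β : x' ≅ x) {g : T ⥤ J}
    {γ' : toPt T ⋙ x' ⟶ g ⋙ u} {γ : (l ⋙ toPt T) ⋙ x ⟶ (l ⋙ g) ⋙ u}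
    (e : Functor.whiskerLeft (l ⋙ toPt T) β.hom ≫ γ =
      (show (l ⋙ toPt T) ⋙ x' ⟶ (l ⋙ g) ⋙ u from Functor.whiskerLeft l γ'))
    (h : IsRan (toPt T) (pull γ' κ)) : IsRan (l ⋙ toPt T) (pull γ κ) := by
  refine IsRan.of_iso (u := l ⋙ toPt T) (h.comp_isLeftAdjoint l) ((D.map₂ β.hom).app E)
    (eqToHom (D.map_comp_obj l g Y).symm) ?_
  have e2 := congrArg (fun α => (D.map₂ α).app E) e
  rw [map₂_comp_app, map₂_whiskerLeft_app, map₂_whiskerLeft_assoc_app, Category.assoc,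
    eqToHom_comp_iff, Category.assoc] at e2
  have e5 := eq_whisker e2 (eqToHom (D.map_comp_obj (l ⋙ g) u E) ≫ (D.map (l ⋙ g)).map κ)
  simp only [pull, cell_app, Functor.map_comp, Category.assoc, eqToHom_map, map_comp_map] at e5 ⊢
  simpa using e5

theorem IsLan.push_isRightAdjoint {S T : Type w} [SmallCategory S] [SmallCategory T] [𝒟.Has S]
    [𝒟.Has T] (r : S ⥤ T) [r.IsRightAdjoint] {u : J ⥤ K} {E : D.obj K} {Y : D.obj J}
    {κ : Y ⟶ (D.map u).obj E} {x x' : Pt.{w} ⥤ K} (β : x' ≅ x) {g : T ⥤ J}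
    {γ' : g ⋙ u ⟶ toPt T ⋙ x'} {γ : (r ⋙ g) ⋙ u ⟶ (r ⋙ toPt T) ⋙ x}
    (e : γ ≫ Functor.whiskerLeft (r ⋙ toPt T) β.inv =
      (show (r ⋙ g) ⋙ u ⟶ (r ⋙ toPt T) ⋙ x' from Functor.whiskerLeft r γ'))
    (h : IsLan (toPt T) (push γ' κ)) : IsLan (r ⋙ toPt T) (push γ κ) := by
  have := h.comp_isRightAdjoint r
  refine IsLan.of_iso (u := r ⋙ toPt T) this ((D.map₂ β.hom).app E)
    (eqToHom (D.map_comp_obj r g Y).symm) ?_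
  have e2 := congrArg (fun α => (D.map₂ α).app E)
    ((Iso.comp_inv_eq (Functor.isoWhiskerLeft (r ⋙ toPt T) β)).1 e)
  rw [map₂_comp_app, map₂_whiskerLeft_assoc_app] at e2
  erw [map₂_whiskerLeft_app] at e2
  have e5 := (D.map (r ⋙ g)).map κ ≫= eqToHom (D.map_comp_obj (r ⋙ g) u E).symm ≫= eq_whisker e2
    (eqToHom (D.map_comp_obj (r ⋙ toPt T) x E))
  simp only [push, cell_app, Functor.map_comp, Category.assoc, eqToHom_map, map_comp_map] at e5 ⊢
  simp only [eqToHom_trans_assoc, eqToHom_trans] at e5 ⊢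
  simpa using ((cancel_epi _).1 e5).symm

variable [D.IsDerivator] {u : J ⥤ K} {E : D.obj K} {Y : D.obj J}

theorem IsRan.slice {κ : (D.map u).obj E ⟶ Y} (hκ : IsRan u κ) (k : K) :
    IsRan (toPt (StructuredArrow k u)) (pull (underCell u k) κ) := by
  have := IsDerivator.der4_right (D := D) u k
  have h := (isIso_rightMate_app_iff (underCell u k) Y).1 inferInstance
  obtain ⟨m, _, hm⟩ := hκ.exists_iso
  exact h.of_iso ((D.map (pt k)).map m) ((D.map (StructuredArrow.proj k u)).map (𝟙 Y))
    (map_pull _ (by simpa using hm))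

theorem IsLan.slice {κ : Y ⟶ (D.map u).obj E} (hκ : IsLan u κ) (k : K) :
    IsLan (toPt (CostructuredArrow u k)) (push (overCell u k) κ) := by
  have := IsDerivator.der4_left (D := D) u k
  have h := (isIso_leftMate_app_iff (overCell u k) Y).1 inferInstance
  obtain ⟨m, _, hm⟩ := hκ.exists_iso
  exact h.of_iso ((D.map (pt k)).map m) ((D.map (CostructuredArrow.proj u k)).map (𝟙 Y))
    (map_push _ (by simpa using hm))

variable {S : Type w} [PartialOrder S]

/-- Right Kan extensions are pointwise, and the value at a point may be computed over any shape
that is initial in the slice. -/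
theorem IsRan.restrict {κ : (D.map u).obj E ⟶ Y} (hκ : IsRan u κ) {x : Pt.{w} ⥤ K} {g : S ⥤ J}
    {γ : toPt S ⋙ x ⟶ g ⋙ u} (h : RanData u x g γ) : IsRan (toPt S) (pull γ κ) := by
  have := h.isLeftAdjoint
  let T := StructuredArrow (x.obj PUnit.unit) u
  let l : S ⥤ T := underLift u x g γ
  -- (Der4) presents the value as a limit over the whole slice, which the left adjoint `l` cuts down
  -- to `S`. A functor `x` out of the point is only isomorphic to `pt` of its value, whence `ptIso`.
  refine IsRan.pull_isLeftAdjoint l (ptIso x) ?_ (hκ.slice (x.obj PUnit.unit))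
  ext s
  exact Category.id_comp (γ.app s)

theorem IsLan.restrict {κ : Y ⟶ (D.map u).obj E} (hκ : IsLan u κ) {x : Pt.{w} ⥤ K} {g : S ⥤ J}
    {γ : g ⋙ u ⟶ toPt S ⋙ x} (h : LanData u x g γ) : IsLan (toPt S) (push γ κ) := by
  have := h.isRightAdjoint
  let T := CostructuredArrow u (x.obj PUnit.unit)
  let r : S ⥤ T := overLift u x g γ
  refine IsLan.push_isRightAdjoint r (ptIso x) ?_ (hκ.slice (x.obj PUnit.unit))
  ext s
  exact Category.comp_id (γ.app s)

end pointwise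
end Prederivator

namespace Prederivator

variable {𝒟 : DiagramClass.{w}} {D : Prederivator.{w, v, u} 𝒟}

/-! ### Pointwise detection of Kan extensions and of base change -/

section criterion

variable {J K J₁ J₂ K₁ K₂ : Type w} [SmallCategory J] [SmallCategory K] [SmallCategory J₁]
  [SmallCategory J₂] [SmallCategory K₁] [SmallCategory K₂] [𝒟.Has J] [𝒟.Has K] [𝒟.Has J₁]
  [𝒟.Has J₂] [𝒟.Has K₁] [𝒟.Has K₂] [D.IsDerivator] {u : J ⥤ K} {E : D.obj K} {Y : D.obj J}

/-- Right Kan extensions are detected pointwise. -/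
theorem isRan_of_pointwise {κ : (D.map u).obj E ⟶ Y}
    (h : ∀ k : K, ∃ (S : Type w) (_ : PartialOrder S) (g : S ⥤ J) (γ : toPt S ⋙ pt k ⟶ g ⋙ u),
      RanData u (pt k) g γ ∧ IsRan (toPt S) (pull γ κ)) : IsRan u κ := by
  -- The comparison with the standard Kan extension is pointwise a map between two limits over the
  -- same `S`, hence invertible by (Der2).
  obtain ⟨m, hm⟩ := (isRan_counit u Y E).2 κ
  dsimp only at hm
  have : IsIso m := by
    refine IsDerivator.der2 m fun k => ?_
    obtain ⟨S, _, g, γ, h1, h2⟩ := h k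
    exact h2.isIso ((isRan_counit u Y).restrict h1) _ ((D.map g).map (𝟙 Y))
      (map_pull γ (by simpa using hm))
  exact (isRan_counit u Y).of_iso (inv m) (𝟙 Y) (by simp [← hm])

/-- Left Kan extensions are detected pointwise. -/
theorem isLan_of_pointwise {κ : Y ⟶ (D.map u).obj E}
    (h : ∀ k : K, ∃ (S : Type w) (_ : PartialOrder S) (g : S ⥤ J) (γ : g ⋙ u ⟶ toPt S ⋙ pt k),
      LanData u (pt k) g γ ∧ IsLan (toPt S) (push γ κ)) : IsLan u κ := by
  obtain ⟨m, hm⟩ := (isLan_unit u Y E).2 κ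
  dsimp only at hm
  have : IsIso m := by
    refine IsDerivator.der2 m fun k => ?_
    obtain ⟨S, _, g, γ, h1, h2⟩ := h k
    exact ((isLan_unit u Y).restrict h1).isIso h2 _ ((D.map g).map (𝟙 Y))
      (map_push γ (by simpa using hm))
  exact (isLan_unit u Y).of_iso m (𝟙 Y) (by simp [← hm])

variable {a : J₁ ⥤ J₂} {b : J₂ ⥤ K₂} {c : J₁ ⥤ K₁} {d : K₁ ⥤ K₂}

theorem IsRan.restrict_pull {δ : a ⋙ b ⟶ c ⋙ d} {E : D.obj K₂} {Y : D.obj K₁}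
    {κ : (D.map d).obj E ⟶ Y} (hκ : IsRan d κ) {S : Type w} [PartialOrder S] {x : Pt.{w} ⥤ J₂}
    {g : S ⥤ J₁} {γ : toPt S ⋙ x ⟶ g ⋙ a}
    (h : RanData d (x ⋙ b) (g ⋙ c) (Functor.whiskerRight γ b ≫ Functor.whiskerLeft g δ)) :
    IsRan (toPt S) (pull γ (pull δ κ)) := by
  refine (hκ.restrict h).of_iso (eqToHom (D.map_comp_obj x b E))
    (eqToHom (D.map_comp_obj g c Y)) ?_
  rw [pull_pull]
  simp

theorem IsLan.restrict_push {δ : a ⋙ b ⟶ c ⋙ d} {E : D.obj K₂} {Y : D.obj J₂}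
    {κ : Y ⟶ (D.map b).obj E} (hκ : IsLan b κ) {S : Type w} [PartialOrder S] {x : Pt.{w} ⥤ K₁}
    {g : S ⥤ J₁} {γ : g ⋙ c ⟶ toPt S ⋙ x}
    (h : LanData b (x ⋙ d) (g ⋙ a) (Functor.whiskerLeft g δ ≫ Functor.whiskerRight γ d)) :
    IsLan (toPt S) (push γ (push δ κ)) := by
  refine (hκ.restrict h).of_iso (eqToHom (D.map_comp_obj x d E))
    (eqToHom (D.map_comp_obj g a Y)) ?_
  rw [push_push]
  simp [eqToHom_map]

/-- A square whose slices are computed over the same shapes preserves right Kan extensions. -/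
theorem IsRan.pull_of_ranData {δ : a ⋙ b ⟶ c ⋙ d} {E : D.obj K₂} {Y : D.obj K₁}
    {κ : (D.map d).obj E ⟶ Y} (hκ : IsRan d κ)
    (h : ∀ x : J₂, ∃ (S : Type w) (_ : PartialOrder S) (g : S ⥤ J₁) (γ : toPt S ⋙ pt x ⟶ g ⋙ a),
      RanData a (pt x) g γ ∧ RanData d (pt x ⋙ b) (g ⋙ c)
        (Functor.whiskerRight γ b ≫ Functor.whiskerLeft g δ)) : IsRan a (pull δ κ) :=
  isRan_of_pointwise fun x => by
    obtain ⟨S, hS, g, γ, h1, h2⟩ := h x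
    exact ⟨S, hS, g, γ, h1, hκ.restrict_pull h2⟩

theorem IsLan.push_of_lanData {δ : a ⋙ b ⟶ c ⋙ d} {E : D.obj K₂} {Y : D.obj J₂}
    {κ : Y ⟶ (D.map b).obj E} (hκ : IsLan b κ)
    (h : ∀ x : K₁, ∃ (S : Type w) (_ : PartialOrder S) (g : S ⥤ J₁) (γ : g ⋙ c ⟶ toPt S ⋙ pt x),
      LanData c (pt x) g γ ∧ LanData b (pt x ⋙ d) (g ⋙ a)
        (Functor.whiskerLeft g δ ≫ Functor.whiskerRight γ d)) : IsLan c (push δ κ) :=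
  isLan_of_pointwise fun x => by
    obtain ⟨S, hS, g, γ, h1, h2⟩ := h x
    exact ⟨S, hS, g, γ, h1, hκ.restrict_push h2⟩

/-- Beck–Chevalley criterion: one and the same poset `S` computes the slice of `a` under `x` and
that of `d` under `b x`, so both sides of the mate are the same limit. -/
theorem isIso_rightMate {δ : a ⋙ b ⟶ c ⋙ d}
    (h : ∀ x : J₂, ∃ (S : Type w) (_ : PartialOrder S) (g : S ⥤ J₁) (γ : toPt S ⋙ pt x ⟶ g ⋙ a),
      RanData a (pt x) g γ ∧ RanData d (pt x ⋙ b) (g ⋙ c)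
        (Functor.whiskerRight γ b ≫ Functor.whiskerLeft g δ)) : IsIso (D.rightMate δ) := by
  have : ∀ Y, IsIso ((D.rightMate δ).app Y) := fun Y =>
    (isIso_rightMate_app_iff δ Y).2 ((isRan_counit d Y).pull_of_ranData h)
  exact NatIso.isIso_of_isIso_app _

theorem isIso_leftMate {δ : a ⋙ b ⟶ c ⋙ d}
    (h : ∀ x : K₁, ∃ (S : Type w) (_ : PartialOrder S) (g : S ⥤ J₁) (γ : g ⋙ c ⟶ toPt S ⋙ pt x),
      LanData c (pt x) g γ ∧ LanData b (pt x ⋙ d) (g ⋙ a)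
        (Functor.whiskerLeft g δ ≫ Functor.whiskerRight γ d)) : IsIso (D.leftMate δ) := by
  have : ∀ Y, IsIso ((D.leftMate δ).app Y) := fun Y =>
    (isIso_leftMate_app_iff δ Y).2 ((isLan_unit b Y).push_of_lanData h)
  exact NatIso.isIso_of_isIso_app _

end criterion

/-! ### Shapes over a category with posets as fibres -/

section overPoset

/-- `A` is, over `K`, a full subcategory of the product of `K` with the poset `A₀`. -/
structure IsOverPoset {A K A₀ : Type w} [SmallCategory A] [SmallCategory K] [PartialOrder A₀]
    (q : A ⥤ K) (p : A → A₀) : Prop where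
  ext : ∀ {a a' : A} (f g : a ⟶ a'), q.map f = q.map g → f = g
  le : ∀ {a a' : A}, (a ⟶ a') → p a ≤ p a'
  lift : ∀ {a a' : A} (κ : q.obj a ⟶ q.obj a'), p a ≤ p a' → ∃ h : a ⟶ a', q.map h = κ

variable {A B K A₀ S : Type w} [SmallCategory A] [SmallCategory B] [SmallCategory K]
  [PartialOrder A₀] [PartialOrder S]

theorem isOverPoset_fst {P : Type w} [PartialOrder P] :
    IsOverPoset (CategoryTheory.Prod.fst K P) Prod.snd where
  ext _ _ h := CategoryTheory.Prod.hom_ext h (Subsingleton.elim _ _)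
  le f := leOfHom f.2
  lift κ h := ⟨CategoryTheory.Prod.mkHom κ (homOfLE h), rfl⟩

theorem isOverPoset_fst_fst {P Q : Type w} [PartialOrder P] [PartialOrder Q] :
    IsOverPoset (CategoryTheory.Prod.fst (K × P) Q ⋙ CategoryTheory.Prod.fst K P)
      (fun a => (a.1.2, a.2)) where
  ext _ _ h := CategoryTheory.Prod.hom_ext
    (CategoryTheory.Prod.hom_ext h (Subsingleton.elim _ _)) (Subsingleton.elim _ _)
  le f := ⟨leOfHom f.1.2, leOfHom f.2⟩
  lift κ h := ⟨CategoryTheory.Prod.mkHom (CategoryTheory.Prod.mkHom κ (homOfLE h.1))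
    (homOfLE h.2), rfl⟩

/-- Morphisms are determined by their component in `K` together with an inequality. As `γ` is
invertible over `K`, the factorization in `K` is forced, and only the order condition remains: among
the `s` with `p (g s) ≤ p a` there is a greatest one. -/
theorem RanData.of_poset {B₀ : Type w} [PartialOrder B₀] {u : A ⥤ B} {q : B ⥤ K} {p : A → A₀}
    {p' : B → B₀} (hA : IsOverPoset (u ⋙ q) p) (hB : IsOverPoset q p') {x : Pt.{w} ⥤ B} {g : S ⥤ A}
    {γ : toPt S ⋙ x ⟶ g ⋙ u} (hγ : ∀ s, IsIso (q.map (γ.app s)))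
    (h : ∀ a, p' (x.obj PUnit.unit) ≤ p' (u.obj a) →
      ∃ r : S, p (g.obj r) ≤ p a ∧ ∀ s, p (g.obj s) ≤ p a → s ≤ r) :
    RanData u x g γ := by
  intro a f
  obtain ⟨r, h1, h2⟩ := h a (hB.le f)
  let γ' : ∀ s, q.obj (x.obj PUnit.unit) ⟶ q.obj (u.obj (g.obj s)) := fun s => q.map (γ.app s)
  have hγ' : ∀ s, IsIso (γ' s) := hγ
  obtain ⟨ε, hε⟩ := hA.lift (inv (γ' r) ≫ q.map f) h1
  have hε' : q.map (u.map ε) = inv (γ' r) ≫ q.map f := hε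
  refine ⟨r, ε, hB.ext _ _ ?_, ?_⟩
  · rw [q.map_comp, hε']
    exact IsIso.hom_inv_id_assoc (γ' r) _
  · intro s h hs
    have hsr := h2 s (hA.le h)
    refine ⟨homOfLE hsr, hA.ext _ _ ?_⟩
    rw [Functor.map_comp, hε]
    have hn : γ' s ≫ q.map (u.map (g.map (homOfLE hsr))) = γ' r := by
      have := γ.naturality (homOfLE hsr)
      have h3 : x.map ((toPt S).map (homOfLE hsr)) = 𝟙 _ := by rw [← x.map_id]; rfl
      simp only [Functor.comp_map, h3] at this
      exact (q.map_comp _ _).symm.trans (congrArg q.map (this.symm.trans (Category.id_comp _)))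
    rw [← cancel_epi (γ' s)]
    have h4 := congrArg q.map hs
    rw [Functor.map_comp] at h4
    rw [Functor.comp_map, ← Category.assoc, hn, IsIso.hom_inv_id_assoc]
    exact h4.symm

theorem LanData.of_poset {B₀ : Type w} [PartialOrder B₀] {u : A ⥤ B} {q : B ⥤ K} {p : A → A₀}
    {p' : B → B₀} (hA : IsOverPoset (u ⋙ q) p) (hB : IsOverPoset q p') {x : Pt.{w} ⥤ B} {g : S ⥤ A}
    {γ : g ⋙ u ⟶ toPt S ⋙ x} (hγ : ∀ s, IsIso (q.map (γ.app s)))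
    (h : ∀ a, p' (u.obj a) ≤ p' (x.obj PUnit.unit) →
      ∃ r : S, p a ≤ p (g.obj r) ∧ ∀ s, p a ≤ p (g.obj s) → r ≤ s) :
    LanData u x g γ := by
  intro a f
  obtain ⟨r, h1, h2⟩ := h a (hB.le f)
  let γ' : ∀ s, q.obj (u.obj (g.obj s)) ⟶ q.obj (x.obj PUnit.unit) := fun s => q.map (γ.app s)
  have hγ' : ∀ s, IsIso (γ' s) := hγ
  obtain ⟨ε, hε⟩ := hA.lift (q.map f ≫ inv (γ' r)) h1
  have hε' : q.map (u.map ε) = q.map f ≫ inv (γ' r) := hε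
  refine ⟨r, ε, hB.ext _ _ ?_, ?_⟩
  · rw [q.map_comp, hε', Category.assoc]
    exact (congrArg _ (IsIso.inv_hom_id (γ' r))).trans (Category.comp_id _)
  · intro s h hs
    have hsr := h2 s (hA.le h)
    refine ⟨homOfLE hsr, hA.ext _ _ ?_⟩
    rw [Functor.map_comp, hε]
    have hn : q.map (u.map (g.map (homOfLE hsr))) ≫ γ' s = γ' r := by
      have := γ.naturality (homOfLE hsr)
      have h3 : x.map ((toPt S).map (homOfLE hsr)) = 𝟙 _ := by rw [← x.map_id]; rfl
      simp only [Functor.comp_map, h3] at this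
      exact (q.map_comp _ _).symm.trans (congrArg q.map (this.trans (Category.comp_id _)))
    rw [← cancel_mono (γ' s)]
    have h4 := congrArg q.map hs
    rw [Functor.map_comp] at h4
    rw [Functor.comp_map, Category.assoc, hn, Category.assoc, IsIso.inv_hom_id, Category.comp_id]
    exact h4.symm

end overPoset

/-! ### Zero objects -/

section zero

variable {J K : Type w} [SmallCategory J] [SmallCategory K] [𝒟.Has J] [𝒟.Has K] [D.IsDerivator]

theorem IsPointed.hasZeroObject (h : D.IsPointed) (K : Type w) [SmallCategory K] [𝒟.Has K] :
    HasZeroObject (D.obj K) := by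
  obtain ⟨Z, hZ⟩ := h
  exact ⟨_, isZero_obj_of_adjoints (D.map (toPt K)) hZ⟩

theorem IsPointed.isZero_of_pointwise (h : D.IsPointed) {X : D.obj K}
    (hX : ∀ k : K, IsZero ((D.map (pt k)).obj X)) : IsZero X := by
  obtain ⟨Z, hZ⟩ := h.hasZeroObject K
  have : IsIso (hZ.from_ X) := IsDerivator.der2 _ fun k =>
    isIso_of_isInitial ((hX k).isInitial) (isZero_obj_of_adjoints (D.map (pt k)) hZ).isInitial _
  exact hZ.of_iso (asIso (hZ.from_ X))

theorem IsPointed.isZero_of_isRan (h : D.IsPointed) {u : J ⥤ K} {E : D.obj K} {Y : D.obj J}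
    {κ : (D.map u).obj E ⟶ Y} (hκ : IsRan u κ) (hY : IsZero Y) : IsZero E := by
  obtain ⟨Z, hZ⟩ := h.hasZeroObject K
  exact hZ.of_iso ⟨hZ.from_ E, hZ.to_ E, hκ.hom_ext (hY.eq_of_tgt _ _), hZ.eq_of_src _ _⟩

theorem IsPointed.isZero_of_isLan (h : D.IsPointed) {u : J ⥤ K} {E : D.obj K} {Y : D.obj J}
    {κ : Y ⟶ (D.map u).obj E} (hκ : IsLan u κ) (hY : IsZero Y) : IsZero E := by
  obtain ⟨Z, hZ⟩ := h.hasZeroObject K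
  exact hZ.of_iso ⟨hZ.from_ E, hZ.to_ E, hκ.hom_ext (hY.eq_of_src _ _), hZ.eq_of_src _ _⟩

end zero
end Prederivator

namespace Prederivator

variable {𝒟 : DiagramClass.{w}} {D : Prederivator.{w, v, u} 𝒟}

/-! ### Limit cones inside a diagram -/

/-- The projection of the point to itself is the identity functor, so universality of the cone is
bijectivity of composition with `κ`, and Yoneda applies. -/
theorem isIso_of_isRan_toPt {E Y : D.obj Pt.{w}} {κ : (D.map (toPt Pt.{w})).obj E ⟶ Y}
    (hκ : IsRan (toPt Pt.{w}) κ) : IsIso κ := by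
  have h : ∀ {X X' : D.obj Pt.{w}} (f : X ⟶ X'), (D.map (toPt Pt.{w})).map f =
      eqToHom (D.map_id_obj X) ≫ f ≫ eqToHom (D.map_id_obj X').symm := D.map_id_map
  have h1 : ∀ Z, Function.Bijective fun f : Z ⟶ E => f ≫ eqToHom (D.map_id_obj E).symm ≫ κ := by
    intro Z
    have h2 := ((eqToIso (D.map_id_obj Z)).homFromEquiv (Z := Y)).bijective.comp (hκ Z)
    convert h2 using 1
    funext f
    simp [h]
  have := isIso_of_yoneda_map_bijective (eqToHom (D.map_id_obj E).symm ≫ κ) h1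
  have h3 : κ = eqToHom (D.map_id_obj E) ≫ (eqToHom (D.map_id_obj E).symm ≫ κ) := by simp
  rw [h3]
  infer_instance

theorem isRan_toPt_of_isIso {E Y : D.obj Pt.{w}} (κ : (D.map (toPt Pt.{w})).obj E ⟶ Y)
    [IsIso κ] : IsRan (toPt Pt.{w}) κ := by
  have h : ∀ {X X' : D.obj Pt.{w}} (f : X ⟶ X'), (D.map (toPt Pt.{w})).map f =
      eqToHom (D.map_id_obj X) ≫ f ≫ eqToHom (D.map_id_obj X').symm := D.map_id_map
  intro Z
  constructor
  · intro f g hfg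
    simp only [h, Category.assoc, cancel_epi] at hfg
    exact (cancel_mono _).1 hfg
  · intro f
    exact ⟨eqToHom (D.map_id_obj Z).symm ≫ f ≫ inv κ ≫ eqToHom (D.map_id_obj E), by simp [h]⟩

section cone

variable {A B J S S' : Type w} [SmallCategory A] [SmallCategory B] [SmallCategory J]
  [SmallCategory S] [𝒟.Has A] [𝒟.Has B] [𝒟.Has J] [𝒟.Has S]

/-- The cone `p^* x^* E ⟶ h^* E` given by a 2-cell. -/
def cone {p : S ⥤ J} {x : J ⥤ A} {h : S ⥤ A} (γ : p ⋙ x ⟶ h) (E : D.obj A) :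
    (D.map p).obj ((D.map x).obj E) ⟶ (D.map h).obj E :=
  eqToHom (D.map_comp_obj p x E).symm ≫ (D.map₂ γ).app E

/-- The 2-cell `γ` exhibits the part of shape `x` of `E` as the limit along `p` of the part of
shape `h`. -/
def IsLim {p : S ⥤ J} {x : J ⥤ A} {h : S ⥤ A} (γ : p ⋙ x ⟶ h) (E : D.obj A) : Prop :=
  IsRan p (cone γ E)

variable {p : S ⥤ J} {x x' : J ⥤ A} {h h' : S ⥤ A} {γ : p ⋙ x ⟶ h} {γ' : p ⋙ x' ⟶ h'}
  {E E' : D.obj A}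

theorem isLim_of_isIso {x h : Pt.{w} ⥤ A} (γ : toPt Pt.{w} ⋙ x ⟶ h) [IsIso γ] (E : D.obj A) :
    IsLim γ E := by
  have : IsIso (cone γ E) := by unfold cone; infer_instance
  exact isRan_toPt_of_isIso (cone γ E)

theorem map_cone (γ : p ⋙ x ⟶ h) (m : E ⟶ E') :
    (D.map p).map ((D.map x).map m) ≫ cone γ E' = cone γ E ≫ (D.map h).map m := by
  have := (D.map₂ γ).naturality m
  simp only [cone, Category.assoc, ← this, map_comp_map]
  simp

theorem IsLim.of_iso (hE : IsLim γ E) (m : E ⟶ E') [IsIso m] : IsLim γ E' :=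
  IsRan.of_iso hE ((D.map x).map m) ((D.map h).map m) (map_cone γ m)

theorem IsLim.isIso_map (hE : IsLim γ E) (hE' : IsLim γ E') (m : E ⟶ E')
    [IsIso ((D.map h).map m)] : IsIso ((D.map x).map m) :=
  IsRan.isIso hE hE' _ _ (map_cone γ m)

theorem IsLim.congr (hE : IsLim γ E) (ex : x ≅ x') (eh : h ≅ h')
    (e : Functor.whiskerLeft p ex.hom ≫ γ' = γ ≫ eh.hom) : IsLim γ' E := by
  refine IsRan.of_iso hE ((D.map₂ ex.hom).app E) ((D.map₂ eh.hom).app E) ?_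
  have e2 := congrArg (fun α => (D.map₂ α).app E) e
  rw [map₂_comp_app, map₂_comp_app, map₂_whiskerLeft_app, Category.assoc, eqToHom_comp_iff] at e2
  simp only [cone, Category.assoc] at e2 ⊢
  exact e2

theorem isLim_map_iff {T : A ⥤ B} {F : D.obj B} :
    IsLim γ ((D.map T).obj F) ↔
      IsLim (p := p) (x := x ⋙ T) (h := h ⋙ T) (Functor.whiskerRight γ T) F := by
  have e : (D.map p).map (eqToHom (D.map_comp_obj x T F)) ≫ cone γ ((D.map T).obj F) =
      cone (p := p) (x := x ⋙ T) (h := h ⋙ T) (Functor.whiskerRight γ T) F ≫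
        eqToHom (D.map_comp_obj h T F) := by
    have := D.map₂_whiskerRight_app γ T F
    simp only [cone, eqToHom_map]
    erw [this]
    simp
  constructor
  · intro hE
    refine IsRan.of_iso hE (eqToHom (D.map_comp_obj x T F).symm)
      (eqToHom (D.map_comp_obj h T F).symm) ?_
    have e' := congrArg (· ≫ eqToHom (D.map_comp_obj h T F).symm) e
    simp only [Category.assoc, eqToHom_trans, eqToHom_refl, Category.comp_id] at e'
    rw [← e']
    simp [eqToHom_map]
  · intro hE
    exact IsRan.of_iso hE (eqToHom (D.map_comp_obj x T F)) (eqToHom (D.map_comp_obj h T F)) e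

theorem pull_eq_cone {f : B ⥤ A} {g : S ⥤ B} (γ : p ⋙ x ⟶ g ⋙ f) {Y : D.obj B}
    (κ : (D.map f).obj E ⟶ Y) :
    pull γ κ = cone γ E ≫ eqToHom (D.map_comp_obj g f E) ≫ (D.map g).map κ := by
  simp [pull, cone, cell_app]

/-- The two cones differ by the isomorphism induced by `κ`. This turns statements about an extension
and its counit into statements about `E` alone. -/
theorem isRan_pull_iff_isLim {f : B ⥤ A} {g : S ⥤ B} {γ : p ⋙ x ⟶ g ⋙ f} {Y : D.obj B}
    {κ : (D.map f).obj E ⟶ Y} [IsIso κ] : IsRan p (pull γ κ) ↔ IsLim γ E := by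
  rw [pull_eq_cone]
  constructor
  · intro h
    exact IsRan.of_iso h (𝟙 _) (inv (eqToHom (D.map_comp_obj g f E) ≫ (D.map g).map κ)) (by simp)
  · intro h
    exact IsRan.of_iso h (𝟙 _) (eqToHom (D.map_comp_obj g f E) ≫ (D.map g).map κ) (by simp)

end cone

/-! ### Objects right Kan extended from a part of their shape -/

section ranExt

variable {A B C : Type w} [SmallCategory A] [SmallCategory B] [SmallCategory C]
  [𝒟.Has A] [𝒟.Has B] [𝒟.Has C]

/-- `E` is right Kan extended from its restriction along `f`. -/
def IsRanExt (f : B ⥤ A) (E : D.obj A) : Prop := IsRan f (𝟙 ((D.map f).obj E))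

variable {f : B ⥤ A} {E E' : D.obj A} {Y : D.obj B}

theorem IsRan.isRanExt {κ : (D.map f).obj E ⟶ Y} (hκ : IsRan f κ) [IsIso κ] : IsRanExt f E :=
  hκ.of_iso (𝟙 _) (inv κ) (by simp)

theorem IsRanExt.of_iso (hE : IsRanExt f E) (m : E ⟶ E') [IsIso m] : IsRanExt f E' :=
  IsRan.of_iso hE m ((D.map f).map m) (by simp)

/-- A map between right Kan extended objects is an isomorphism if it is so after restriction. -/
theorem IsRanExt.isIso (hE : IsRanExt f E) (hE' : IsRanExt f E') (m : E ⟶ E')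
    [IsIso ((D.map f).map m)] : IsIso m :=
  IsRan.isIso hE hE' m ((D.map f).map m) (by simp)

/-- The value of a right Kan extension at a point whose slice has an initial object. -/
theorem IsRan.isIso_at [D.IsDerivator] {κ : (D.map f).obj E ⟶ Y} (hκ : IsRan f κ)
    (x : Pt.{w} ⥤ A) (g : Pt.{w} ⥤ B) (γ : toPt Pt.{w} ⋙ x ⟶ g ⋙ f) (h : RanData f x g γ) :
    IsIso (pull γ κ) :=
  isIso_of_isRan_toPt (hκ.restrict h)

theorem ranData_pt (f : B ⥤ A) [f.Full] [f.Faithful] (b : B) :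
    RanData f (pt (f.obj b)) (pt b)
      ({ app := fun _ => 𝟙 _ } : toPt Pt.{w} ⋙ pt (f.obj b) ⟶ pt b ⋙ f) := by
  intro a φ
  refine ⟨PUnit.unit, f.preimage φ, by simp, fun s h hs => ⟨𝟙 _, ?_⟩⟩
  apply f.map_injective
  simpa using hs.symm

/-- The counit of the right Kan extension along a fully faithful functor is an isomorphism. -/
theorem IsRan.isIso_of_fullyFaithful [D.IsDerivator] [f.Full] [f.Faithful]
    {κ : (D.map f).obj E ⟶ Y} (hκ : IsRan f κ) : IsIso κ := by
  -- At a point `f b` of the image, `b` itself is initial in the slice, because `f` is fully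
  -- faithful; the limit over the slice is then the value at `b`.
  refine IsDerivator.der2 κ fun b => ?_
  let γ : toPt Pt.{w} ⋙ pt (f.obj b) ⟶ pt b ⋙ f := { app := fun _ => 𝟙 _ }
  have h := hκ.isIso_at _ _ γ (ranData_pt f b)
  have : IsIso γ := by
    have : ∀ X, IsIso (γ.app X) := fun _ => inferInstanceAs (IsIso (𝟙 _))
    exact NatIso.isIso_of_isIso_app _
  rw [pull_eq_cone] at h
  have : IsIso (cone γ E) := by unfold cone; infer_instance
  rw [isIso_comp_left_iff, isIso_comp_left_iff] at h
  exact h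

theorem isRanExt_of_pointwise [D.IsDerivator]
    (h : ∀ a : A, ∃ (S : Type w) (_ : PartialOrder S) (g : S ⥤ B) (γ : toPt S ⋙ pt a ⟶ g ⋙ f),
      RanData f (pt a) g γ ∧ IsLim γ E) : IsRanExt f E :=
  isRan_of_pointwise fun a => by
    obtain ⟨S, hS, g, γ, h1, h2⟩ := h a
    exact ⟨S, hS, g, γ, h1, isRan_pull_iff_isLim.2 h2⟩

theorem IsRanExt.isLim [D.IsDerivator] (hE : IsRanExt f E) {S : Type w} [PartialOrder S]
    {x : Pt.{w} ⥤ A} {g : S ⥤ B} {γ : toPt S ⋙ x ⟶ g ⋙ f} (h : RanData f x g γ) : IsLim γ E :=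
  isRan_pull_iff_isLim.1 (IsRan.restrict hE h)

/-- Kan extension in stages. -/
theorem IsRanExt.right [D.IsDerivator] {g : C ⥤ B} [g.Full] [g.Faithful] [f.Full] [f.Faithful]
    (hE : IsRanExt (g ⋙ f) E) : IsRanExt f E := by
  let Y := (D.map (g ⋙ f)).obj E
  -- Extending along `g` and then along `f` is an extension along `g ⋙ f`, so it gives back `E`;
  -- being of the form `f_*` of something, with `f` fully faithful, it is extended from its
  -- restriction along `f`.
  have h1 := (isRan_counit f ((D.ran g).obj Y)).comp (isRan_counit g Y)
  obtain ⟨m, hm⟩ := (h1 E).2 (𝟙 Y)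
  have h2 : IsIso m := IsRan.isIso hE h1 m (𝟙 _) (by simpa using hm)
  have h3 := (isRan_counit f ((D.ran g).obj Y)).isIso_of_fullyFaithful
  exact (isRan_counit f ((D.ran g).obj Y)).isRanExt.of_iso (inv m)

end ranExt

/-! ### Cartesian squares -/

section cart

variable {A B : Type w} [SmallCategory A] [SmallCategory B] [𝒟.Has A] [𝒟.Has B]

/-- The lower left corner of the square. -/
abbrev Sq.zero : Sq.{w} := ⟨false, false⟩

/-- The cone of `⌝` with apex `(0,0)`. -/
def cornerCone : toPt SqUR.{w} ⋙ pt Sq.zero.{w} ⟶ SqUR.incl.{w} where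
  app s := homOfLE ⟨Bool.false_le _, Bool.false_le _⟩

/-- The square of shape `e` in `E` is cartesian. -/
def IsCartSq (e : Sq.{w} ⥤ A) (E : D.obj A) : Prop :=
  IsLim (p := toPt SqUR.{w}) (x := pt Sq.zero.{w} ⋙ e) (h := SqUR.incl.{w} ⋙ e)
    (Functor.whiskerRight cornerCone e) E

theorem IsCartSq.of_iso {e : Sq.{w} ⥤ A} {E E' : D.obj A} (h : IsCartSq e E) (m : E ⟶ E')
    [IsIso m] : IsCartSq e E' := IsLim.of_iso h m

theorem IsCartSq.congr {e e' : Sq.{w} ⥤ A} {E : D.obj A} (h : IsCartSq e E) (i : e ≅ e') :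
    IsCartSq e' E :=
  IsLim.congr h (Functor.isoWhiskerLeft _ i) (Functor.isoWhiskerLeft _ i) (by ext; simp)

theorem isCartSq_map_iff {e : Sq.{w} ⥤ A} {T : A ⥤ B} {E : D.obj B} :
    IsCartSq e ((D.map T).obj E) ↔ IsCartSq (e ⋙ T) E := isLim_map_iff

theorem IsCartSq.isIso_map {e : Sq.{w} ⥤ A} {E E' : D.obj A} (h : IsCartSq e E)
    (h' : IsCartSq e E') (m : E ⟶ E') [IsIso ((D.map (SqUR.incl.{w} ⋙ e)).map m)] :
    IsIso ((D.map (pt Sq.zero.{w} ⋙ e)).map m) := IsLim.isIso_map h h' m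

end cart

end Prederivator

namespace Prederivator

variable {𝒟 : DiagramClass.{w}} {D : Prederivator.{w, v, u} 𝒟}

/-! ### Families of squares -/

section family

variable {K P P' Q S : Type w} [SmallCategory K] [PartialOrder P] [PartialOrder P']
  [PartialOrder Q] [PartialOrder S] [𝒟.Has K]

instance full_prod {A A' B B' : Type w} [SmallCategory A] [SmallCategory A'] [SmallCategory B]
    [SmallCategory B'] (F : A ⥤ A') (G : B ⥤ B') [F.Full] [G.Full] : (F.prod G).Full where
  map_surjective f := ⟨CategoryTheory.Prod.mkHom (F.preimage f.1) (G.preimage f.2),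
    CategoryTheory.Prod.hom_ext (F.map_preimage f.1) (G.map_preimage f.2)⟩

instance faithful_prod {A A' B B' : Type w} [SmallCategory A] [SmallCategory A'] [SmallCategory B]
    [SmallCategory B'] (F : A ⥤ A') (G : B ⥤ B') [F.Faithful] [G.Faithful] :
    (F.prod G).Faithful where
  map_injective h := CategoryTheory.Prod.hom_ext (F.map_injective (congrArg Prod.fst h))
    (G.map_injective (congrArg Prod.snd h))

theorem midHom_ext {a b : (K × P) × Q} {f g : a ⟶ b} (h : f.1.1 = g.1.1) : f = g :=
  CategoryTheory.Prod.hom_ext (CategoryTheory.Prod.hom_ext h (Subsingleton.elim _ _))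
    (Subsingleton.elim _ _)

/-- The inclusion of a poset-shaped diagram in the fibre over `k` and `v`. -/
def inFiber (k : K) (g : S ⥤ P) (v : Q) : S ⥤ (K × P) × Q where
  obj s := ((k, g.obj s), v)
  map e := CategoryTheory.Prod.mkHom (CategoryTheory.Prod.mkHom (𝟙 k) (g.map e)) (𝟙 v)
  map_id s := by simp
  map_comp e e' := by simp

/-- A natural transformation of poset-shaped diagrams, in a fibre. -/
def inFiberHom (k : K) {g g' : S ⥤ P} (α : g ⟶ g') (v : Q) : inFiber k g v ⟶ inFiber k g' v where
  app s := CategoryTheory.Prod.mkHom (CategoryTheory.Prod.mkHom (𝟙 k) (α.app s)) (𝟙 v)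
  naturality _ _ _ := midHom_ext rfl

/-- An isomorphism of poset-shaped diagrams, in a fibre. -/
def inFiberIso (k : K) {g g' : S ⥤ P} (α : g ≅ g') (v : Q) : inFiber k g v ≅ inFiber k g' v where
  hom := inFiberHom k α.hom v
  inv := inFiberHom k α.inv v
  hom_inv_id := by
    ext s : 2
    refine midHom_ext ?_
    exact Category.id_comp (𝟙 k)
  inv_hom_id := by
    ext s : 2
    refine midHom_ext ?_
    exact Category.id_comp (𝟙 k)

/-- The functor `f` in the middle component. -/
abbrev midMap (K Q : Type w) [SmallCategory K] [PartialOrder Q] (f : P ⥤ P') :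
    (K × P) × Q ⥤ (K × P') × Q := ((𝟭 K).prod f).prod (𝟭 Q)

/-- All shapes below have the form `(K × P) × Q` with `K` and `Q` mere parameters. What is left to
verify is a condition in posets. -/
theorem ranData_midMap (f : P ⥤ P') {x : Pt.{w} ⥤ (K × P') × Q} {g : S ⥤ (K × P) × Q}
    {γ : toPt S ⋙ x ⟶ g ⋙ midMap K Q f} (hγ : ∀ s, IsIso (γ.app s).1.1)
    (h : ∀ a v, (x.obj PUnit.unit).1.2 ≤ f.obj a → (x.obj PUnit.unit).2 ≤ v →
      ∃ r, (g.obj r).1.2 ≤ a ∧ (g.obj r).2 ≤ v ∧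
        ∀ s, (g.obj s).1.2 ≤ a → (g.obj s).2 ≤ v → s ≤ r) :
    RanData (midMap K Q f) x g γ := by
  refine RanData.of_poset (q := CategoryTheory.Prod.fst (K × P') Q ⋙ CategoryTheory.Prod.fst K P')
    (p := fun a => (a.1.2, a.2)) isOverPoset_fst_fst isOverPoset_fst_fst hγ fun a ha => ?_
  obtain ⟨r, h1, h2, h3⟩ := h a.1.2 a.2 ha.1 ha.2
  exact ⟨r, ⟨h1, h2⟩, fun s hs => h3 s hs.1 hs.2⟩

variable [D.IsDerivator]

/-- Squares in the fibres of a right Kan extended object. -/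
theorem IsRanExt.isCartSq {f : P ⥤ P'} {E : D.obj ((K × P') × Q)}
    (hE : IsRanExt (midMap K Q f) E) (e : Sq.{w} ⥤ P') (g : SqUR.{w} ⥤ P)
    (i : g ⋙ f ≅ SqUR.incl.{w} ⋙ e) (h : ∀ a, e.obj Sq.zero ≤ f.obj a →
      ∃ r, g.obj r ≤ a ∧ ∀ s, g.obj s ≤ a → s ≤ r) (k : K) (v : Q) :
    IsCartSq (inFiber k e v) E := by
  let γ : toPt SqUR.{w} ⋙ (pt Sq.zero ⋙ inFiber k e v) ⟶ inFiber k g v ⋙ midMap K Q f :=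
    Functor.whiskerRight cornerCone (inFiber k e v) ≫ (inFiberIso k i v).inv
  have h1 : RanData (midMap K Q f) _ _ γ := by
    -- By `h` the corner is initial in the slice under the lower left vertex of `e`, so the
    -- pointwise limit there is the limit over the corner, which is what cartesian means.
    refine ranData_midMap f (fun s => inferInstanceAs (IsIso (𝟙 k ≫ 𝟙 k))) fun a v' h1 h2 => ?_
    obtain ⟨r, h3, h4⟩ := h a h1
    exact ⟨r, h3, h2, fun s hs _ => h4 s hs⟩
  refine IsLim.congr (hE.isLim h1) (Iso.refl _) (inFiberIso k i v) ?_
  ext s : 2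
  refine midHom_ext ?_
  change (𝟙 k ≫ 𝟙 k : k ⟶ k) = (𝟙 k ≫ 𝟙 k) ≫ 𝟙 k
  simp

/-- The inclusion of the families of corners in the families of squares. -/
abbrev cornerIncl (K Q : Type w) [SmallCategory K] [PartialOrder Q] :
    (K × SqUR.{w}) × Q ⥤ (K × Sq.{w}) × Q := midMap K Q SqUR.incl

/-- A family of squares is cartesian. -/
def IsCart (E : D.obj ((K × Sq.{w}) × Q)) : Prop := IsRanExt (cornerIncl K Q) E

/-- Only the lower left vertices impose a condition: at the other vertices the slice of the corner
inclusion has an initial object and the limit is the value itself. -/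
theorem isCart_iff {E : D.obj ((K × Sq.{w}) × Q)} :
    IsCart E ↔ ∀ (k : K) (v : Q), IsCartSq (inFiber k (𝟭 Sq.{w}) v) E := by
  constructor
  · intro hE k v
    exact IsRanExt.isCartSq hE (𝟭 _) (𝟭 _) (Iso.refl _)
      (fun a _ => ⟨a, le_rfl, fun s hs => hs⟩) k v
  · intro h
    refine isRanExt_of_pointwise ?_
    rintro ⟨⟨k, q⟩, v⟩
    by_cases hq : q = Sq.zero
    · subst hq
      refine ⟨SqUR.{w}, inferInstance, inFiber k (𝟭 _) v,
        Functor.whiskerRight cornerCone (inFiber k (𝟭 _) v), ?_, h k v⟩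
      exact ranData_midMap _ (fun s => inferInstanceAs (IsIso (𝟙 k)))
        fun a v' h1 h2 => ⟨a, le_rfl, h2, fun s hs _ => hs⟩
    · let γ : toPt Pt.{w} ⋙ pt ((k, q), v) ⟶ pt ((k, ⟨q, hq⟩), v) ⋙ cornerIncl K Q :=
        { app := fun _ => 𝟙 _ }
      have : IsIso γ := by
        have : ∀ X, IsIso (γ.app X) := fun _ => inferInstanceAs (IsIso (𝟙 _))
        exact NatIso.isIso_of_isIso_app _
      refine ⟨Pt.{w}, inferInstance, _, γ, ?_, isLim_of_isIso γ E⟩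
      exact ranData_midMap _ (fun s => inferInstanceAs (IsIso (𝟙 k)))
        fun a v' h1 h2 => ⟨PUnit.unit, h1, h2, fun s hs _ => le_rfl⟩

end family

/-! ### Rigidity of maps to cartesian squares -/

section arrow

variable {K Q : Type w} [SmallCategory K] [PartialOrder Q] [𝒟.Has K] [D.IsDerivator]
  {C : Type*} [Category* C] {G G' S S' : C ⥤ D.obj ((K × Sq.{w}) × Q)}

theorem isIso_unit_of_isCart {E : D.obj ((K × Sq.{w}) × Q)} (hE : IsCart E) :
    IsIso ((D.ranAdj (cornerIncl K Q)).unit.app E) :=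
  IsRan.isIso hE (isRan_counit (cornerIncl K Q) _) _ (𝟙 _)
    (((D.ranAdj (cornerIncl K Q)).left_triangle_components E).trans (Category.id_comp _).symm)

/-- Write `c` for the corner inclusion. The target is `c_* c^*` of itself since it is cartesian, and
`c^* ψ` identifies this with `c_* c^* G`. Under the identification `ψ` becomes the unit at `G`, an
arrow depending on `G` only. -/
theorem nonempty_arrow_iso_unit (ψ : G ⟶ S) (hS : ∀ X, IsCart (S.obj X))
    (hψ : ∀ X, IsIso ((D.map (cornerIncl K Q)).map (ψ.app X))) :
    Nonempty (Arrow.mk ψ ≅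
      Arrow.mk (Functor.whiskerLeft G (D.ranAdj (cornerIncl K Q)).unit)) := by
  have h1 : ∀ X, IsIso ((Functor.whiskerLeft S (D.ranAdj (cornerIncl K Q)).unit).app X) :=
    fun X => isIso_unit_of_isCart (hS X)
  have h2 := NatIso.isIso_of_isIso_app
    (Functor.whiskerLeft S (D.ranAdj (cornerIncl K Q)).unit)
  have h3 : ∀ X, IsIso ((Functor.whiskerRight ψ
      (D.map (cornerIncl K Q) ⋙ D.ran (cornerIncl K Q))).app X) := fun X => by
    have := hψ X
    dsimp
    infer_instance
  have h4 := NatIso.isIso_of_isIso_app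
    (Functor.whiskerRight ψ (D.map (cornerIncl K Q) ⋙ D.ran (cornerIncl K Q)))
  exact ⟨Arrow.isoMk (Iso.refl _)
    (asIso (Functor.whiskerLeft S (D.ranAdj (cornerIncl K Q)).unit) ≪≫
      (asIso (Functor.whiskerRight ψ
        (D.map (cornerIncl K Q) ⋙ D.ran (cornerIncl K Q)))).symm) (by
      rw [← cancel_mono (Functor.whiskerRight ψ
        (D.map (cornerIncl K Q) ⋙ D.ran (cornerIncl K Q)))]
      ext X
      simp)⟩

/-- Natural maps to cartesian squares that are isomorphisms on corners are determined by their
source. -/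
theorem nonempty_arrow_iso (ψ : G ⟶ S) (ψ' : G' ⟶ S') (e : G ≅ G') (hS : ∀ X, IsCart (S.obj X))
    (hψ : ∀ X, IsIso ((D.map (cornerIncl K Q)).map (ψ.app X))) (hS' : ∀ X, IsCart (S'.obj X))
    (hψ' : ∀ X, IsIso ((D.map (cornerIncl K Q)).map (ψ'.app X))) :
    Nonempty (Arrow.mk ψ ≅ Arrow.mk ψ') := by
  obtain ⟨i⟩ := nonempty_arrow_iso_unit ψ hS hψ
  obtain ⟨i'⟩ := nonempty_arrow_iso_unit ψ' hS' hψ'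
  exact ⟨i ≪≫ Arrow.isoMk' _ _ e (Functor.isoWhiskerRight e
    (D.map (cornerIncl K Q) ⋙ D.ran (cornerIncl K Q))) (by ext; simp) ≪≫ i'.symm⟩

end arrow
end Prederivator

namespace Prederivator

variable {𝒟 : DiagramClass.{w}} (D : Prederivator.{w, v, u} 𝒟)

/-! ### The map `φ` and cartesian squares -/

section phi

/-- The inclusion of the square in its cone. -/
def Sq.coe : Sq.{w} ⥤ SqCone.{w} :=
  Monotone.functor (f := fun p => (p : SqCone.{w})) fun _ _ h => WithBot.coe_le_coe.2 h

theorem Sq.toCone_le (p : Sq.{w}) : Sq.toCone.obj p ≤ Sq.coe.obj p := by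
  change (if p.a = false ∧ p.b = false then (⊥ : SqCone.{w}) else (p : SqCone.{w})) ≤ _
  split_ifs
  · exact bot_le
  · exact le_rfl

theorem Sq.toCone_eq {p : Sq.{w}} (hp : p ≠ Sq.zero) : Sq.toCone.obj p = Sq.coe.obj p := by
  change (if p.a = false ∧ p.b = false then (⊥ : SqCone.{w}) else (p : SqCone.{w})) = _
  rw [if_neg]
  · rfl
  · rintro ⟨h1, h2⟩
    exact hp (Sq.ext h1 h2)

/-- The comparison of the two maps of the square to its cone. -/
def Sq.toConeHom : Sq.toCone.{w} ⟶ Sq.coe.{w} where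
  app p := homOfLE (Sq.toCone_le p)

/-- The two maps agree on the corner. -/
def Sq.cornerIso : SqUR.incl.{w} ⋙ Sq.toCone ≅ SqUR.incl.{w} ⋙ Sq.coe :=
  NatIso.ofComponents (fun p => eqToIso (Sq.toCone_eq p.2))

instance : Sq.toCone.{w}.Full where
  map_surjective {p q} f := by
    refine ⟨homOfLE ?_, Subsingleton.elim _ _⟩
    have h := leOfHom f
    by_cases hp : p = Sq.zero
    · subst hp
      exact ⟨Bool.false_le _, Bool.false_le _⟩
    · rw [Sq.toCone_eq hp] at h
      exact WithBot.coe_le_coe.1 (h.trans (Sq.toCone_le q))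

instance : Sq.toCone.{w}.Faithful where
  map_injective _ := Subsingleton.elim _ _

variable {K P P' Q : Type w} [SmallCategory K] [PartialOrder P] [PartialOrder P'] [PartialOrder Q]
  [𝒟.Has K]

/-- A natural transformation in the middle component. -/
abbrev midHom (K Q : Type w) [SmallCategory K] [PartialOrder Q] {f f' : P ⥤ P'} (α : f ⟶ f') :
    midMap K Q f ⟶ midMap K Q f' := NatTrans.prod (NatTrans.prod (𝟙 (𝟭 K)) α) (𝟙 (𝟭 Q))

theorem isIso_midHom {f f' : P ⥤ P'} (α : f ⟶ f') [IsIso α] : IsIso (midHom K Q α) := by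
  refine ⟨midHom K Q (inv α), ?_, ?_⟩ <;> ext x : 2 <;> refine midHom_ext ?_ <;>
    exact Category.id_comp (𝟙 x.1.1)

/-- The restriction of a map `t^* E ⟶ t'^* E` given by a 2-cell that is invertible after
restriction. -/
theorem isIso_map_map₂_app {I J L : Type w} [SmallCategory I] [SmallCategory J] [SmallCategory L]
    [𝒟.Has I] [𝒟.Has J] [𝒟.Has L] (c : I ⥤ J) {t t' : J ⥤ L} (α : t ⟶ t')
    (h : IsIso (Functor.whiskerLeft c α)) (E : D.obj L) :
    IsIso ((D.map c).map ((D.map₂ α).app E)) := by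
  have e := D.map₂_whiskerLeft_app c α E
  have e' : (D.map c).map ((D.map₂ α).app E) = eqToHom (D.map_comp_obj c t E).symm ≫
      (D.map₂ (Functor.whiskerLeft c α)).app E ≫ eqToHom (D.map_comp_obj c t' E) := by
    rw [e]; simp
  rw [e']
  infer_instance

variable [D.IsDerivator]

/-- The comparison between the two squares in `s_* w^* X`. -/
noncomputable def phiSquare (K : Type w) [SmallCategory K] [𝒟.Has K] :
    D.phiDiagram K ⋙ D.map (midMap K Strip.{w} Sq.toCone.{w}) ⟶
      D.phiDiagram K ⋙ D.map (midMap K Strip.{w} Sq.coe.{w}) :=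
  Functor.whiskerLeft (D.phiDiagram K) (D.map₂ (midHom K Strip.{w} Sq.toConeHom))

/-- Restriction to the lower left corners of a family of squares. -/
abbrev evZero (K : Type w) [SmallCategory K] [𝒟.Has K] :
    (D.shift Strip.{w}).obj (K × Sq.{w}) ⥤ (D.shift Strip.{w}).obj K :=
  (D.shift Strip.{w}).map (CategoryTheory.Prod.sectL K Sq.zero.{w})

/-- The counit `s^* s_* w^* X ⟶ w^* X` is an isomorphism. -/
theorem isRan_phiDiagram (X : (D.shift Strip.{w}).obj K) :
    IsRanExt (midMap K Strip.{w} Sq.toCone.{w}) ((D.phiDiagram K).obj X) := by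
  have h := isRan_counit (D := D) (midMap K Strip.{w} Sq.toCone.{w})
    ((D.twistStar K Strip.w Strip.w_mono).obj X)
  have := h.isIso_of_fullyFaithful
  exact h.isRanExt

/-- The square `s^* s_* w^* X` is `w^* X`. -/
noncomputable def phiSquareSource (K : Type w) [SmallCategory K] [𝒟.Has K] :
    D.phiDiagram K ⋙ D.map (midMap K Strip.{w} Sq.toCone.{w}) ≅
      D.twistStar K Strip.w Strip.w_mono :=
  have : ∀ Y, IsIso ((D.ranAdj (midMap K Strip.{w} Sq.toCone.{w})).counit.app Y) := fun Y =>
    (isRan_counit (D := D) (midMap K Strip.{w} Sq.toCone.{w}) Y).isIso_of_fullyFaithful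
  have := NatIso.isIso_of_isIso_app (D.ranAdj (midMap K Strip.{w} Sq.toCone.{w})).counit
  Functor.isoWhiskerLeft (D.twistStar K Strip.w Strip.w_mono)
    (asIso (D.ranAdj (midMap K Strip.{w} Sq.toCone.{w})).counit) ≪≫ Functor.rightUnitor _

/-- Since `(0,0)` is sent to `⊥`, the points of `□` whose image lies above the old vertex `(0,0)`
are exactly those of the corner. -/
theorem isCart_phiSquareTarget (X : (D.shift Strip.{w}).obj K) :
    IsCart ((D.map (midMap K Strip.{w} Sq.coe.{w})).obj ((D.phiDiagram K).obj X)) := by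
  rw [isCart_iff]
  intro k v
  rw [isCartSq_map_iff]
  refine (D.isRan_phiDiagram X).isCartSq Sq.coe SqUR.incl Sq.cornerIso ?_ k v
  intro q hq
  have hq' : q ≠ Sq.zero := by
    rintro rfl
    have h : Sq.toCone.obj Sq.zero = (⊥ : SqCone.{w}) := rfl
    rw [h, le_bot_iff] at hq
    exact WithBot.coe_ne_bot hq
  exact ⟨⟨q, hq'⟩, le_rfl, fun s hs => hs⟩

theorem isIso_whiskerLeft_corner :
    IsIso (Functor.whiskerLeft (cornerIncl K Q) (midHom K Q Sq.toConeHom.{w})) := by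
  have : IsIso (Functor.whiskerLeft SqUR.incl.{w} Sq.toConeHom) := by
    have : Functor.whiskerLeft SqUR.incl.{w} Sq.toConeHom = Sq.cornerIso.hom := by
      ext; exact Subsingleton.elim _ _
    rw [this]
    infer_instance
  have h := isIso_midHom (K := K) (Q := Q) (Functor.whiskerLeft SqUR.incl.{w} Sq.toConeHom)
  exact h

theorem isIso_corner_phiSquare (X : (D.shift Strip.{w}).obj K) :
    IsIso ((D.map (cornerIncl K Strip.{w})).map ((D.phiSquare K).app X)) :=
  D.isIso_map_map₂_app _ _ isIso_whiskerLeft_corner _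

/-- The source of `φ` in terms of the square. -/
noncomputable def phiSourceIso (K : Type w) [SmallCategory K] [𝒟.Has K] :
    D.phiSource K ≅ (D.phiDiagram K ⋙ D.map (midMap K Strip.{w} Sq.toCone.{w})) ⋙ D.evZero K :=
  Functor.isoWhiskerLeft (D.phiDiagram K)
    (D.mapComp ((CategoryTheory.Prod.sectL K Sq.zero.{w}).prod (𝟭 Strip.{w}))
      (midMap K Strip.{w} Sq.toCone.{w}))

/-- The target of `φ` in terms of the square. -/
noncomputable def phiTargetIso (K : Type w) [SmallCategory K] [𝒟.Has K] :
    D.phiTarget K ≅ (D.phiDiagram K ⋙ D.map (midMap K Strip.{w} Sq.coe.{w})) ⋙ D.evZero K :=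
  Functor.isoWhiskerLeft (D.phiDiagram K)
    (D.mapComp ((CategoryTheory.Prod.sectL K Sq.zero.{w}).prod (𝟭 Strip.{w}))
      (midMap K Strip.{w} Sq.coe.{w}))

/-- Exhibits `φ` as the lower left component of the map of squares `phiSquare`, so that facts about
squares can be used for `φ`. -/
theorem phiSourceIso_hom_comp :
    (D.phiSourceIso K).hom ≫ Functor.whiskerRight (D.phiSquare K) (D.evZero K) =
      D.phi K ≫ (D.phiTargetIso K).hom := by
  ext X
  have e : (D.phi K).app X = _ :=
    D.map₂_whiskerLeft_app ((CategoryTheory.Prod.sectL K Sq.zero.{w}).prod (𝟭 Strip.{w}))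
      (midHom K Strip.{w} Sq.toConeHom) ((D.phiDiagram K).obj X)
  rw [NatTrans.comp_app, NatTrans.comp_app, e]
  change (D.mapComp _ _).hom.app _ ≫ _ = _ ≫ (D.mapComp _ _).hom.app _
  rw [mapComp_hom_app, mapComp_hom_app]
  simp
  rfl

theorem isIso_phi_app_iff_evZero (X : (D.shift Strip.{w}).obj K) :
    IsIso ((D.phi K).app X) ↔ IsIso ((D.evZero K).map ((D.phiSquare K).app X)) := by
  have h := congrArg (fun α => α.app X) (D.phiSourceIso_hom_comp (K := K))
  simp only [NatTrans.comp_app, Functor.whiskerRight_app] at h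
  rw [← isIso_comp_right_iff ((D.phi K).app X) ((D.phiTargetIso K).hom.app X), ← h,
    isIso_comp_left_iff]

/-- A map of families of squares is an isomorphism if it is so on corners and at `(0,0)`. -/
theorem isIso_of_corner_of_evZero {E E' : (D.shift Strip.{w}).obj (K × Sq.{w})} (m : E ⟶ E')
    (h : IsIso ((D.map (cornerIncl K Strip.{w})).map m)) (h' : IsIso ((D.evZero K).map m)) :
    IsIso m := by
  have key : ∀ {J : Type w} [SmallCategory J] [𝒟.Has J] (t : J ⥤ (K × Sq.{w}) × Strip.{w}) (j : J),
      IsIso ((D.map t).map m) → IsIso ((D.map (pt (t.obj j))).map m) := by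
    intro J _ _ t j _
    have e : (D.map (pt (t.obj j))).map m ≫ (D.map₂ (ptIso (pt j ⋙ t)).hom).app E' =
        (D.map₂ (ptIso (pt j ⋙ t)).hom).app E ≫ (D.map (pt j ⋙ t)).map m :=
      (D.map₂ (ptIso (pt j ⋙ t)).hom).naturality m
    rw [map_comp_map] at e
    rw [← isIso_comp_right_iff _ ((D.map₂ (ptIso (pt j ⋙ t)).hom).app E')]
    erw [e]
    infer_instance
  refine IsDerivator.der2 (D := D) (K := (K × Sq.{w}) × Strip.{w}) m ?_
  rintro ⟨⟨k, q⟩, v⟩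
  by_cases hq : q = Sq.zero
  · subst hq
    exact key ((CategoryTheory.Prod.sectL K Sq.zero.{w}).prod (𝟭 Strip.{w})) (k, v) h'
  · exact key (cornerIncl K Strip.{w}) ((k, ⟨q, hq⟩), v) h

/-- The map `φ_X` is invertible if and only if the squares `w^* X` are cartesian. -/
theorem isIso_phi_app_iff (X : (D.shift Strip.{w}).obj K) :
    IsIso ((D.phi K).app X) ↔ IsCart ((D.twistStar K Strip.w Strip.w_mono).obj X) := by
  -- `phiSquare` leads from `w^* X` to a cartesian square and is invertible on corners; only its
  -- component at `(0,0)`, which is `φ`, can fail to be invertible.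
  rw [isIso_phi_app_iff_evZero]
  have hc := D.isIso_corner_phiSquare X
  constructor
  · intro h
    have := D.isIso_of_corner_of_evZero _ hc h
    exact (D.isCart_phiSquareTarget X).of_iso
      (inv ((D.phiSquare K).app X) ≫ (D.phiSquareSource K).hom.app X)
  · intro h
    have := (IsRanExt.of_iso h ((D.phiSquareSource K).inv.app X)).isIso (D.isCart_phiSquareTarget X)
      ((D.phiSquare K).app X)
    infer_instance

/-- The square in `K × V` over `k` from which `φ` is read off at `v`. -/
abbrev sqAt (k : K) (v : Strip.{w}) : Sq.{w} ⥤ K × Strip.{w} :=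
  inFiber k (𝟭 Sq.{w}) v ⋙ twist Strip.w Strip.w_mono K

/-- Turns invertibility of `φ` into a condition on squares inside `X`, one for each point of `K ×
V`. In this form it passes to restrictions and can be tested on colimits. -/
theorem isIso_phi_app_iff_isCartSq (X : (D.shift Strip.{w}).obj K) :
    IsIso ((D.phi K).app X) ↔ ∀ k v, IsCartSq (sqAt k v) (show D.obj (K × Strip.{w}) from X) := by
  rw [isIso_phi_app_iff, isCart_iff]
  refine forall₂_congr fun k v => ?_
  exact isCartSq_map_iff

/-- The Ω-spectra are stable under restriction. -/
theorem isOmegaSpectrum_stable : D.Sp.PullbackStable D.IsOmegaSpectrum := by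
  intro J K _ _ _ _ t X hX
  have hX' : IsIso ((D.phi K).app X.obj) := hX
  rw [isIso_phi_app_iff_isCartSq] at hX'
  change IsIso ((D.phi J).app ((D.map (t.prod (𝟭 Strip.{w}))).obj X.obj))
  rw [isIso_phi_app_iff_isCartSq]
  intro j v
  refine isCartSq_map_iff.2 ((hX' (t.obj j) v).congr ?_)
  exact NatIso.ofComponents (fun q => Iso.refl _) (fun f =>
    CategoryTheory.Prod.hom_ext (by simp [sqAt, inFiber, twist]) (Subsingleton.elim _ _))

/-- Natural maps from `w^* X` to cartesian squares that are isomorphisms on corners give the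
arrow `φ` on lower left corners. -/
theorem nonempty_arrow_phi_iso {C : Type*} [Category* C] (H : C ⥤ (D.shift Strip.{w}).obj K)
    {G S : C ⥤ D.obj ((K × Sq.{w}) × Strip.{w})} (ψ : G ⟶ S)
    (e : G ≅ H ⋙ D.twistStar K Strip.w Strip.w_mono) (hS : ∀ X, IsCart (S.obj X))
    (hψ : ∀ X, IsIso ((D.map (cornerIncl K Strip.{w})).map (ψ.app X))) :
    Nonempty (Arrow.mk (Functor.whiskerRight ψ (D.evZero K)) ≅
      Arrow.mk (Functor.whiskerLeft H (D.phi K))) := by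
  -- Both maps start at `w^*` of `H`, end in cartesian squares and are invertible on corners, so
  -- rigidity identifies them.
  obtain ⟨i⟩ := nonempty_arrow_iso ψ (Functor.whiskerLeft H (D.phiSquare K))
    (e ≪≫ Functor.isoWhiskerLeft H (D.phiSquareSource K).symm) hS hψ
    (fun X => D.isCart_phiSquareTarget _) (fun X => D.isIso_corner_phiSquare _)
  have i2 : Arrow.mk (D.phi K) ≅ Arrow.mk (Functor.whiskerRight (D.phiSquare K) (D.evZero K)) :=
    Arrow.isoMk' _ _ (D.phiSourceIso K) (D.phiTargetIso K) D.phiSourceIso_hom_comp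
  exact ⟨((Functor.whiskeringRight _ _ _).obj (D.evZero K)).mapArrow.mapIso i ≪≫
    (((Functor.whiskeringLeft _ _ _).obj H).mapArrow.mapIso i2).symm⟩

end phi
end Prederivator

namespace Prederivator

variable {𝒟 : DiagramClass.{w}} (D : Prederivator.{w, v, u} 𝒟)

/-! ### The squares of the tower -/

section towerSq

theorem isIso_of_sandwich {C : Type*} [Category* C] {A B A₁ B₁ : C} {f : A₁ ⟶ B₁}
    {p : A = A₁} {q : B₁ = B} (h : IsIso (eqToHom p ≫ f ≫ eqToHom q)) : IsIso f := by
  subst p q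
  simpa using h

section arrow

variable {I J L : Type w} [SmallCategory I] [SmallCategory J] [SmallCategory L] [𝒟.Has I]
  [𝒟.Has J] [𝒟.Has L]

/-- Restriction along a whiskered 2-cell. -/
def arrowWhiskerLeft (t : I ⥤ J) {a a' : J ⥤ L} (α : a ⟶ a') :
    Arrow.mk (D.map₂ (Functor.whiskerLeft t α)) ≅
      Arrow.mk (Functor.whiskerRight (D.map₂ α) (D.map t)) :=
  Arrow.isoMk' _ _ (D.mapComp t a) (D.mapComp t a') (by ext; simp [D.map₂_whiskerLeft])

/-- Restriction along a whiskered 2-cell. -/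
def arrowWhiskerRight {a a' : I ⥤ J} (α : a ⟶ a') (t : J ⥤ L) :
    Arrow.mk (D.map₂ (Functor.whiskerRight α t)) ≅
      Arrow.mk (Functor.whiskerLeft (D.map t) (D.map₂ α)) :=
  Arrow.isoMk' _ _ (D.mapComp a t) (D.mapComp a' t) (by ext; simp [D.map₂_whiskerRight])

end arrow

/-- Whiskering an isomorphism of arrows. -/
def arrowIsoWhiskerLeft {B C C' : Type*} [Category* B] [Category* C] [Category* C'] (H : B ⥤ C)
    {F F' G G' : C ⥤ C'} {α : F ⟶ F'} {β : G ⟶ G'} (i : Arrow.mk α ≅ Arrow.mk β) :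
    Arrow.mk (Functor.whiskerLeft H α) ≅ Arrow.mk (Functor.whiskerLeft H β) :=
  ((Functor.whiskeringLeft _ _ _).obj H).mapArrow.mapIso i

/-- Whiskering an isomorphism of arrows. -/
def arrowIsoWhiskerRight {B C C' : Type*} [Category* B] [Category* C] [Category* C'] (H : C ⥤ C')
    {F F' G G' : B ⥤ C} {α : F ⟶ F'} {β : G ⟶ G'} (i : Arrow.mk α ≅ Arrow.mk β) :
    Arrow.mk (Functor.whiskerRight α H) ≅ Arrow.mk (Functor.whiskerRight β H) :=
  ((Functor.whiskeringRight _ _ _).obj H).mapArrow.mapIso i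

/-- Whiskering an arrow with isomorphic functors. -/
def arrowIsoOfIsoLeft {B C C' : Type*} [Category* B] [Category* C] [Category* C'] {H H' : B ⥤ C}
    (i : H ≅ H') {F F' : C ⥤ C'} (α : F ⟶ F') :
    Arrow.mk (Functor.whiskerLeft H α) ≅ Arrow.mk (Functor.whiskerLeft H' α) :=
  Arrow.isoMk' _ _ (Functor.isoWhiskerRight i F) (Functor.isoWhiskerRight i F') (by ext; simp)

/-- Whiskering an arrow with isomorphic functors. -/
def arrowIsoOfIsoRight {B C C' : Type*} [Category* B] [Category* C] [Category* C'] {H H' : C ⥤ C'}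
    (i : H ≅ H') {F F' : B ⥤ C} (α : F ⟶ F') :
    Arrow.mk (Functor.whiskerRight α H) ≅ Arrow.mk (Functor.whiskerRight α H') :=
  Arrow.isoMk' _ _ (Functor.isoWhiskerLeft F i) (Functor.isoWhiskerLeft F' i) (by ext; simp)

/-- The square of `V^{≥ 0}` at the origin. -/
def Sq.corner (q : Sq.{w}) : StripNonneg.{w} :=
  ⟨Strip.w q ⟨0, 0, by simp⟩, by
    obtain ⟨a, b⟩ := q
    cases a <;> cases b <;> simp [Strip.w]⟩

theorem Sq.corner_le_iff {q : Sq.{w}} {p : StripNonneg.{w}} :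
    Sq.corner q ≤ p ↔ (q.a = true → 1 ≤ p.1.i) ∧ (q.b = true → 1 ≤ p.1.j) := by
  obtain ⟨a, b⟩ := q
  obtain ⟨p, h1, h2⟩ := p
  change (_ ≤ _ ∧ _ ≤ _) ↔ _
  cases a <;> cases b <;> simp [Sq.corner, Strip.w, h1, h2]

/-- The definition of `ω` extends that of `w` from the unit square at the origin to all of `V^{≥0}`;
this makes the first square of the tower equal to `w^* X`. -/
theorem Sq.ω_corner (q : Sq.{w}) (v : Strip.{w}) : Strip.ω (Sq.corner q) v = Strip.w q v := by
  obtain ⟨a, b⟩ := q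
  cases a <;> cases b <;> simp [Sq.corner, Strip.w, Strip.ω]

/-- The square of `V^{≥ 0} × {n}` at the origin. -/
def StripNat.sq (n : ℕ) : Sq.{w} ⥤ StripNat.{w} :=
  Monotone.functor (f := fun q => ⟨Sq.corner q, n⟩) fun _ _ h => ⟨Strip.w_mono h le_rfl, le_rfl⟩

/-- The transition between the squares of `V^{≥ 0} × ℕ` at the origin. -/
def StripNat.sqHom (n : ℕ) : StripNat.sq.{w} n ⟶ StripNat.sq (n + 1) where
  app _ := homOfLE ⟨le_rfl, Nat.le_succ n⟩

instance : StripZ.incl.{w}.Full where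
  map_surjective f := ⟨homOfLE (leOfHom f), rfl⟩

instance : StripZ.incl.{w}.Faithful where
  map_injective _ := Subsingleton.elim _ _

variable (K : Type w) [SmallCategory K] [𝒟.Has K] [D.IsDerivator]

/-- The diagram from which the tower is read off. -/
noncomputable def towerDiagram :
    (D.shift Strip.{w}).obj K ⥤ (D.shift Strip.{w}).obj (K × StripNat.{w}) :=
  D.twistStar K Strip.ω Strip.ω_mono ⋙ D.map (midMap K Strip.{w} StripZ.ζ.{w}) ⋙
    D.ran (midMap K Strip.{w} StripZ.incl.{w})

/-- The `n`-th square of the tower. -/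
noncomputable def towerSq (n : ℕ) :
    (D.shift Strip.{w}).obj K ⥤ (D.shift Strip.{w}).obj (K × Sq.{w}) :=
  D.towerDiagram K ⋙ D.map (midMap K Strip.{w} (StripNat.sq.{w} n))

/-- The transition maps between the squares of the tower. -/
noncomputable def towerSqMap (n : ℕ) : D.towerSq K n ⟶ D.towerSq K (n + 1) :=
  Functor.whiskerLeft (D.towerDiagram K) (D.map₂ (midHom K Strip.{w} (StripNat.sqHom.{w} n)))

/-- The transition map at the origin. -/
abbrev zeroHom (n : ℕ) := Functor.whiskerLeft
  ((CategoryTheory.Prod.sectL K Sq.zero.{w}).prod (𝟭 Strip.{w}))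
    (midHom K Strip.{w} (StripNat.sqHom.{w} n))

/-- The arrow in the tower, as a restriction along a 2-cell. -/
noncomputable def towerMapIso' (n : ℕ) : Arrow.mk (D.towerMap K n) ≅
    Arrow.mk (Functor.whiskerLeft (D.towerDiagram K) (D.map₂ (zeroHom K n))) :=
  let α := sectHom K (show (ULift.up n : NatShape.{w}) ≤ ULift.up (n + 1) from Nat.le_succ n)
  have e : Functor.whiskerRight (NatTrans.prod α (𝟙 (𝟭 Strip.{w})))
      (midMap K Strip.{w} StripNat.column.{w}) = zeroHom K n := by
    ext x : 2
    exact midHom_ext rfl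
  arrowIsoWhiskerLeft (D.towerDiagram K) ((D.arrowWhiskerRight (NatTrans.prod α (𝟙 (𝟭 Strip.{w})))
    (midMap K Strip.{w} StripNat.column.{w})).symm ≪≫
      eqToIso (congrArg (fun β => Arrow.mk (D.map₂ β)) e))

/-- The arrow in the tower, read off from the squares. -/
noncomputable def towerMapIso (n : ℕ) :
    Arrow.mk (D.towerMap K n) ≅ Arrow.mk (Functor.whiskerRight (D.towerSqMap K n) (D.evZero K)) :=
  D.towerMapIso' K n ≪≫ arrowIsoWhiskerLeft (D.towerDiagram K) (D.arrowWhiskerLeft _ _)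

end towerSq
end Prederivator

namespace Prederivator

variable {𝒟 : DiagramClass.{w}} (D : Prederivator.{w, v, u} 𝒟)

/-! ### The cartesian squares of the tower and its initial arrow -/

section towerBase

/-- The part of `V^{≥ 0} × ℕ` obtained by removing the entries `(0,0,k)` with `k > 0`. -/
abbrev StripNatRel : Type w := {x : StripNat.{w} // x.p = StripNonneg.zero → x.k = 0}

/-- The inclusion. -/
def StripNatRel.incl : StripNatRel.{w} ⥤ StripNat.{w} :=
  Monotone.functor (f := Subtype.val) fun _ _ h => h

/-- The inclusion of `Z`. -/
def StripNatRel.ofZ : StripZ.{w} ⥤ StripNatRel.{w} :=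
  Monotone.functor (f := fun x => ⟨x.1, fun h => by
    have h1 := x.2
    rw [h] at h1
    have : (x.1.k : ℤ) ≤ 0 := h1 rfl
    omega⟩) fun _ _ h => h

instance : StripNatRel.incl.{w}.Full where
  map_surjective f := ⟨homOfLE (leOfHom f), rfl⟩

instance : StripNatRel.incl.{w}.Faithful where
  map_injective _ := Subsingleton.elim _ _

instance : StripNatRel.ofZ.{w}.Full where
  map_surjective f := ⟨homOfLE (leOfHom f), rfl⟩

instance : StripNatRel.ofZ.{w}.Faithful where
  map_injective _ := Subsingleton.elim _ _

theorem StripNonneg.eq_zero_iff {p : StripNonneg.{w}} :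
    p = StripNonneg.zero ↔ p.1.i < 1 ∧ p.1.j < 1 := by
  obtain ⟨p, h1, h2⟩ := p
  constructor
  · intro h
    have h' := congrArg Subtype.val h
    change p = _ at h'
    subst h'
    exact ⟨zero_lt_one, zero_lt_one⟩
  · rintro ⟨h3, h4⟩
    refine Subtype.ext (Strip.ext ?_ ?_)
    · change p.i = 0
      change p.i < 1 at h3
      omega
    · change p.j = 0
      change p.j < 1 at h4
      omega

/-- The corner of the `n`-th square. -/
def StripNatRel.corner (n : ℕ) : SqUR.{w} ⥤ StripNatRel.{w} :=
  Monotone.functor (f := fun q => ⟨(StripNat.sq n).obj q.1, fun h => by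
    have h1 : Sq.corner q.1 ≤ StripNonneg.zero := le_of_eq h
    rw [Sq.corner_le_iff] at h1
    obtain ⟨⟨a, b⟩, hq⟩ := q
    cases a <;> cases b <;> simp [StripNonneg.zero] at h1 hq⟩)
    fun _ _ h => (StripNat.sq n).monotone h

variable (K : Type w) [SmallCategory K] [𝒟.Has K] [D.IsDerivator]

theorem isRanExt_towerDiagram (X : (D.shift Strip.{w}).obj K) :
    IsRanExt (midMap K Strip.{w} StripZ.incl.{w}) ((D.towerDiagram K).obj X) := by
  have h := isRan_counit (D := D) (midMap K Strip.{w} StripZ.incl.{w})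
    ((D.map (midMap K Strip.{w} StripZ.ζ.{w})).obj ((D.twistStar K Strip.ω Strip.ω_mono).obj X))
  have := h.isIso_of_fullyFaithful
  exact h.isRanExt

/-- `Z` contains none of the points `(0,0,k)` with `k > 0`, so the tower diagram is right Kan
extended from the complement of all of them. A point of this complement above `(0,0,n+1)` lies away
from the origin, so the corner is initial in the slice. -/
theorem isCart_towerSq_succ (X : (D.shift Strip.{w}).obj K) (n : ℕ) :
    IsCart ((D.towerSq K (n + 1)).obj X) := by
  rw [isCart_iff]
  intro k v
  refine isCartSq_map_iff.2 ?_
  have h := (show IsRanExt (midMap K Strip.{w} StripNatRel.ofZ.{w} ⋙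
    midMap K Strip.{w} StripNatRel.incl.{w}) ((D.towerDiagram K).obj X) from
      D.isRanExt_towerDiagram K X).right
  refine h.isCartSq (StripNat.sq (n + 1)) (StripNatRel.corner (n + 1)) (Iso.refl _) ?_ k v
  rintro ⟨⟨p, m⟩, hp⟩ ⟨h1, h2⟩
  have hp' : ¬ (p.1.i < 1 ∧ p.1.j < 1) := fun h3 => by
    have h4 : m = 0 := hp (StripNonneg.eq_zero_iff.2 h3)
    have h5 : n + 1 ≤ m := h2
    omega
  -- The greatest vertex of the corner below `p`; it is not `(0,0)` because `p` is not the origin.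
  refine ⟨⟨⟨decide (1 ≤ p.1.i), decide (1 ≤ p.1.j)⟩, fun h3 => hp' ?_⟩, ⟨?_, h2⟩, ?_⟩
  · have h4 := congrArg Sq.a h3
    have h5 := congrArg Sq.b h3
    simpa using And.intro h4 h5
  · exact Sq.corner_le_iff.2 (by simp)
  · rintro ⟨q, hq⟩ ⟨h3, _⟩
    have h4 := Sq.corner_le_iff.1 h3
    constructor
    · intro ha
      simpa using h4.1 ha
    · intro hb
      simpa using h4.2 hb

/-- The restriction of a right Kan extension along a fully faithful functor. -/
noncomputable def ranCounitIso {I J : Type w} [SmallCategory I] [SmallCategory J] [𝒟.Has I]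
    [𝒟.Has J] (f : I ⥤ J) [f.Full] [f.Faithful] : D.ran f ⋙ D.map f ≅ 𝟭 (D.obj I) :=
  have : ∀ Y, IsIso ((D.ranAdj f).counit.app Y) := fun Y =>
    (isRan_counit (D := D) f Y).isIso_of_fullyFaithful
  have := NatIso.isIso_of_isIso_app (D.ranAdj f).counit
  asIso (D.ranAdj f).counit

/-- The square in `Z` at the origin. -/
def StripZ.sq : Sq.{w} ⥤ StripZ.{w} :=
  Monotone.functor (f := fun q => ⟨⟨Sq.corner q, 0⟩, fun _ => (Sq.corner q).2.1⟩) fun _ _ h =>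
    ⟨Strip.w_mono h le_rfl, le_rfl⟩

/-- The part of the tower diagram over `Z`. -/
noncomputable def towerDiagramZ : D.towerDiagram K ⋙ D.map (midMap K Strip.{w} StripZ.incl.{w}) ≅
    D.twistStar K Strip.ω Strip.ω_mono ⋙ D.map (midMap K Strip.{w} StripZ.ζ.{w}) :=
  Functor.isoWhiskerLeft
    (D.twistStar K Strip.ω Strip.ω_mono ⋙ D.map (midMap K Strip.{w} StripZ.ζ.{w}))
    (D.ranCounitIso (midMap K Strip.{w} StripZ.incl.{w})) ≪≫ Functor.rightUnitor _

/-- The initial square of the tower is `w^* X`. -/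
noncomputable def towerSqZeroIso : D.towerSq K 0 ≅ D.twistStar K Strip.w Strip.w_mono :=
  Functor.isoWhiskerLeft (D.towerDiagram K) (D.mapComp (midMap K Strip.{w} StripZ.sq.{w})
      (midMap K Strip.{w} StripZ.incl.{w})) ≪≫
    Functor.isoWhiskerRight (D.towerDiagramZ K) (D.map (midMap K Strip.{w} StripZ.sq.{w})) ≪≫
    Functor.isoWhiskerLeft (D.twistStar K Strip.ω Strip.ω_mono)
      (D.mapComp (midMap K Strip.{w} StripZ.sq.{w}) (midMap K Strip.{w} StripZ.ζ.{w})).symm ≪≫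
    (D.mapComp (midMap K Strip.{w} (StripZ.sq.{w} ⋙ StripZ.ζ.{w}))
      (twist Strip.ω Strip.ω_mono K)).symm ≪≫
    D.mapIso (NatIso.ofComponents (fun x => Iso.prod (Iso.refl x.1.1)
      (eqToIso (Sq.ω_corner x.1.2 x.2))) fun _ => CategoryTheory.Prod.hom_ext
        ((Category.comp_id _).trans (Category.id_comp _).symm) (Subsingleton.elim _ _))

/-- A transition map in a right Kan extension of `ζ^* W` that becomes invertible under `ζ`. -/
theorem isIso_map₂_app_ran {I A B C : Type w} [SmallCategory I] [SmallCategory A]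
    [SmallCategory B] [SmallCategory C] [𝒟.Has I] [𝒟.Has A] [𝒟.Has B] [𝒟.Has C] (f : A ⥤ B)
    [f.Full] [f.Faithful] (ζ : A ⥤ C) {z z' : I ⥤ A} (β : z ⟶ z')
    (h : IsIso (Functor.whiskerRight β ζ)) (W : D.obj C) :
    IsIso ((D.map₂ (Functor.whiskerRight β f)).app ((D.ran f).obj ((D.map ζ).obj W))) := by
  have h1 := (isRan_counit (D := D) f ((D.map ζ).obj W)).isIso_of_fullyFaithful
  have h2 := (D.map₂ β).naturality (ranCounit f ((D.map ζ).obj W))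
  have h3 : (D.map₂ β).app ((D.map ζ).obj W) = eqToHom (D.map_comp_obj z ζ W).symm ≫
      (D.map₂ (Functor.whiskerRight β ζ)).app W ≫ eqToHom (D.map_comp_obj z' ζ W) := by
    rw [map₂_whiskerRight_app]; simp
  have h4 : IsIso ((D.map₂ β).app ((D.map ζ).obj W)) := by
    rw [h3]
    infer_instance
  rw [map₂_whiskerRight_app, isIso_comp_left_iff, isIso_comp_right_iff,
    ← isIso_comp_right_iff _ ((D.map z').map (ranCounit f ((D.map ζ).obj W))), ← h2]
  infer_instance

/-- The corners of the squares `0` and `1` in `Z`. -/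
def StripZ.corner (n : ℕ) (hn : n ≤ 1) : SqUR.{w} ⥤ StripZ.{w} :=
  Monotone.functor (f := fun q => ⟨(StripNat.sq n).obj q.1, fun h => by
    obtain ⟨⟨a, b⟩, hq⟩ := q
    have : (n : ℤ) ≤ 1 := by exact_mod_cast hn
    cases a <;> cases b <;> simp [StripNat.sq, Sq.corner, Strip.w] at h hq ⊢
    exact hn⟩) fun _ _ h => (StripNat.sq n).monotone h

/-- In heights `0` and `1` the corners lie in `Z`: the points `(1,0)` and `(0,1)` are off the
diagonal, and `(1,1)` admits heights up to `1`. Over `Z` the diagram is pulled back along `ζ`, which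
forgets the height. -/
theorem isIso_corner_towerSqMap (X : (D.shift Strip.{w}).obj K) :
    IsIso ((D.map (cornerIncl K Strip.{w})).map ((D.towerSqMap K 0).app X)) := by
  let β : StripZ.corner.{w} 0 zero_le_one ⟶ StripZ.corner 1 le_rfl :=
    { app := fun _ => homOfLE ⟨le_rfl, zero_le_one⟩ }
  have h1 : IsIso (Functor.whiskerRight β StripZ.ζ.{w}) :=
    ⟨⟨{ app := fun _ => 𝟙 _ }, by ext; exact Subsingleton.elim _ _,
      by ext; exact Subsingleton.elim _ _⟩⟩
  have h2 : IsIso (Functor.whiskerRight (midHom K Strip.{w} β) (midMap K Strip.{w} StripZ.ζ.{w})) :=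
    isIso_midHom (K := K) (Q := Strip.{w}) (Functor.whiskerRight β StripZ.ζ.{w})
  have h3 := D.isIso_map₂_app_ran (midMap K Strip.{w} StripZ.incl.{w}) _ _ h2
    ((D.twistStar K Strip.ω Strip.ω_mono).obj X)
  have h4 := D.map₂_whiskerLeft_app (cornerIncl K Strip.{w})
    (midHom K Strip.{w} (StripNat.sqHom.{w} 0)) ((D.towerDiagram K).obj X)
  have h5 : Functor.whiskerLeft (cornerIncl K Strip.{w})
      (midHom K Strip.{w} (StripNat.sqHom.{w} 0)) =
      Functor.whiskerRight (midHom K Strip.{w} β) (midMap K Strip.{w} StripZ.incl.{w}) := by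
    ext x : 2
    exact midHom_ext rfl
  have h6 := (congrArg (fun γ => (D.map₂ γ).app ((D.towerDiagram K).obj X)) h5).symm.trans h4
  exact isIso_of_sandwich (h6 ▸ h3)

/-- The initial map of the tower is `φ`. -/
theorem nonempty_towerMap_zero_iso :
    Nonempty (Arrow.mk (D.towerMap K 0) ≅ Arrow.mk (D.phi K)) := by
  obtain ⟨i⟩ := D.nonempty_arrow_phi_iso (𝟭 _) (D.towerSqMap K 0) (D.towerSqZeroIso K)
    (fun X => D.isCart_towerSq_succ K X 0) (fun X => D.isIso_corner_towerSqMap K X)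
  exact ⟨D.towerMapIso K 0 ≪≫ i⟩

end towerBase
end Prederivator

namespace Prederivator

variable {𝒟 : DiagramClass.{w}} {D : Prederivator.{w, v, u} 𝒟}

/-! ### Vanishing of the tower diagram of a prespectrum off the diagonal -/

section zeros

/-- Evaluation at a point of the image of a functor. -/
def ptMapIso {J K : Type w} [SmallCategory J] [SmallCategory K] [𝒟.Has J] [𝒟.Has K] (t : J ⥤ K)
    (j : J) (E : D.obj K) :
    (D.map (pt (t.obj j))).obj E ≅ (D.map (pt j)).obj ((D.map t).obj E) :=
  (D.mapIso (ptIso (pt j ⋙ t))).app E ≪≫ (D.mapComp (pt j) t).app E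

/-- A morphism that is invertible after restriction is invertible at the points in the image. -/
theorem isIso_map_pt_of_isIso_map {I J : Type w} [SmallCategory I] [SmallCategory J] [𝒟.Has I]
    [𝒟.Has J] (t : I ⥤ J) (i : I) {E E' : D.obj J} (m : E ⟶ E') [IsIso ((D.map t).map m)] :
    IsIso ((D.map (pt (t.obj i))).map m) := by
  have h := NatIso.naturality_2 (D.mapIso (ptIso (pt i ⋙ t)) ≪≫ D.mapComp (pt i) t) m
  change IsIso ((D.map (pt ((pt i ⋙ t).obj PUnit.unit))).map m)
  rw [← h]
  have : IsIso ((D.map t ⋙ D.map (pt i)).map m) :=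
    inferInstanceAs (IsIso ((D.map (pt i)).map ((D.map t).map m)))
  infer_instance

variable {K : Type w} [SmallCategory K] [𝒟.Has K]

theorem IsPrespectrum.isZero_at {X : (D.shift Strip.{w}).obj K} (hX : D.IsPrespectrum K X)
    (hD : D.HasKan) (k : K) {v : Strip.{w}} (hv : |v.i - v.j| = 1) :
    IsZero ((D.map (pt ((k, v) : K × Strip.{w}))).obj X) :=
  (isZero_obj_of_adjoints (D.map (pt ((k, ⟨v, hv⟩) : K × StripBd.{w}))) hX).of_iso
    (ptMapIso ((𝟭 K).prod StripBd.incl.{w}) (k, ⟨v, hv⟩) X)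

variable [D.IsDerivator]

theorem IsPointed.isPrespectrum (hpt : D.IsPointed) {X : (D.shift Strip.{w}).obj K}
    (hX : ∀ (k : K) (v : Strip.{w}), |v.i - v.j| = 1 →
      IsZero ((D.map (pt ((k, v) : K × Strip.{w}))).obj X)) : D.IsPrespectrum K X := by
  refine hpt.isZero_of_pointwise ?_
  rintro ⟨k, v, hv⟩
  exact (hX k v hv).of_iso (ptMapIso ((𝟭 K).prod StripBd.incl.{w}) (k, ⟨v, hv⟩) X).symm

/-- The values of the tower diagram over `Z`. -/
noncomputable def towerDiagramAt (k : K) (z : StripZ.{w}) (v : Strip.{w})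
    (X : (D.shift Strip.{w}).obj K) :
    (D.map (pt (((k, z.1), v) : (K × StripNat.{w}) × Strip.{w}))).obj ((D.towerDiagram K).obj X) ≅
      (D.map (pt ((k, Strip.ω z.1.p v) : K × Strip.{w}))).obj X :=
  ptMapIso (midMap K Strip.{w} StripZ.incl.{w}) ((k, z), v) ((D.towerDiagram K).obj X) ≪≫
    (D.map (pt (((k, z), v) : (K × StripZ.{w}) × Strip.{w}))).mapIso ((D.towerDiagramZ K).app X) ≪≫
    (ptMapIso (midMap K Strip.{w} StripZ.ζ.{w}) ((k, z), v)
      ((D.twistStar K Strip.ω Strip.ω_mono).obj X)).symm ≪≫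
    (ptMapIso (twist Strip.ω Strip.ω_mono K) ((k, z.1.p), v) X).symm

/-- The coordinates of `p` differ by one, hence have different parity, so both entries of `ω p v`
are formed from the same coordinate of `v`. This is the purpose of the alternation in `ω`. -/
theorem Strip.abs_ω (p : StripNonneg.{w}) (v : Strip.{w}) (hp : p.1.i ≠ p.1.j) :
    |(Strip.ω p v).i - (Strip.ω p v).j| = 1 := by
  obtain ⟨⟨a, b, hab⟩, ha, hb⟩ := p
  obtain ⟨i, j, hij⟩ := v
  change a ≠ b at hp
  have h1 := abs_le.1 hab
  change |((if Even a then i else j) + a) - ((if Even b then j else i) + b)| = 1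
  rw [abs_eq zero_le_one]
  simp only [Int.even_iff]
  split_ifs <;> omega

theorem IsPrespectrum.isZero_towerDiagram {X : (D.shift Strip.{w}).obj K}
    (hX : D.IsPrespectrum K X) (k : K) {x : StripNat.{w}} (hx : x.p.1.i ≠ x.p.1.j)
    (v : Strip.{w}) :
    IsZero ((D.map (pt (((k, x), v) : (K × StripNat.{w}) × Strip.{w}))).obj
      ((D.towerDiagram K).obj X)) :=
  (hX.isZero_at inferInstance k (Strip.abs_ω x.p v hx)).of_iso
    (towerDiagramAt k ⟨x, fun h => absurd h hx⟩ v X)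

theorem Sq.corner_ne {q : Sq.{w}} (h0 : q ≠ Sq.zero) (h1 : q ≠ ⟨true, true⟩) :
    (Sq.corner q).1.i ≠ (Sq.corner q).1.j := by
  obtain ⟨a, b⟩ := q
  cases a <;> cases b <;> simp [Sq.corner, Strip.w] at h0 h1 ⊢

theorem IsPrespectrum.isZero_towerSq {X : (D.shift Strip.{w}).obj K}
    (hX : D.IsPrespectrum K X) (n : ℕ) (k : K) {q : Sq.{w}} (h0 : q ≠ Sq.zero)
    (h1 : q ≠ ⟨true, true⟩) (v : Strip.{w}) :
    IsZero ((D.map (pt (((k, q), v) : (K × Sq.{w}) × Strip.{w}))).obj ((D.towerSq K n).obj X)) :=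
  (hX.isZero_towerDiagram k (x := (StripNat.sq n).obj q) (Sq.corner_ne h0 h1) v).of_iso
    (ptMapIso (midMap K Strip.{w} (StripNat.sq.{w} n)) ((k, q), v)
      ((D.towerDiagram K).obj X)).symm

end zeros

/-! ### Loops and cartesian squares -/

section loop

theorem isLan_toPt_of_isIso {E Y : D.obj Pt.{w}} (κ : Y ⟶ (D.map (toPt Pt.{w})).obj E)
    [IsIso κ] : IsLan (toPt Pt.{w}) κ := by
  have h : ∀ {X X' : D.obj Pt.{w}} (f : X ⟶ X'), (D.map (toPt Pt.{w})).map f =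
      eqToHom (D.map_id_obj X) ≫ f ≫ eqToHom (D.map_id_obj X').symm := D.map_id_map
  intro Z
  constructor
  · intro f g hfg
    simp only [h, cancel_epi] at hfg
    exact (cancel_mono _).1 hfg
  · intro f
    exact ⟨eqToHom (D.map_id_obj E).symm ≫ inv κ ≫ f ≫ eqToHom (D.map_id_obj Z), by simp [h]⟩

/-- A left Kan extension along a functor from an empty shape. -/
theorem IsPointed.isLan_of_isEmpty [D.IsDerivator] (hpt : D.IsPointed) {J K : Type w}
    [SmallCategory J] [SmallCategory K] [𝒟.Has J] [𝒟.Has K] [IsEmpty J] {t : J ⥤ K} {E : D.obj K}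
    {Y : D.obj J} (κ : Y ⟶ (D.map t).obj E) (hE : IsZero E) : IsLan t κ := fun Z => by
  have hY : IsZero Y := hpt.isZero_of_pointwise fun k => isEmptyElim k
  exact ⟨fun _ _ _ => hE.eq_of_src _ _, fun f => ⟨hE.to_ Z, hY.eq_of_src _ _⟩⟩

/-- The corner `(1,1)`. -/
abbrev SqUR.one : SqUR.{w} := ⟨⟨true, true⟩, by simp⟩

theorem SqUR.le_one (s : SqUR.{w}) : s ≤ SqUR.one := ⟨Bool.le_true _, Bool.le_true _⟩

variable (K Q : Type w) [SmallCategory K] [PartialOrder Q] [𝒟.Has K] [D.IsDerivator]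

/-- The inclusion of the upper right corners in families of corners. -/
abbrev oneIncl : K × Q ⥤ (K × SqUR.{w}) × Q :=
  (CategoryTheory.Prod.sectL K SqUR.one.{w}).prod (𝟭 Q)

variable {K Q}

/-- The vertex `(1,1)` is greatest in the corner, so the slices over all other vertices are empty
and left extension puts zeros there. A diagram already zero at those vertices is thus extended from
`(1,1)`. -/
theorem IsPointed.isLan_oneIncl (hpt : D.IsPointed) {Y : D.obj ((K × SqUR.{w}) × Q)}
    (hY : ∀ k s v, s ≠ SqUR.one → IsZero ((D.map (pt ((k, s), v))).obj Y)) :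
    IsLan (oneIncl K Q) (𝟙 ((D.map (oneIncl K Q)).obj Y)) := by
  have h1 : IsOverPoset (oneIncl K Q ⋙ CategoryTheory.Prod.fst (K × SqUR.{w}) Q ⋙
    CategoryTheory.Prod.fst K SqUR.{w}) Prod.snd := isOverPoset_fst (K := K) (P := Q)
  refine isLan_of_pointwise ?_
  rintro ⟨⟨k, s⟩, v⟩
  by_cases hs : s = SqUR.one
  · subst hs
    let γ : pt (k, v) ⋙ oneIncl K Q ⟶ toPt Pt.{w} ⋙ pt ((k, SqUR.one), v) := { app := fun _ => 𝟙 _ }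
    have hγ : IsIso γ := by
      have : ∀ X, IsIso (γ.app X) := fun _ => inferInstanceAs (IsIso (𝟙 _))
      exact NatIso.isIso_of_isIso_app _
    refine ⟨Pt.{w}, inferInstance, pt (k, v), γ, ?_, ?_⟩
    · exact LanData.of_poset h1 isOverPoset_fst_fst (fun s => inferInstanceAs (IsIso (𝟙 k)))
        fun a h => ⟨PUnit.unit, h.2, fun _ _ => le_rfl⟩
    · have : IsIso (push γ (𝟙 ((D.map (oneIncl K Q)).obj Y))) := by
        rw [push, cell_app]
        infer_instance
      exact isLan_toPt_of_isIso _
  · let S : Type w := {x : Pt.{w} // False}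
    have : IsEmpty S := ⟨fun x => x.2⟩
    let g : S ⥤ K × Q := { obj := fun x => x.2.elim, map := fun {x} => x.2.elim,
                           map_id := fun x => x.2.elim, map_comp := fun {x} => x.2.elim }
    let γ : g ⋙ oneIncl K Q ⟶ toPt S ⋙ pt ((k, s), v) :=
      { app := fun x => x.2.elim, naturality := fun {x} => x.2.elim }
    refine ⟨S, inferInstance, g, γ, ?_, hpt.isLan_of_isEmpty _ (hY k s v hs)⟩
    exact LanData.of_poset h1 isOverPoset_fst_fst (fun s => s.2.elim)
      fun a h => absurd (le_antisymm (SqUR.le_one s) h.1) hs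

theorem isIso_lanCounit {I J : Type w} [SmallCategory I] [SmallCategory J] [𝒟.Has I] [𝒟.Has J]
    {t : I ⥤ J} {Y : D.obj J} (h : IsLan t (𝟙 ((D.map t).obj Y))) :
    IsIso ((D.lanAdj t).counit.app Y) :=
  IsLan.isIso (isLan_unit t ((D.map t).obj Y)) h _ (𝟙 _)
    (((D.lanAdj t).right_triangle_components Y).trans (Category.comp_id _).symm)

/-- A natural transformation that is invertible on the ends of an arrow. -/
theorem nonempty_arrow_whiskerRight_iso {C C' C'' : Type*} [Category* C] [Category* C']
    [Category* C''] {S S' : C ⥤ C'} (ψ : S ⟶ S') {F G : C' ⥤ C''} (α : F ⟶ G)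
    (h : ∀ X, IsIso (α.app (S.obj X))) (h' : ∀ X, IsIso (α.app (S'.obj X))) :
    Nonempty (Arrow.mk (Functor.whiskerRight ψ F) ≅ Arrow.mk (Functor.whiskerRight ψ G)) := by
  have h1 : ∀ X, IsIso ((Functor.whiskerLeft S α).app X) := h
  have h2 : ∀ X, IsIso ((Functor.whiskerLeft S' α).app X) := h'
  have := NatIso.isIso_of_isIso_app (Functor.whiskerLeft S α)
  have := NatIso.isIso_of_isIso_app (Functor.whiskerLeft S' α)
  exact ⟨Arrow.isoMk' _ _ (asIso (Functor.whiskerLeft S α)) (asIso (Functor.whiskerLeft S' α))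
    (by ext; simp)⟩

/-- The cartesian squares with zeros at `(1,0)` and `(0,1)`. -/
def IsLoopSq (E : D.obj ((K × Sq.{w}) × Q)) : Prop :=
  IsCart E ∧ ∀ k q v, q ≠ Sq.zero → q ≠ ⟨true, true⟩ → IsZero ((D.map (pt ((k, q), v))).obj E)

/-- Restriction to the upper right corners of a family of squares. -/
abbrev evOne (D : Prederivator.{w, v, u} 𝒟) (K : Type w) [SmallCategory K] [𝒟.Has K] :
    (D.shift Strip.{w}).obj (K × Sq.{w}) ⥤ (D.shift Strip.{w}).obj K :=
  (D.shift Strip.{w}).map (CategoryTheory.Prod.sectL K ⟨true, true⟩)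

/-- The lower left corner of a loop square is the loop object of the upper right corner. -/
theorem IsPointed.nonempty_arrow_evZero_iso (hpt : D.IsPointed) {C : Type*} [Category* C]
    {S S' : C ⥤ (D.shift Strip.{w}).obj (K × Sq.{w})} (ψ : S ⟶ S')
    (hS : ∀ X, IsLoopSq (Q := Strip.{w}) (S.obj X))
    (hS' : ∀ X, IsLoopSq (Q := Strip.{w}) (S'.obj X)) :
    Nonempty (Arrow.mk (Functor.whiskerRight ψ (D.evZero K)) ≅
      Arrow.mk (Functor.whiskerRight ψ (evOne D K ⋙ (D.shift Strip.{w}).loop K))) := by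
  let c := cornerIncl K Strip.{w}
  let j := oneIncl K Strip.{w}
  -- On loop squares the unit of `c^* ⊣ c_*` is invertible by cartesianness and the counit of `j_! ⊣
  -- j^*` by the zeros. They connect evaluation at `(0,0)` with `j_!` and `R` applied to the value
  -- at `(1,1)`, which is the definition of `loop`.
  let R : D.obj ((K × SqUR.{w}) × Strip.{w}) ⥤ (D.shift Strip.{w}).obj K := D.ran c ⋙ D.evZero K
  let α : D.evZero K ⟶ D.map c ⋙ R := Functor.whiskerRight (D.ranAdj c).unit (D.evZero K)
  let β : D.map c ⋙ (D.map j ⋙ D.lan j) ⋙ R ⟶ D.map c ⋙ R :=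
    Functor.whiskerLeft (D.map c) (Functor.whiskerRight (D.lanAdj j).counit R)
  have hα : ∀ E : D.obj ((K × Sq.{w}) × Strip.{w}), IsLoopSq E → IsIso (α.app E) := fun E hE => by
    have := isIso_unit_of_isCart hE.1
    exact inferInstanceAs (IsIso ((D.evZero K).map ((D.ranAdj c).unit.app E)))
  have hβ : ∀ E : D.obj ((K × Sq.{w}) × Strip.{w}), IsLoopSq E → IsIso (β.app E) := fun E hE => by
    have : IsIso ((D.lanAdj j).counit.app ((D.map c).obj E)) := isIso_lanCounit <|
      hpt.isLan_oneIncl fun k s v hs => (hE.2 k s.1 v s.2 fun h => hs (Subtype.ext h)).of_iso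
        (ptMapIso c ((k, s), v) E).symm
    exact inferInstanceAs (IsIso (R.map ((D.lanAdj j).counit.app ((D.map c).obj E))))
  obtain ⟨i1⟩ := nonempty_arrow_whiskerRight_iso ψ α (fun X => hα _ (hS X)) (fun X => hα _ (hS' X))
  obtain ⟨i2⟩ := nonempty_arrow_whiskerRight_iso ψ β (fun X => hβ _ (hS X)) (fun X => hβ _ (hS' X))
  let γ : evOne D K ⋙ (D.shift Strip.{w}).loop K ≅ D.map c ⋙ (D.map j ⋙ D.lan j) ⋙ R :=
    Functor.isoWhiskerRight (D.mapComp j c) (D.lan j ⋙ R)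
  obtain ⟨i3⟩ := nonempty_arrow_whiskerRight_iso ψ γ.hom (fun _ => inferInstance)
    (fun _ => inferInstance)
  exact ⟨i1 ≪≫ i2.symm ≪≫ i3.symm⟩

end loop
end Prederivator

namespace Prederivator

variable {𝒟 : DiagramClass.{w}} {D : Prederivator.{w, v, u} 𝒟}

/-! ### The inductive description of the tower -/

section shift

/-- The shift of `V^{≥ 0}`. -/
def StripNonneg.shift (p : StripNonneg.{w}) : StripNonneg.{w} :=
  ⟨Strip.σ.obj p.1, Int.le_add_one p.2.2, Int.le_add_one p.2.1⟩

/-- Adding one changes parities and so exchanges the roles of `i` and `j`; the twist in `σ` accounts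
exactly for this exchange. -/
theorem Strip.ω_shift (p : StripNonneg.{w}) (v : Strip.{w}) :
    Strip.ω (StripNonneg.shift p) v = Strip.σ.obj (Strip.ω p v) := by
  refine Strip.ext ?_ ?_
  · change (if Even (p.1.j + 1) then v.i else v.j) + (p.1.j + 1) =
      (if Even p.1.j then v.j else v.i) + p.1.j + 1
    simp only [Int.even_iff]
    split_ifs <;> omega
  · change (if Even (p.1.i + 1) then v.j else v.i) + (p.1.i + 1) =
      (if Even p.1.i then v.i else v.j) + p.1.i + 1
    simp only [Int.even_iff]
    split_ifs <;> omega

/-- The shift of `V^{≥ 0} × ℕ`. -/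
def StripNat.shift : StripNat.{w} ⥤ StripNat.{w} :=
  Monotone.functor (f := fun x => ⟨StripNonneg.shift x.p, x.k + 1⟩) fun _ _ h =>
    ⟨Strip.σ.monotone h.1, Nat.succ_le_succ h.2⟩

/-- The shift of `Z`. -/
def StripZ.shift : StripZ.{w} ⥤ StripZ.{w} :=
  Monotone.functor (f := fun x => ⟨StripNat.shift.obj x.1, fun h => by
    have h1 : x.1.p.1.j + 1 = x.1.p.1.i + 1 := h
    have h2 := x.2 (by omega)
    change ((x.1.k + 1 : ℕ) : ℤ) ≤ x.1.p.1.j + 1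
    push_cast
    omega⟩) fun _ _ h => StripNat.shift.monotone h

/-- Every element of `Z` above a shifted element is shifted. -/
theorem StripZ.exists_shift {x : StripNat.{w}} {z : StripZ.{w}} (h : StripNat.shift.obj x ≤ z.1) :
    ∃ z' : StripZ.{w}, x ≤ z'.1 ∧ StripZ.shift.obj z' = z := by
  obtain ⟨⟨⟨⟨a, b, hab⟩, ha, hb⟩, k⟩, hz⟩ := z
  obtain ⟨⟨⟨a', b', hab'⟩, ha', hb'⟩, k'⟩ := x
  obtain ⟨⟨h1, h2⟩, h3⟩ := h
  change b' + 1 ≤ a at h1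
  change a' + 1 ≤ b at h2
  change k' + 1 ≤ k at h3
  change a = b → (k : ℤ) ≤ a at hz
  change 0 ≤ a' at ha'
  change 0 ≤ b' at hb'
  -- Above a shifted element all three coordinates are at least `1`. The inequality defining `Z` is
  -- unaffected by lowering both of its sides by one.
  obtain ⟨k, rfl⟩ : ∃ m, k = m + 1 := ⟨k - 1, by omega⟩
  refine ⟨⟨⟨⟨⟨b - 1, a - 1, ?_⟩, ?_, ?_⟩, k⟩, ?_⟩, ⟨⟨?_, ?_⟩, ?_⟩, ?_⟩
  · have := abs_le.1 hab
    rw [abs_le]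
    omega
  · change 0 ≤ b - 1
    omega
  · change 0 ≤ a - 1
    omega
  · intro h
    change b - 1 = a - 1 at h
    change (k : ℤ) ≤ b - 1
    have := hz (by omega)
    push_cast at this
    omega
  · change a' ≤ b - 1
    omega
  · change b' ≤ a - 1
    omega
  · change k' ≤ k
    omega
  · refine Subtype.ext (StripNat.ext (Subtype.ext (Strip.ext ?_ ?_)) rfl)
    · exact sub_add_cancel a 1
    · exact sub_add_cancel b 1

theorem StripNat.le_of_shift_le {x y : StripNat.{w}}
    (h : StripNat.shift.obj x ≤ StripNat.shift.obj y) : x ≤ y := by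
  obtain ⟨⟨h1, h2⟩, h3⟩ := h
  exact ⟨⟨(add_le_add_iff_right 1).1 h2, (add_le_add_iff_right 1).1 h1⟩, Nat.le_of_succ_le_succ h3⟩

variable (K : Type w) [SmallCategory K] [𝒟.Has K] [D.IsDerivator]

/-- The part of `Z` above a shifted point is the shift of the part above the original point, so both
sides of the mate are limits over one poset. -/
theorem isIso_rightMate_shift : IsIso (D.rightMate (a := midMap K Strip.{w} StripZ.incl.{w})
    (b := midMap K Strip.{w} StripNat.shift.{w}) (c := midMap K Strip.{w} StripZ.shift.{w})
    (d := midMap K Strip.{w} StripZ.incl.{w}) (𝟙 _)) := by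
  refine isIso_rightMate ?_
  rintro ⟨⟨k, x⟩, v⟩
  let S : Type w := {z : StripZ.{w} // x ≤ z.1}
  let i : S ⥤ StripZ.{w} := Monotone.functor (f := Subtype.val) fun _ _ h => h
  let γ : toPt S ⋙ pt ((k, x), v) ⟶ inFiber k i v ⋙ midMap K Strip.{w} StripZ.incl.{w} :=
    { app := fun s => CategoryTheory.Prod.mkHom (CategoryTheory.Prod.mkHom (𝟙 k)
        (homOfLE s.2)) (𝟙 v)
      naturality := fun _ _ _ => midHom_ext rfl }
  refine ⟨S, inferInstance, inFiber k i v, γ, ?_, ?_⟩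
  · exact ranData_midMap _ (fun s => inferInstanceAs (IsIso (𝟙 k)))
      fun z v' h1 h2 => ⟨⟨z, h1⟩, le_rfl, h2, fun s hs _ => hs⟩
  · refine ranData_midMap _ (fun s => inferInstanceAs (IsIso (𝟙 k ≫ 𝟙 k))) fun z v' h1 h2 => ?_
    obtain ⟨z', h3, rfl⟩ := StripZ.exists_shift h1
    exact ⟨⟨z', h3⟩, le_rfl, h2, fun s hs _ => StripNat.le_of_shift_le hs⟩

/-- The restriction of the tower diagram of `X` along the shift is the tower diagram of
`σ^* X`. -/
noncomputable def towerDiagramShift (D : Prederivator.{w, v, u} 𝒟) [D.IsDerivator]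
    (K : Type w) [SmallCategory K] [𝒟.Has K] :
    D.towerDiagram K ⋙ D.map (midMap K Strip.{w} StripNat.shift.{w}) ≅
      D.sigmaStar K ⋙ D.towerDiagram K :=
  have := isIso_rightMate_shift (D := D) K
  Functor.isoWhiskerLeft (D.twistStar K Strip.ω Strip.ω_mono ⋙
      D.map (midMap K Strip.{w} StripZ.ζ.{w}))
    (asIso (D.rightMate (a := midMap K Strip.{w} StripZ.incl.{w})
      (b := midMap K Strip.{w} StripNat.shift.{w}) (c := midMap K Strip.{w} StripZ.shift.{w})
      (d := midMap K Strip.{w} StripZ.incl.{w}) (𝟙 _))) ≪≫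
  Functor.isoWhiskerRight
    (Functor.isoWhiskerLeft (D.twistStar K Strip.ω Strip.ω_mono)
      (D.mapComp (midMap K Strip.{w} StripZ.shift.{w}) (midMap K Strip.{w} StripZ.ζ.{w})).symm ≪≫
    (D.mapComp (midMap K Strip.{w} (StripZ.shift.{w} ⋙ StripZ.ζ.{w}))
      (twist Strip.ω Strip.ω_mono K)).symm ≪≫
    D.mapIso (show midMap K Strip.{w} (StripZ.shift.{w} ⋙ StripZ.ζ.{w}) ⋙
          twist Strip.ω Strip.ω_mono K ≅ midMap K Strip.{w} StripZ.ζ.{w} ⋙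
          twist Strip.ω Strip.ω_mono K ⋙ (𝟭 K).prod Strip.σ.{w} from
        NatIso.ofComponents (fun x => Iso.prod (Iso.refl x.1.1)
          (eqToIso (Strip.ω_shift x.1.2.1.p x.2))) fun _ => CategoryTheory.Prod.hom_ext
            ((Category.comp_id _).trans (Category.id_comp _).symm) (Subsingleton.elim _ _)) ≪≫
    D.mapComp (midMap K Strip.{w} StripZ.ζ.{w})
      (twist Strip.ω Strip.ω_mono K ⋙ (𝟭 K).prod Strip.σ.{w}) ≪≫
    Functor.isoWhiskerRight (D.mapComp (twist Strip.ω Strip.ω_mono K) ((𝟭 K).prod Strip.σ.{w}))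
      (D.map (midMap K Strip.{w} StripZ.ζ.{w})))
    (D.ran (midMap K Strip.{w} StripZ.incl.{w}))

/-- The upper right corners of the squares of the tower. -/
noncomputable def towerSqMapSuccIso (n : ℕ) :
    Arrow.mk (Functor.whiskerRight (D.towerSqMap K (n + 1)) (evOne D K)) ≅
      Arrow.mk (Functor.whiskerLeft (D.sigmaStar K) (D.towerMap K n)) :=
  -- The vertex `(1,1)` in height `n+1` is the shift of the origin in height `n`.
  have e : Functor.whiskerLeft ((CategoryTheory.Prod.sectL K (⟨true, true⟩ : Sq.{w})).prod
      (𝟭 Strip.{w})) (midHom K Strip.{w} (StripNat.sqHom.{w} (n + 1))) =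
      Functor.whiskerRight (zeroHom K n) (midMap K Strip.{w} StripNat.shift.{w}) := by
    ext x : 2
    exact midHom_ext rfl
  arrowIsoWhiskerLeft (D.towerDiagram K) ((D.arrowWhiskerLeft
      ((CategoryTheory.Prod.sectL K (⟨true, true⟩ : Sq.{w})).prod (𝟭 Strip.{w})) _).symm ≪≫
    eqToIso (congrArg (fun β => Arrow.mk (D.map₂ β)) e) ≪≫ D.arrowWhiskerRight _ _) ≪≫
  arrowIsoOfIsoLeft (D.towerDiagramShift K) (D.map₂ (zeroHom K n)) ≪≫
  arrowIsoWhiskerLeft (D.sigmaStar K) (D.towerMapIso' K n).symm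

end shift

/-! ### Compatibility of `φ` with the shift -/

section flip

/-- The symmetry of the square. -/
def Sq.flip : Sq.{w} ⥤ Sq.{w} :=
  Monotone.functor (f := fun q => ⟨q.b, q.a⟩) fun _ _ h => ⟨h.2, h.1⟩

/-- The symmetry of the corner. -/
def SqUR.flip : SqUR.{w} ⥤ SqUR.{w} :=
  Monotone.functor (f := fun q => ⟨Sq.flip.obj q.1, fun h => q.2 (by
    have h1 := congrArg Sq.a h
    have h2 := congrArg Sq.b h
    exact Sq.ext h2 h1)⟩) fun _ _ h => Sq.flip.monotone h

theorem Strip.w_flip (q : Sq.{w}) (v : Strip.{w}) :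
    Strip.w (Sq.flip.obj q) (Strip.σ.obj v) = Strip.σ.obj (Strip.w q v) := by
  obtain ⟨a, b⟩ := q
  cases a <;> cases b <;> rfl

variable (K : Type w) [SmallCategory K] [𝒟.Has K]

/-- The symmetry of families of squares. -/
abbrev flipMap : (K × Sq.{w}) × Strip.{w} ⥤ (K × Sq.{w}) × Strip.{w} :=
  ((𝟭 K).prod Sq.flip).prod Strip.σ

theorem isIso_corner_flip {E E' : D.obj ((K × Sq.{w}) × Strip.{w})} (m : E ⟶ E')
    (h : IsIso ((D.map (cornerIncl K Strip.{w})).map m)) :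
    IsIso ((D.map (cornerIncl K Strip.{w})).map ((D.map (flipMap K)).map m)) := by
  let t : (K × SqUR.{w}) × Strip.{w} ⥤ (K × SqUR.{w}) × Strip.{w} :=
    ((𝟭 K).prod SqUR.flip).prod Strip.σ
  have h1 := D.map_comp_map (cornerIncl K Strip.{w}) (flipMap K) m
  have h2 := D.map_comp_map t (cornerIncl K Strip.{w}) m
  have h3 : IsIso ((D.map (t ⋙ cornerIncl K Strip.{w})).map m) := by
    rw [h2]
    infer_instance
  exact isIso_of_sandwich (h1 ▸ h3 :)

variable [D.IsDerivator]

theorem isCart_flip {E : D.obj ((K × Sq.{w}) × Strip.{w})} (hE : IsCart E) :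
    IsCart ((D.map (flipMap K)).obj E) := by
  rw [isCart_iff]
  intro k v
  refine isCartSq_map_iff.2 ((IsRanExt.isCartSq hE Sq.flip SqUR.flip (Iso.refl _)
    (fun a _ => ⟨SqUR.flip.obj a, le_rfl, fun s hs => ⟨hs.2, hs.1⟩⟩) k (Strip.σ.obj v)).congr ?_)
  exact NatIso.ofComponents (fun q => Iso.refl _) (fun f => midHom_ext rfl)

/-- Because `σ` exchanges the two coordinates, it interchanges the vertices `(1,0)` and `(0,1)` of
the squares defining `φ`. Restricting `phiSquare` along the flip together with `σ` gives a map from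
`w^* σ^* X` to cartesian squares, invertible on corners, and rigidity recognizes it as the map for
`σ^* X`. -/
theorem nonempty_sigmaStar_phi_iso :
    Nonempty (Arrow.mk (Functor.whiskerRight (D.phi K) (D.sigmaStar K)) ≅
      Arrow.mk (Functor.whiskerLeft (D.sigmaStar K) (D.phi K))) := by
  let ψ := Functor.whiskerRight (D.phiSquare K) (D.map (flipMap K))
  let e : (D.phiDiagram K ⋙ D.map (midMap K Strip.{w} Sq.toCone.{w})) ⋙ D.map (flipMap K) ≅
      D.sigmaStar K ⋙ D.twistStar K Strip.w Strip.w_mono :=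
    Functor.isoWhiskerRight (D.phiSquareSource K) (D.map (flipMap K)) ≪≫
    (D.mapComp (flipMap K) (twist Strip.w Strip.w_mono K)).symm ≪≫
    D.mapIso (show flipMap K ⋙ twist Strip.w Strip.w_mono K ≅
        twist Strip.w Strip.w_mono K ⋙ (𝟭 K).prod Strip.σ.{w} from
      NatIso.ofComponents (fun x => Iso.prod (Iso.refl x.1.1)
        (eqToIso (Strip.w_flip x.1.2 x.2))) fun _ => CategoryTheory.Prod.hom_ext
          ((Category.comp_id _).trans (Category.id_comp _).symm) (Subsingleton.elim _ _)) ≪≫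
    D.mapComp (twist Strip.w Strip.w_mono K) ((𝟭 K).prod Strip.σ.{w})
  obtain ⟨i⟩ := D.nonempty_arrow_phi_iso (D.sigmaStar K) ψ e
    (fun X => isCart_flip K (D.isCart_phiSquareTarget X))
    (fun X => isIso_corner_flip K _ (D.isIso_corner_phiSquare X))
  let z := (CategoryTheory.Prod.sectL K Sq.zero.{w}).prod (𝟭 Strip.{w})
  let c : D.evZero K ⋙ D.sigmaStar K ≅ D.map (flipMap K) ⋙ D.evZero K :=
    (D.mapComp ((𝟭 K).prod Strip.σ.{w}) z).symm ≪≫ D.mapComp z (flipMap K)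
  have i2 : Arrow.mk (D.phi K) ≅ Arrow.mk (Functor.whiskerRight (D.phiSquare K) (D.evZero K)) :=
    Arrow.isoMk' _ _ (D.phiSourceIso K) (D.phiTargetIso K) D.phiSourceIso_hom_comp
  exact ⟨arrowIsoWhiskerRight (D.sigmaStar K) i2 ≪≫ arrowIsoOfIsoRight c (D.phiSquare K) ≪≫ i⟩

/-- The source of `φ` is the identity. -/
noncomputable def phiSourceIsoId (D : Prederivator.{w, v, u} 𝒟) [D.IsDerivator] (K : Type w)
    [SmallCategory K] [𝒟.Has K] : D.phiSource K ≅ 𝟭 ((D.shift Strip.{w}).obj K) :=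
  D.phiSourceIso K ≪≫ Functor.isoWhiskerRight (D.phiSquareSource K) (D.evZero K) ≪≫
    (D.mapComp ((CategoryTheory.Prod.sectL K Sq.zero.{w}).prod (𝟭 Strip.{w}))
      (twist Strip.w Strip.w_mono K)).symm ≪≫ eqToIso (D.map_id (K × Strip.{w}))

end flip

/-! ### The stages and transition maps of the tower as iterated loops -/

section induction

variable (K : Type w) [SmallCategory K] [𝒟.Has K] [D.IsDerivator]

/-- An endofunctor commutes with its iterates. -/
def iterFunctorComm {C : Type u} [Category.{v} C] (T : C ⥤ C) :
    ∀ n, iterFunctor T (n + 1) ≅ T ⋙ iterFunctor T n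
  | 0 => Functor.leftUnitor T ≪≫ (Functor.rightUnitor T).symm
  | n + 1 => Functor.isoWhiskerRight (iterFunctorComm T n) T

theorem IsPrespectrum.sigmaStar {X : (D.shift Strip.{w}).obj K} (hX : D.IsPrespectrum K X)
    (hpt : D.IsPointed) : D.IsPrespectrum K ((D.sigmaStar K).obj X) :=
  hpt.isPrespectrum fun k v hv =>
    (hX.isZero_at inferInstance k (v := Strip.σ.obj v) (by
      change |v.j + 1 - (v.i + 1)| = 1
      rw [← hv, abs_sub_comm]
      congr 1
      ring)).of_iso (ptMapIso ((𝟭 K).prod Strip.σ.{w}) (k, v) X).symm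

theorem IsPrespectrum.isLoopSq_towerSq {X : (D.shift Strip.{w}).obj K} (hX : D.IsPrespectrum K X)
    (n : ℕ) : IsLoopSq (Q := Strip.{w}) ((D.towerSq K (n + 1)).obj X) :=
  ⟨D.isCart_towerSq_succ K X n, fun k _ v h0 h1 => hX.isZero_towerSq (n + 1) k h0 h1 v⟩

/-- On prespectra the squares in heights `n+1` and `n+2` are loop squares, so the map of their lower
left vertices is `Ω` of the map of upper right vertices, and the latter is the `n`-th transition map
for `σ^* X`. -/
theorem IsPointed.nonempty_towerMap_succ_iso (hpt : D.IsPointed) (n : ℕ) :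
    Nonempty (Arrow.mk (Functor.whiskerLeft (D.IsPrespectrum K).ι (D.towerMap K (n + 1))) ≅
      Arrow.mk (Functor.whiskerLeft ((D.IsPrespectrum K).ι ⋙ D.sigmaStar K)
        (Functor.whiskerRight (D.towerMap K n) ((D.shift Strip.{w}).loop K)))) := by
  obtain ⟨i⟩ := hpt.nonempty_arrow_evZero_iso
    (Functor.whiskerLeft (D.IsPrespectrum K).ι (D.towerSqMap K (n + 1)))
    (fun X => X.property.isLoopSq_towerSq K n) (fun X => X.property.isLoopSq_towerSq K (n + 1))
  exact ⟨arrowIsoWhiskerLeft _ (D.towerMapIso K (n + 1)) ≪≫ i ≪≫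
    arrowIsoWhiskerLeft _ (arrowIsoWhiskerRight _ (towerSqMapSuccIso K n))⟩

theorem IsPointed.nonempty_towerMap_iso (hpt : D.IsPointed) (n : ℕ) :
    Nonempty (Arrow.mk (Functor.whiskerLeft (D.IsPrespectrum K).ι (D.towerMap K n)) ≅
      Arrow.mk (Functor.whiskerLeft (D.IsPrespectrum K).ι
        (Functor.whiskerRight (D.phi K) (D.loopShift K n)))) := by
  induction n with
  | zero =>
    obtain ⟨i⟩ := D.nonempty_towerMap_zero_iso K
    exact ⟨arrowIsoWhiskerLeft _ i⟩
  | succ n ih =>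
    obtain ⟨i⟩ := ih
    obtain ⟨j⟩ := hpt.nonempty_towerMap_succ_iso K n
    obtain ⟨s⟩ := nonempty_sigmaStar_phi_iso (D := D) K
    -- The induction hypothesis is available on prespectra only; it is applied to `σ^* X`, which is
    -- again one.
    let σ' : (D.IsPrespectrum K).FullSubcategory ⥤ (D.IsPrespectrum K).FullSubcategory :=
      (D.IsPrespectrum K).lift ((D.IsPrespectrum K).ι ⋙ D.sigmaStar K)
        fun X => X.property.sigmaStar K hpt
    let c : D.sigmaStar K ⋙ D.loopShift K n ⋙ (D.shift Strip.{w}).loop K ≅ D.loopShift K (n + 1) :=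
      Functor.isoWhiskerRight (iterFunctorComm (D.sigmaStar K) n).symm
        (iterFunctor ((D.shift Strip.{w}).loop K) (n + 1))
    exact ⟨j ≪≫ arrowIsoWhiskerLeft σ' (arrowIsoWhiskerRight ((D.shift Strip.{w}).loop K) i) ≪≫
      arrowIsoWhiskerLeft (D.IsPrespectrum K).ι
        (arrowIsoWhiskerRight (D.loopShift K n ⋙ (D.shift Strip.{w}).loop K) s.symm ≪≫
          arrowIsoOfIsoRight c (D.phi K))⟩

theorem IsPointed.nonempty_towerObj_iso (hpt : D.IsPointed) (n : ℕ) :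
    Nonempty ((D.IsPrespectrum K).ι ⋙ D.towerObj K n ≅
      (D.IsPrespectrum K).ι ⋙ D.loopShift K n) := by
  obtain ⟨i⟩ := hpt.nonempty_towerMap_iso K n
  exact ⟨Arrow.leftFunc.mapIso i ≪≫ Functor.isoWhiskerLeft (D.IsPrespectrum K).ι
    (Functor.isoWhiskerRight (D.phiSourceIsoId K) (D.loopShift K n) ≪≫ Functor.leftUnitor _)⟩

end induction
end Prederivator

namespace Prederivator

variable {𝒟 : DiagramClass.{w}} {D : Prederivator.{w, v, u} 𝒟}

/-! ### Restrictions along sequences -/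

section sequences

variable {A B J : Type w} [SmallCategory A] [SmallCategory B] [SmallCategory J] [𝒟.Has A]
  [𝒟.Has B] [𝒟.Has J]

/-- The initial object of `ℕ` is left adjoint to the projection to the point. -/
def natAdj : pt (ULift.up 0 : NatShape.{w}) ⊣ toPt NatShape.{w} :=
  Adjunction.mkOfUnitCounit
    { unit := { app := fun _ => 𝟙 _ }
      counit := { app := fun n => homOfLE (Nat.zero_le n.down) } }

/-- The constant diagrams of shape `ℕ`. -/
theorem isLan_nat_of_isIso {Y : D.obj NatShape.{w}} {W : D.obj Pt.{w}}
    (κ : Y ⟶ (D.map (toPt NatShape.{w})).obj W) [IsIso κ] : IsLan (toPt NatShape.{w}) κ := by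
  -- As `0` is initial in `ℕ`, pullback from the point is left adjoint to evaluation at `0` with
  -- invertible unit, hence fully faithful. So the colimit of a constant sequence is its value.
  have : IsIso (natAdj.{w}).unit := by
    have : ∀ X, IsIso ((natAdj.{w}).unit.app X) := fun _ => inferInstanceAs (IsIso (𝟙 _))
    exact NatIso.isIso_of_isIso_app _
  have : IsIso (D.mapAdj natAdj.{w}).unit := by
    simp only [mapAdj, Adjunction.mkOfUnitCounit_unit]
    infer_instance
  have h := (D.mapAdj natAdj.{w}).fullyFaithfulLOfIsIsoUnit
  intro Z
  have h1 := ((asIso κ).symm.homFromEquiv (Z := (D.map (toPt NatShape.{w})).obj Z)).bijective.comp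
    (h.homEquiv (X := W) (Y := Z)).bijective
  convert h1 using 1
  funext f
  simp [Iso.homFromEquiv]

variable [D.IsDerivator]

/-- Restriction along a functor whose slices are computed by sequences is fully faithful. -/
theorem isLan_id_of_lanData {t : A ⥤ B} (h : ∀ b : B, ∃ (g : NatShape.{w} ⥤ A)
    (γ : g ⋙ t ⟶ toPt NatShape.{w} ⋙ pt b), IsIso γ ∧ LanData t (pt b) g γ) (Y : D.obj B) :
    IsLan t (𝟙 ((D.map t).obj Y)) :=
  isLan_of_pointwise fun b => by
    obtain ⟨g, γ, _, h⟩ := h b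
    refine ⟨NatShape.{w}, inferInstance, g, γ, h, ?_⟩
    -- Since `γ` is invertible, the restriction of `Y` to the sequence is constant.
    have : IsIso (push γ (𝟙 ((D.map t).obj Y))) := by
      rw [push, cell_app]
      infer_instance
    exact isLan_nat_of_isIso _

end sequences

/-! ### The straightened tower -/

/-- The poset `ℤ × V`. -/
@[ext]
structure IntStrip : Type w where
  /-- the component in `ℤ` -/
  m : ℤ
  /-- the component in `V` -/
  v : Strip.{w}

instance : PartialOrder IntStrip.{w} where
  le x y := x.m ≤ y.m ∧ x.v ≤ y.v
  le_refl _ := ⟨le_rfl, le_rfl⟩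
  le_trans _ _ _ h h' := ⟨h.1.trans h'.1, h.2.trans h'.2⟩
  le_antisymm _ _ h h' := IntStrip.ext (le_antisymm h.1 h'.1) (le_antisymm h.2 h'.2)

/-- The full subposet of `ℤ × V` of the `(m, i, j)` with `m ≤ i` if `i = j`. -/
abbrev IntZ : Type w := {x : IntStrip.{w} // |x.v.i - x.v.j| = 1 ∨ x.m ≤ x.v.i}

/-- The inclusion. -/
def IntZ.incl : IntZ.{w} ⥤ IntStrip.{w} := Monotone.functor (f := Subtype.val) fun _ _ h => h

instance : IntZ.incl.{w}.Full where
  map_surjective f := ⟨homOfLE (leOfHom f), rfl⟩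

instance : IntZ.incl.{w}.Faithful where
  map_injective _ := Subsingleton.elim _ _

section straight

variable (K : Type w) [SmallCategory K] [𝒟.Has K]

/-- The projection to `K × V`. -/
def intProj : (K × IntStrip.{w}) × Pt.{w} ⥤ K × Strip.{w} where
  obj x := (x.1.1, x.1.2.v)
  map f := CategoryTheory.Prod.mkHom f.1.1 (homOfLE (leOfHom f.1.2).2)

/-- The inclusion of the initial part. -/
abbrev intIncl : (K × IntZ.{w}) × Pt.{w} ⥤ (K × IntStrip.{w}) × Pt.{w} :=
  midMap K Pt.{w} IntZ.incl.{w}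

variable {K}

/-- A sequence over a fixed point with heights `n + s` is cofinal in the slice: the first index
reaching height `m` is the nonnegative part of `m - s`. The starting height `s` is free, which is
used with `0`, with `i + 1` and with `min i j`. -/
theorem lanData_intProj {x : Pt.{w} ⥤ K × Strip.{w}}
    {g : NatShape.{w} ⥤ (K × IntStrip.{w}) × Pt.{w}} {γ : g ⋙ intProj K ⟶ toPt NatShape.{w} ⋙ x}
    (hγ : ∀ n, IsIso (γ.app n).1) (s : ℤ)
    (hg : ∀ n, (g.obj n).1.2.m = n.down + s)
    (hg' : ∀ n, (x.obj PUnit.unit).2 ≤ (g.obj n).1.2.v) : LanData (intProj K) x g γ := by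
  refine LanData.of_poset (q := CategoryTheory.Prod.fst K Strip.{w}) (p := fun a => (a.1.2, a.2))
    (isOverPoset_fst_fst (K := K) (P := IntStrip.{w}) (Q := Pt.{w})) isOverPoset_fst hγ
    fun a ha => ⟨ULift.up (a.1.2.m - s).toNat, ⟨⟨?_, ha.trans (hg' _)⟩, le_rfl⟩, fun n hn => ?_⟩
  · change a.1.2.m ≤ (g.obj _).1.2.m
    rw [hg]
    have := Int.self_le_toNat (a.1.2.m - s)
    change a.1.2.m ≤ ((a.1.2.m - s).toNat : ℤ) + s
    omega
  · have h1 : a.1.2.m ≤ (g.obj n).1.2.m := hn.1.1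
    rw [hg] at h1
    exact Int.toNat_le.2 (by omega)

/-- The sequence over a point. -/
def intSeq (k : K) (v : Strip.{w}) : NatShape.{w} ⥤ (K × IntStrip.{w}) × Pt.{w} :=
  inFiber k (Monotone.functor (f := fun n => (⟨n.down, v⟩ : IntStrip.{w}))
    fun _ _ h => ⟨Int.ofNat_le.2 h, le_rfl⟩) PUnit.unit

/-- The sequence over a point is constant after projection. -/
def intSeqHom (k : K) (v : Strip.{w}) :
    intSeq k v ⋙ intProj K ⟶ toPt NatShape.{w} ⋙ pt (k, v) where
  app _ := 𝟙 _

instance (k : K) (v : Strip.{w}) : IsIso (intSeqHom k v) := by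
  have : ∀ X, IsIso ((intSeqHom k v).app X) := fun _ => inferInstanceAs (IsIso (𝟙 _))
  exact NatIso.isIso_of_isIso_app _

theorem lanData_intSeq (k : K) (v : Strip.{w}) :
    LanData (intProj K) (pt (k, v)) (intSeq k v) (intSeqHom k v) :=
  lanData_intProj (fun _ => inferInstanceAs (IsIso (𝟙 k))) 0 (fun _ => (add_zero _).symm)
    (fun _ => le_rfl)

variable [D.IsDerivator]

theorem isLan_intProj_id (Y : D.obj (K × Strip.{w})) :
    IsLan (intProj K) (𝟙 ((D.map (intProj K)).obj Y)) :=
  isLan_id_of_lanData (fun b => ⟨intSeq b.1 b.2, intSeqHom b.1 b.2, inferInstance,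
    lanData_intSeq b.1 b.2⟩) Y

/-- The straightened tower. -/
noncomputable def straight (D : Prederivator.{w, v, u} 𝒟) [D.IsDerivator] (K : Type w)
    [SmallCategory K] [𝒟.Has K] (X : D.obj (K × Strip.{w})) : D.obj ((K × IntStrip.{w}) × Pt.{w}) :=
  -- In height `m` the values of `X` are kept off the diagonal and at `(i,i)` with `m ≤ i`; at the
  -- remaining points they are replaced by limits of the kept ones.
  (D.ran (intIncl K)).obj ((D.map (intIncl K)).obj ((D.map (intProj K)).obj X))

/-- The map from the constant diagram to the straightened tower. -/
noncomputable def toStraight (X : D.obj (K × Strip.{w})) :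
    (D.map (intProj K)).obj X ⟶ straight D K X :=
  (D.ranAdj (intIncl K)).unit.app ((D.map (intProj K)).obj X)

/-- The counit for the straightened tower. -/
noncomputable abbrev straightCounit (X : D.obj (K × Strip.{w})) :
    (D.map (intIncl K)).obj (straight D K X) ⟶ (D.map (intIncl K)).obj ((D.map (intProj K)).obj X) :=
  ranCounit (intIncl K) _

theorem isRan_straightCounit (X : D.obj (K × Strip.{w})) :
    IsRan (intIncl K) (straightCounit X) := isRan_counit _ _

instance (X : D.obj (K × Strip.{w})) : IsIso (straightCounit X) :=
  (isRan_straightCounit X).isIso_of_fullyFaithful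

theorem toStraight_counit (X : D.obj (K × Strip.{w})) :
    (D.map (intIncl K)).map (toStraight X) ≫ straightCounit X = 𝟙 _ :=
  (D.ranAdj (intIncl K)).left_triangle_components _

instance (X : D.obj (K × Strip.{w})) : IsIso ((D.map (intIncl K)).map (toStraight X)) := by
  have h := toStraight_counit X
  rw [← IsIso.eq_comp_inv] at h
  rw [h]
  infer_instance

theorem isRanExt_straight (X : D.obj (K × Strip.{w})) : IsRanExt (intIncl K) (straight D K X) :=
  (isRan_straightCounit X).isRanExt

/-- The square in `ℤ × V` from which `φ` is read off at `v`. -/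
def intSq (m : ℤ) (v : Strip.{w}) : Sq.{w} ⥤ IntStrip.{w} :=
  Monotone.functor (f := fun q => ⟨m, Strip.w q v⟩) fun _ _ h => ⟨le_rfl, Strip.w_mono h le_rfl⟩

/-- The part of `ℤ × V` without the `(m, i, i)` for `m > i`. -/
abbrev IntRel (i : ℤ) : Type w :=
  {x : IntStrip.{w} // ¬ (x.v.i = i ∧ x.v.j = i ∧ i < x.m)}

/-- The inclusion. -/
def IntRel.incl (i : ℤ) : IntRel.{w} i ⥤ IntStrip.{w} :=
  Monotone.functor (f := Subtype.val) fun _ _ h => h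

/-- The inclusion of the initial part. -/
def IntRel.ofZ (i : ℤ) : IntZ.{w} ⥤ IntRel.{w} i :=
  Monotone.functor (f := fun x => ⟨x.1, by
    rintro ⟨h1, h2, h3⟩
    rcases x.2 with h | h
    · rw [h1, h2] at h
      simp at h
    · omega⟩) fun _ _ h => h

instance (i : ℤ) : (IntRel.incl.{w} i).Full where
  map_surjective f := ⟨homOfLE (leOfHom f), rfl⟩

instance (i : ℤ) : (IntRel.incl.{w} i).Faithful where
  map_injective _ := Subsingleton.elim _ _

instance (i : ℤ) : (IntRel.ofZ.{w} i).Full where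
  map_surjective f := ⟨homOfLE (leOfHom f), rfl⟩

instance (i : ℤ) : (IntRel.ofZ.{w} i).Faithful where
  map_injective _ := Subsingleton.elim _ _

/-- The diagonal of `V`. -/
abbrev Strip.diag (i : ℤ) : Strip.{w} := ⟨i, i, by simp⟩

theorem Strip.w_diag_le_iff {q : Sq.{w}} {i : ℤ} {v : Strip.{w}} (hv : Strip.diag i ≤ v) :
    Strip.w q (Strip.diag i) ≤ v ↔ (q.a = true → i + 1 ≤ v.i) ∧ (q.b = true → i + 1 ≤ v.j) := by
  obtain ⟨h1, h2⟩ := hv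
  change i ≤ v.i at h1
  change i ≤ v.j at h2
  obtain ⟨a, b⟩ := q
  change (_ ≤ _ ∧ _ ≤ _) ↔ _
  cases a <;> cases b <;> simp [Strip.w, h1, h2]

/-- The corner of the square. -/
def IntRel.corner {m i : ℤ} : SqUR.{w} ⥤ IntRel.{w} i :=
  Monotone.functor (f := fun q => ⟨(intSq m (Strip.diag i)).obj q.1, by
    obtain ⟨⟨a, b⟩, hq⟩ := q
    cases a <;> cases b <;> simp [intSq, Strip.w] at hq ⊢⟩)
    fun _ _ h => (intSq m (Strip.diag i)).monotone h

/-- No point `(m',i,i)` with `m' > i` belongs to `IntZ`, so the diagram is right Kan extended from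
the larger part `IntRel i`. As `i < m`, points of that part above `(m,i,i)` are strictly larger in
`V`, so the corner is initial there. -/
theorem isCartSq_straight (X : D.obj (K × Strip.{w})) (k : K) {m i : ℤ} (h : i < m) :
    IsCartSq (inFiber k (intSq m (Strip.diag i)) PUnit.unit) (straight D K X) := by
  have h1 := (show IsRanExt (midMap K Pt.{w} (IntRel.ofZ i) ⋙ midMap K Pt.{w} (IntRel.incl i))
    (straight D K X) from isRanExt_straight X).right
  refine h1.isCartSq (intSq m (Strip.diag i)) (IntRel.corner (m := m)) (Iso.refl _) ?_ k
    PUnit.unit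
  rintro ⟨⟨m', p⟩, hp⟩ ⟨h2, h3⟩
  change m ≤ m' at h2
  change Strip.diag i ≤ p at h3
  have hp' : ¬ (p.i < i + 1 ∧ p.j < i + 1) := fun h4 => by
    obtain ⟨h5, h6⟩ := h3
    change i ≤ p.i at h5
    change i ≤ p.j at h6
    exact hp ⟨by change p.i = i; omega, by change p.j = i; omega, by change i < m'; omega⟩
  refine ⟨⟨⟨decide (i + 1 ≤ p.i), decide (i + 1 ≤ p.j)⟩, fun h4 => hp' ?_⟩, ⟨h2, ?_⟩, ?_⟩
  · have h5 := congrArg Sq.a h4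
    have h6 := congrArg Sq.b h4
    simpa using And.intro h5 h6
  · exact (Strip.w_diag_le_iff h3).2 (by simp)
  · rintro ⟨q, hq⟩ ⟨_, h4⟩
    have h5 := (Strip.w_diag_le_iff h3).1 h4
    constructor
    · intro ha
      simpa using h5.1 ha
    · intro hb
      simpa using h5.2 hb

theorem isIso_map_of_pointwise {I J : Type w} [SmallCategory I] [SmallCategory J] [𝒟.Has I]
    [𝒟.Has J] (t : I ⥤ J) {E E' : D.obj J} (m : E ⟶ E')
    (h : ∀ i, IsIso ((D.map (pt (t.obj i))).map m)) : IsIso ((D.map t).map m) := by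
  refine IsDerivator.der2 _ fun i => ?_
  have h1 := NatIso.naturality_1 (D.mapIso (ptIso (pt i ⋙ t)) ≪≫ D.mapComp (pt i) t) m
  have : IsIso ((D.map (pt ((pt i ⋙ t).obj PUnit.unit))).map m) := h i
  change IsIso ((D.map t ⋙ D.map (pt i)).map m)
  rw [← h1]
  infer_instance

theorem Strip.eq_diag {v : Strip.{w}} (h : ¬ |v.i - v.j| = 1) : v = Strip.diag v.i := by
  have h1 := abs_le.1 v.near
  rw [abs_eq zero_le_one] at h
  refine Strip.ext rfl ?_
  change v.j = v.i
  omega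

/-- For an Ω-spectrum the right Kan extension changes nothing. Source and target have cartesian
squares at `(i,i)` in heights above `i`, so invertibility at `(i+1,i+1)` and on the boundary, where
both agree anyway, implies invertibility at `(i,i)`. -/
theorem isIso_toStraight {Y : D.obj (K × Strip.{w})}
    (hY : ∀ k v, IsCartSq (sqAt k v) Y) : IsIso (toStraight Y) := by
  -- The induction is on a bound `n` for `m - v.i`; passing to the opposite vertex of the square
  -- lowers it by one.
  have key : ∀ (n : ℕ) (k : K) (m : ℤ) (v : Strip.{w}), m ≤ v.i + n →
      IsIso ((D.map (pt ((k, ⟨m, v⟩), PUnit.unit))).map (toStraight Y)) := by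
    intro n
    induction n with
    | zero =>
      intro k m v h
      exact isIso_map_pt_of_isIso_map (intIncl K)
        ((k, ⟨⟨m, v⟩, Or.inr (by simpa using h)⟩), PUnit.unit) _
    | succ n ih =>
      intro k m v h
      by_cases hv : |v.i - v.j| = 1
      · exact isIso_map_pt_of_isIso_map (intIncl K) ((k, ⟨⟨m, v⟩, Or.inl hv⟩), PUnit.unit) _
      rw [Strip.eq_diag hv]
      by_cases hm : m ≤ v.i
      · exact isIso_map_pt_of_isIso_map (intIncl K)
          ((k, ⟨⟨m, Strip.diag v.i⟩, Or.inr hm⟩), PUnit.unit) _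
      let e := inFiber k (intSq m (Strip.diag.{w} v.i)) (PUnit.unit : Pt.{w})
      have h1 : IsCartSq e ((D.map (intProj K)).obj Y) := isCartSq_map_iff.2 (hY k _)
      have h2 : IsCartSq e (straight D K Y) := isCartSq_straight Y k (not_le.1 hm)
      have h3 : IsIso ((D.map (SqUR.incl.{w} ⋙ e)).map (toStraight Y)) := by
        refine isIso_map_of_pointwise _ _ ?_
        rintro ⟨⟨a, b⟩, hq⟩
        cases a <;> cases b
        · exact absurd rfl hq
        · exact isIso_map_pt_of_isIso_map (intIncl K)
            ((k, ⟨⟨m, ⟨v.i, v.i + 1, by simp⟩⟩, Or.inl (by simp)⟩), PUnit.unit) _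
        · exact isIso_map_pt_of_isIso_map (intIncl K)
            ((k, ⟨⟨m, ⟨v.i + 1, v.i, by simp⟩⟩, Or.inl (by simp)⟩), PUnit.unit) _
        · exact ih k m ⟨v.i + 1, v.i + 1, by simp⟩ (by
            change m ≤ v.i + 1 + n
            push_cast at h
            omega)
      have h4 := h1.isIso_map h2 (toStraight Y)
      exact isIso_map_pt_of_isIso_map (pt Sq.zero.{w} ⋙ e) PUnit.unit _
  refine IsDerivator.der2 _ ?_
  rintro ⟨⟨k, ⟨m, v⟩⟩, _⟩
  exact key (m - v.i).toNat k m v (by omega)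

end straight
end Prederivator

namespace Prederivator

variable {𝒟 : DiagramClass.{w}} {D : Prederivator.{w, v, u} 𝒟}

/-! ### Sequential colimits of cartesian squares -/

/-- Compatibility of the cones in a diagram with a cocone under it. -/
theorem cone_comp_push {I J J' A B L : Type w} [SmallCategory I] [SmallCategory J]
    [SmallCategory J'] [SmallCategory A] [SmallCategory B] [SmallCategory L] [𝒟.Has I]
    [𝒟.Has J] [𝒟.Has J'] [𝒟.Has A] [𝒟.Has B] [𝒟.Has L] {p : I ⥤ J} {x : J ⥤ A} {g : I ⥤ A}
    {t : A ⥤ B} {q : I ⥤ J'} {y : J' ⥤ B} {r : J ⥤ L} {r' : J' ⥤ L} {z : L ⥤ B} (δ : p ⋙ x ⟶ g)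
    (δ₁ : g ⋙ t ⟶ q ⋙ y) (δ₀ : x ⋙ t ⟶ r ⋙ z) (ε : p ⋙ r ⟶ q ⋙ r') (δ₂ : r' ⋙ z ⟶ y)
    (e : Functor.whiskerRight δ t ≫ δ₁ = (show (p ⋙ x) ⋙ t ⟶ p ⋙ (r ⋙ z) from
      Functor.whiskerLeft p δ₀) ≫ (show p ⋙ (r ⋙ z) ⟶ q ⋙ (r' ⋙ z) from
        Functor.whiskerRight ε z) ≫ Functor.whiskerLeft q δ₂)
    {E : D.obj A} {F : D.obj B} (κ : E ⟶ (D.map t).obj F) :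
    push ε (push δ₀ κ) ≫ (D.map q).map (cone δ₂ F) = cone δ E ≫ push δ₁ κ := by
  have h := congrArg (fun α => (D.map₂ α).app F) e
  dsimp only at h
  rw [map₂_comp_app, map₂_comp_app, map₂_comp_app] at h
  have h1 := D.map₂_whiskerRight_app δ t F
  have h2 : (D.map₂ (show (p ⋙ x) ⋙ t ⟶ p ⋙ (r ⋙ z) from Functor.whiskerLeft p δ₀)).app F = _ :=
    D.map₂_whiskerLeft_app p δ₀ F
  have h3 : (D.map₂ (show p ⋙ (r ⋙ z) ⟶ q ⋙ (r' ⋙ z) from Functor.whiskerRight ε z)).app F = _ :=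
    D.map₂_whiskerRight_app ε z F
  have h4 := D.map₂_whiskerLeft_app q δ₂ F
  have h5 := (D.map₂ δ).naturality κ
  rw [h1, h2, h3, h4, Category.assoc, Category.assoc, eqToHom_comp_iff] at h
  rw [map_comp_map] at h5
  have h6 := (D.map p).map ((D.map x).map κ) ≫= eqToHom (D.map_comp_obj p x _).symm ≫=
    eq_whisker h (eqToHom (D.map_comp_obj q y F))
  simp only [push, cone, cell_app, Functor.map_comp, Category.assoc, eqToHom_map] at h6 ⊢
  rw [← reassoc_of% h5]
  simp only [eqToHom_trans_assoc, eqToHom_trans, eqToHom_refl, Category.comp_id,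
    Category.id_comp] at h6 ⊢
  exact h6.symm

section regular

variable [D.IsDerivator]

theorem isIso_leftMate_nat {B : Type w} [PartialOrder B] :
    IsIso (D.leftMate (a := CategoryTheory.Prod.fst NatShape.{w} B) (b := toPt NatShape.{w})
      (c := CategoryTheory.Prod.snd NatShape.{w} B) (d := toPt B) (𝟙 _)) := by
  refine isIso_leftMate fun x => ?_
  refine ⟨NatShape.{w}, inferInstance, CategoryTheory.Prod.sectL NatShape.{w} x,
    { app := fun _ => 𝟙 _ }, ?_, ?_⟩
  · intro a f
    exact ⟨a.1, CategoryTheory.Prod.mkHom (𝟙 _) f, Subsingleton.elim _ _,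
      fun s h _ => ⟨h.1, CategoryTheory.Prod.hom_ext (Subsingleton.elim _ _)
        (Subsingleton.elim _ _)⟩⟩
  · intro a f
    exact ⟨a, 𝟙 _, Subsingleton.elim _ _, fun s h _ => ⟨h, Subsingleton.elim _ _⟩⟩

/-- In a regular derivator, sequential colimits of limit cones of finite shape are limit cones. -/
theorem IsRegular.isRan (hreg : D.IsRegular) {B : Type w} [PartialOrder B]
    (hB : IsFiniteShape B) {E : D.obj NatShape.{w}} {G : D.obj (NatShape.{w} × B)}
    {W : D.obj Pt.{w}} {N : D.obj B}
    {κ : (D.map (CategoryTheory.Prod.fst NatShape.{w} B)).obj E ⟶ G}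
    (hκ : IsRan (CategoryTheory.Prod.fst NatShape.{w} B) κ)
    {ι : E ⟶ (D.map (toPt NatShape.{w})).obj W} (hι : IsLan (toPt NatShape.{w}) ι)
    {ν : G ⟶ (D.map (CategoryTheory.Prod.snd NatShape.{w} B)).obj N}
    (hν : IsLan (CategoryTheory.Prod.snd NatShape.{w} B) ν)
    {μ : (D.map (toPt B)).obj W ⟶ N}
    (h : push (a := CategoryTheory.Prod.fst NatShape.{w} B) (b := toPt NatShape.{w})
      (c := CategoryTheory.Prod.snd NatShape.{w} B) (d := toPt B) (𝟙 _) ι ≫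
        (D.map (CategoryTheory.Prod.snd NatShape.{w} B)).map μ = κ ≫ ν) :
    IsRan (toPt B) μ := by
  let p := CategoryTheory.Prod.fst NatShape.{w} B
  let q := CategoryTheory.Prod.snd NatShape.{w} B
  obtain ⟨c, hc, hc'⟩ := hreg NatShape.{w} B hB G
  obtain ⟨e, he, he'⟩ := hκ.exists_iso
  obtain ⟨n, hn, hn'⟩ := hν.exists_iso
  obtain ⟨o, ho⟩ := (isLan_unit (toPt NatShape.{w}) ((D.ran p).obj G) W).2 (e ≫ ι)
  dsimp only at ho
  have ho' : IsIso o := (isLan_unit (toPt NatShape.{w}) ((D.ran p).obj G)).isIso hι o e ho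
  let ℓ := D.leftMate (a := p) (b := toPt NatShape.{w}) (c := q) (d := toPt B) (𝟙 _)
  have hl : IsIso ℓ := isIso_leftMate_nat
  have hl' : IsIso (ℓ.app ((D.ran p).obj G)) := inferInstance
  have hc1 : ℓ.app ((D.ran p).obj G) ≫ (D.map (toPt B)).map c ≫ ranCounit (toPt B) _ =
    (D.lan q).map (ranCounit p G) := hc
  -- The interchange map `c` is known through its transpose only, so the two cones are compared
  -- after the invertible mate `ℓ` and the unit of the colimit. Thereafter `μ` differs from the
  -- standard limit cone by isomorphisms.
  have key : (D.map (toPt B)).map o ≫ μ =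
      (D.map (toPt B)).map c ≫ ranCounit (toPt B) ((D.lan q).obj G) ≫ n := by
    rw [← cancel_epi (ℓ.app ((D.ran p).obj G))]
    rw [reassoc_of% hc1]
    refine (isLan_unit q ((D.map p).obj ((D.ran p).obj G))).hom_ext ?_
    have h1 : lanUnit q _ ≫ (D.map q).map (ℓ.app ((D.ran p).obj G)) =
      push (a := p) (b := toPt NatShape.{w}) (c := q) (d := toPt B) (𝟙 _)
        (lanUnit (toPt NatShape.{w}) ((D.ran p).obj G)) :=
      lanUnit_leftMate_app (D := D) (a := p) (b := toPt NatShape.{w}) (c := q) (d := toPt B) (𝟙 _) _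
    have h2 := map_push (a := p) (b := toPt NatShape.{w}) (c := q) (d := toPt B) (𝟙 _) ho
    have h3 := lanUnit_naturality q (ranCounit p G)
    rw [Functor.map_comp, Functor.map_comp, Functor.map_comp, reassoc_of% h1, reassoc_of% h2, h,
      ← reassoc_of% h3, hn', ← he', Category.assoc]
  exact (isRan_counit (toPt B) ((D.lan q).obj G)).of_iso (inv c ≫ o) n (by
    rw [Functor.map_comp, Category.assoc, key]
    simp)

theorem isFiniteShape_SqUR : IsFiniteShape SqUR.{w} where
  finite_obj := Finite.of_injective (fun q : SqUR.{w} => (q.1.a, q.1.b)) fun _ _ h =>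
    Subtype.ext (Sq.ext (congrArg Prod.fst h) (congrArg Prod.snd h))
  finite_hom _ _ := inferInstance
  endo_eq_id _ _ := Subsingleton.elim _ _
  eq_of_hom _ _ f g := le_antisymm (leOfHom f) (leOfHom g)

variable {K : Type w} [SmallCategory K] [𝒟.Has K] {X L : D.obj (K × Strip.{w})}
  {κ : straight D K X ⟶ (D.map (intProj K)).obj L}

/-- The values of the straightened tower over the initial part. -/
noncomputable def straightAt (X : D.obj (K × Strip.{w})) (k : K) (z : IntZ.{w}) :
    (D.map (pt ((k, z.1), (PUnit.unit : Pt.{w})))).obj (straight D K X) ≅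
      (D.map (pt (k, z.1.v))).obj X :=
  ptMapIso (intIncl K) ((k, z), PUnit.unit) (straight D K X) ≪≫
    (D.map (pt ((k, z), (PUnit.unit : Pt.{w})))).mapIso (asIso (straightCounit X)) ≪≫
    (ptMapIso (intIncl K) ((k, z), PUnit.unit) ((D.map (intProj K)).obj X)).symm ≪≫
    (ptMapIso (intProj K) ((k, z.1), PUnit.unit) X).symm

theorem isPrespectrum_of_isLan (hpt : D.IsPointed) (hX : D.IsPrespectrum K X)
    (hκ : IsLan (intProj K) κ) : D.IsPrespectrum K L :=
  hpt.isPrespectrum fun k v hv => by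
    refine hpt.isZero_of_isLan (hκ.restrict (lanData_intSeq k v)) ?_
    refine hpt.isZero_of_pointwise fun n => ?_
    exact ((hX.isZero_at inferInstance k hv).of_iso
      (straightAt X k ⟨⟨n.down, v⟩, Or.inl hv⟩)).of_iso
        (ptMapIso (intSeq k v) n (straight D K X)).symm

/-- The sequence of squares over a point of the diagonal. -/
def intFamily (k : K) (i : ℤ) : (NatShape.{w} × Sq.{w}) × Pt.{w} ⥤ (K × IntStrip.{w}) × Pt.{w} where
  obj x := ((k, (intSq (x.1.1.down + (i + 1)) (Strip.diag i)).obj x.1.2), x.2)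
  map {x y} f := CategoryTheory.Prod.mkHom (CategoryTheory.Prod.mkHom (𝟙 k)
    (homOfLE ⟨add_le_add_left (Int.ofNat_le.2 (show x.1.1 ≤ y.1.1 from leOfHom f.1.1)) _,
      Strip.w_mono (leOfHom f.1.2) le_rfl⟩)) f.2
  map_id _ := midHom_ext rfl
  map_comp _ _ := midHom_ext (Category.comp_id (𝟙 k)).symm

/-- The heights in `intFamily` start at `i + 1`, so every square of the sequence is in the range `m
> i` where `straight` is cartesian. -/
theorem isCart_intFamily (X : D.obj (K × Strip.{w})) (k : K) (i : ℤ) :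
    IsCart ((D.map (intFamily k i)).obj (straight D K X)) := by
  rw [isCart_iff]
  intro n v
  refine isCartSq_map_iff.2 ((isCartSq_straight X k (m := n.down + (i + 1)) (i := i)
    (by omega)).congr ?_)
  exact NatIso.ofComponents (fun q => Iso.refl _) (fun f => midHom_ext rfl)

/-- The lower left corners in the sequences of squares. -/
def seqZero : NatShape.{w} ⥤ (NatShape.{w} × Sq.{w}) × Pt.{w} where
  obj n := ((n, Sq.zero), PUnit.unit)
  map f := CategoryTheory.Prod.mkHom (CategoryTheory.Prod.mkHom f (𝟙 _)) (𝟙 _)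
  map_id _ := rfl
  map_comp _ _ := rfl

/-- The corners in the sequences of squares. -/
def seqCorner : NatShape.{w} × SqUR.{w} ⥤ (NatShape.{w} × SqUR.{w}) × Pt.{w} :=
  CategoryTheory.Prod.sectL _ PUnit.unit

/-- The cone of the corner. -/
def seqCone : CategoryTheory.Prod.fst NatShape.{w} SqUR.{w} ⋙ seqZero.{w} ⟶
    seqCorner.{w} ⋙ cornerIncl NatShape.{w} Pt.{w} where
  app _ := CategoryTheory.Prod.mkHom (CategoryTheory.Prod.mkHom (𝟙 _)
    (homOfLE ⟨Bool.false_le _, Bool.false_le _⟩)) (𝟙 _)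
  naturality _ _ _ := midHom_ext (Subsingleton.elim _ _)

theorem isLim_seqCone {E : D.obj ((NatShape.{w} × Sq.{w}) × Pt.{w})} (hE : IsCart E) :
    IsLim seqCone.{w} E := by
  have h : IsRan (CategoryTheory.Prod.fst NatShape.{w} SqUR.{w})
      (pull seqCone.{w} (𝟙 ((D.map (cornerIncl NatShape.{w} Pt.{w})).obj E))) := by
    refine IsRan.pull_of_ranData hE fun n => ?_
    refine ⟨SqUR.{w}, inferInstance, CategoryTheory.Prod.sectR n SqUR.{w},
      { app := fun _ => 𝟙 n }, ?_, ?_⟩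
    · intro a f
      exact ⟨a.2, CategoryTheory.Prod.mkHom f (𝟙 _), Subsingleton.elim _ _,
        fun s h _ => ⟨h.2, CategoryTheory.Prod.hom_ext (Subsingleton.elim _ _)
          (Subsingleton.elim _ _)⟩⟩
    · refine ranData_midMap _ (fun s => ?_) fun a v h1 h2 => ⟨a, le_rfl, h2, fun s hs _ => hs⟩
      exact inferInstanceAs (IsIso (𝟙 n ≫ 𝟙 n))
  exact isRan_pull_iff_isLim.1 h

/-- The only place where regularity enters. The heights above `i` are cofinal, so the square of `L`
is the sequential colimit of the cartesian squares in `intFamily`, and the corner is a finite shape.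
-/
theorem isCartSq_diag_of_isLan (hreg : D.IsRegular) (hκ : IsLan (intProj K) κ) (k : K) (i : ℤ) :
    IsCartSq (sqAt k (Strip.diag i)) L := by
  let x := seqZero.{w} ⋙ intFamily k i
  let g := (seqCorner.{w} ⋙ cornerIncl NatShape.{w} Pt.{w}) ⋙ intFamily k i
  let p := CategoryTheory.Prod.fst NatShape.{w} SqUR.{w}
  let q := CategoryTheory.Prod.snd NatShape.{w} SqUR.{w}
  let δ : p ⋙ x ⟶ g := Functor.whiskerRight seqCone.{w} (intFamily k i)
  let δ₀ : x ⋙ intProj K ⟶ toPt NatShape.{w} ⋙ (pt Sq.zero.{w} ⋙ sqAt k (Strip.diag i)) :=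
    { app := fun _ => 𝟙 (k, Strip.diag i)
      naturality := fun _ _ _ => CategoryTheory.Prod.hom_ext rfl (Subsingleton.elim _ _) }
  let δ₁ : g ⋙ intProj K ⟶ q ⋙ (SqUR.incl.{w} ⋙ sqAt k (Strip.diag i)) :=
    { app := fun a => 𝟙 (k, Strip.w a.2.1 (Strip.diag i))
      naturality := fun _ _ _ => CategoryTheory.Prod.hom_ext rfl (Subsingleton.elim _ _) }
  have h1 : IsRan p (cone δ (straight D K X)) :=
    isLim_map_iff.1 (isLim_seqCone (isCart_intFamily X k i))
  have h2 : IsLan (toPt NatShape.{w}) (push δ₀ κ) := by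
    refine hκ.push_of_lanData fun y => ⟨NatShape.{w}, inferInstance, 𝟭 _, { app := fun _ => 𝟙 _ },
      ?_, ?_⟩
    · intro a f
      exact ⟨a, 𝟙 _, Subsingleton.elim _ _, fun s h _ => ⟨h, Subsingleton.elim _ _⟩⟩
    · exact lanData_intProj (fun _ => inferInstanceAs (IsIso (𝟙 k ≫ 𝟙 k))) (i + 1)
        (fun _ => rfl) (fun _ => le_rfl)
  have h3 : IsLan q (push δ₁ κ) := by
    refine hκ.push_of_lanData fun y => ⟨NatShape.{w}, inferInstance,
      CategoryTheory.Prod.sectL NatShape.{w} y, { app := fun _ => 𝟙 _ }, ?_, ?_⟩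
    · intro a f
      exact ⟨a.1, CategoryTheory.Prod.mkHom (𝟙 _) f, Subsingleton.elim _ _,
        fun s h _ => ⟨h.1, CategoryTheory.Prod.hom_ext (Subsingleton.elim _ _)
          (Subsingleton.elim _ _)⟩⟩
    · exact lanData_intProj (fun _ => inferInstanceAs (IsIso (𝟙 k ≫ 𝟙 k))) (i + 1)
        (fun _ => rfl) (fun _ => le_rfl)
  refine hreg.isRan isFiniteShape_SqUR h1 h2 h3 ?_
  refine cone_comp_push δ δ₁ δ₀ (𝟙 _) (Functor.whiskerRight cornerCone (sqAt k (Strip.diag i))) ?_ κ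
  ext a : 2
  refine CategoryTheory.Prod.hom_ext ?_ (Subsingleton.elim _ _)
  change 𝟙 k ≫ 𝟙 k = 𝟙 k ≫ 𝟙 k ≫ 𝟙 k
  simp

/-- If `v` is on the boundary, so are all four vertices of the square at `v`; a square of zeros is
cartesian. -/
theorem isCartSq_of_isPrespectrum (hpt : D.IsPointed) (hL : D.IsPrespectrum K L) (k : K)
    {v : Strip.{w}} (hv : |v.i - v.j| = 1) : IsCartSq (sqAt k v) L := by
  have h : ∀ q : Sq.{w}, |(Strip.w q v).i - (Strip.w q v).j| = 1 := by
    rintro ⟨a, b⟩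
    rw [abs_eq zero_le_one] at hv
    cases a <;> cases b <;> simp [Strip.w]
    · rwa [abs_eq zero_le_one]
    · rw [abs_eq zero_le_one]
      omega
  have h1 : IsZero ((D.map (pt Sq.zero.{w} ⋙ sqAt k v)).obj L) :=
    hpt.isZero_of_pointwise fun x => (hL.isZero_at inferInstance k (h Sq.zero)).of_iso
      (ptMapIso (pt Sq.zero.{w} ⋙ sqAt k v) x L).symm
  have h2 : IsZero ((D.map (SqUR.incl.{w} ⋙ sqAt k v)).obj L) :=
    hpt.isZero_of_pointwise fun x => (hL.isZero_at inferInstance k (h x.1)).of_iso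
      (ptMapIso (SqUR.incl.{w} ⋙ sqAt k v) x L).symm
  exact fun Z => ⟨fun _ _ _ => h1.eq_of_tgt _ _, fun _ => ⟨h1.from_ Z, h2.eq_of_tgt _ _⟩⟩

/-- Sequential colimits of straightened towers are Ω-spectra. -/
theorem isCartSq_of_isLan (hpt : D.IsPointed) (hreg : D.IsRegular) (hX : D.IsPrespectrum K X)
    (hκ : IsLan (intProj K) κ) (k : K) (v : Strip.{w}) : IsCartSq (sqAt k v) L := by
  by_cases hv : |v.i - v.j| = 1
  · exact isCartSq_of_isPrespectrum hpt (isPrespectrum_of_isLan hpt hX hκ) k hv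
  · rw [Strip.eq_diag hv]
    exact isCartSq_diag_of_isLan hreg hκ k v.i

end regular
end Prederivator

namespace Prederivator

variable {𝒟 : DiagramClass.{w}} {D : Prederivator.{w, v, u} 𝒟}

/-! ### The unit of the localization -/

section equalities

variable {I J : Type w} [SmallCategory I] [SmallCategory J] [𝒟.Has I] [𝒟.Has J]

theorem map_obj_congr {t t' : I ⥤ J} (h : t = t') (X : D.obj J) :
    (D.map t).obj X = (D.map t').obj X := by rw [h]

theorem map_tri_obj {L : Type w} [SmallCategory L] [𝒟.Has L] {t : I ⥤ L} {a : I ⥤ J} {b : J ⥤ L}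
    (h : t = a ⋙ b) (X : D.obj L) : (D.map t).obj X = (D.map a).obj ((D.map b).obj X) :=
  (map_obj_congr h X).trans (D.map_comp_obj a b X)

theorem map_tri_map {L : Type w} [SmallCategory L] [𝒟.Has L] {t : I ⥤ L} {a : I ⥤ J} {b : J ⥤ L}
    (h : t = a ⋙ b) {X Y : D.obj L} (f : X ⟶ Y) :
    (D.map t).map f ≫ eqToHom (map_tri_obj h Y) = eqToHom (map_tri_obj h X) ≫
      (D.map a).map ((D.map b).map f) := by
  subst h
  simp [map_comp_map]

theorem map_tri_naturality {L : Type w} [SmallCategory L] [𝒟.Has L] {t : I ⥤ L} {a : I ⥤ J}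
    {b : J ⥤ L} (h : t = a ⋙ b) {X Y : D.obj L} (f : X ⟶ Y) {X' Y' : D.obj J}
    {x : (D.map b).obj X ⟶ X'} {y : (D.map b).obj Y ⟶ Y'} {g : X' ⟶ Y'}
    (e : (D.map b).map f ≫ y = x ≫ g) :
    (D.map t).map f ≫ eqToHom (map_tri_obj h Y) ≫ (D.map a).map y =
      (eqToHom (map_tri_obj h X) ≫ (D.map a).map x) ≫ (D.map a).map g := by
  rw [reassoc_of% map_tri_map h f, Category.assoc, ← Functor.map_comp, ← Functor.map_comp, e]

theorem map_sq_obj {J' L : Type w} [SmallCategory J'] [SmallCategory L] [𝒟.Has J'] [𝒟.Has L]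
    {a : I ⥤ J} {b : J ⥤ L} {c : I ⥤ J'} {d : J' ⥤ L} (h : a ⋙ b = c ⋙ d) (X : D.obj L) :
    (D.map a).obj ((D.map b).obj X) = (D.map c).obj ((D.map d).obj X) :=
  (D.map_comp_obj a b X).symm.trans (map_tri_obj h X)

theorem map_sq_map {J' L : Type w} [SmallCategory J'] [SmallCategory L] [𝒟.Has J'] [𝒟.Has L]
    {a : I ⥤ J} {b : J ⥤ L} {c : I ⥤ J'} {d : J' ⥤ L} (h : a ⋙ b = c ⋙ d) {X Y : D.obj L}
    (f : X ⟶ Y) :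
    (D.map a).map ((D.map b).map f) ≫ eqToHom (map_sq_obj h Y) = eqToHom (map_sq_obj h X) ≫
      (D.map c).map ((D.map d).map f) := by
  have h1 := map_tri_map h f
  rw [map_comp_map] at h1
  simp only [Category.assoc, eqToHom_trans, eqToHom_comp_iff] at h1
  rw [h1]
  simp

theorem map_bijective_of_isLan_id {A B : Type w} [SmallCategory A] [SmallCategory B] [𝒟.Has A]
    [𝒟.Has B] {t : A ⥤ B} {Y Z : D.obj B} (h : IsLan t (𝟙 ((D.map t).obj Y))) :
    Function.Bijective fun f : Y ⟶ Z => (D.map t).map f := by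
  convert h Z using 2
  exact (Category.id_comp _).symm

end equalities

section unit

variable (K : Type w) [SmallCategory K] [𝒟.Has K]

/-- The projection to `V^{≥ 0}`. -/
def StripNat.proj : StripNat.{w} ⥤ StripNonneg.{w} :=
  Monotone.functor (f := fun x => x.p) fun _ _ h => h.1

/-- The constant extension of `ω^*` along the projection. -/
abbrev constMap : (K × StripNat.{w}) × Strip.{w} ⥤ K × Strip.{w} :=
  midMap K Strip.{w} StripNat.proj.{w} ⋙ twist Strip.ω Strip.ω_mono K

/-- The projection `(K × ℕ) × V ⥤ K × V`. -/
abbrev natProj : (K × NatShape.{w}) × Strip.{w} ⥤ K × Strip.{w} :=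
  (CategoryTheory.Prod.fst K NatShape.{w}).prod (𝟭 Strip.{w})

theorem Strip.ω_zero (v : Strip.{w}) : Strip.ω StripNonneg.zero v = v :=
  Strip.ext (add_zero _) (add_zero _)

/-- The two functors agree only up to `Strip.ω_zero`, an equality of integers that does not hold by
definition; hence the explicit transports in what follows. -/
theorem column_constMap :
    midMap K Strip.{w} StripNat.column.{w} ⋙ constMap K = natProj K :=
  CategoryTheory.Functor.ext (fun x => Prod.ext rfl (Strip.ω_zero x.2)) fun x y f => by
    refine CategoryTheory.Prod.hom_ext ?_ (Subsingleton.elim _ _)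
    have e : ∀ {a b c d : K × Strip.{w}} (p : a = b) (g : b ⟶ c) (q : c = d),
        (eqToHom p ≫ g ≫ eqToHom q).1 =
          eqToHom (congrArg Prod.fst p) ≫ g.1 ≫ eqToHom (congrArg Prod.fst q) := by
      rintro _ _ _ _ rfl g rfl
      simp
    rw [e]
    exact ((Category.id_comp _).trans (Category.comp_id _)).symm

variable {K}

theorem incl_constMap_obj (X : D.obj (K × Strip.{w})) :
    (D.map (midMap K Strip.{w} StripZ.incl.{w})).obj ((D.map (constMap K)).obj X) =
      (D.map (midMap K Strip.{w} StripZ.ζ.{w})).obj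
        ((D.map (twist Strip.ω Strip.ω_mono K)).obj X) :=
  map_sq_obj (a := midMap K Strip.{w} StripZ.incl.{w}) (b := constMap K)
    (c := midMap K Strip.{w} StripZ.ζ.{w}) (d := twist Strip.ω Strip.ω_mono K) rfl X

theorem incl_constMap_map {X Y : D.obj (K × Strip.{w})} (f : X ⟶ Y) :
    (D.map (midMap K Strip.{w} StripZ.incl.{w})).map ((D.map (constMap K)).map f) ≫
        eqToHom (incl_constMap_obj Y) = eqToHom (incl_constMap_obj X) ≫
      (D.map (midMap K Strip.{w} StripZ.ζ.{w})).map
        ((D.map (twist Strip.ω Strip.ω_mono K)).map f) :=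
  map_sq_map (a := midMap K Strip.{w} StripZ.incl.{w}) (b := constMap K)
    (c := midMap K Strip.{w} StripZ.ζ.{w}) (d := twist Strip.ω Strip.ω_mono K) rfl f

variable [D.IsDerivator]

/-- The counit of the tower diagram. -/
noncomputable abbrev towerCounit (X : D.obj (K × Strip.{w})) :
    (D.map (midMap K Strip.{w} StripZ.incl.{w})).obj ((D.towerDiagram K).obj X) ⟶
      (D.map (midMap K Strip.{w} StripZ.ζ.{w})).obj
        ((D.map (twist Strip.ω Strip.ω_mono K)).obj X) :=
  ranCounit (midMap K Strip.{w} StripZ.incl.{w}) _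

theorem isRan_towerCounit (X : D.obj (K × Strip.{w})) :
    IsRan (midMap K Strip.{w} StripZ.incl.{w}) (towerCounit X) := isRan_counit _ _

theorem towerCounit_naturality {X Y : D.obj (K × Strip.{w})} (f : X ⟶ Y) :
    (D.map (midMap K Strip.{w} StripZ.incl.{w})).map ((D.towerDiagram K).map f) ≫ towerCounit Y =
      towerCounit X ≫ (D.map (midMap K Strip.{w} StripZ.ζ.{w})).map
        ((D.map (twist Strip.ω Strip.ω_mono K)).map f) :=
  ranCounit_naturality (midMap K Strip.{w} StripZ.incl.{w}) _

/-- Over `Z` the tower diagram is the constant one, so the identity there extends by the universal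
property of the right Kan extension. -/
theorem exists_toTowerDiagram (X : D.obj (K × Strip.{w})) :
    ∃ h : (D.map (constMap K)).obj X ⟶ (D.towerDiagram K).obj X,
      (D.map (midMap K Strip.{w} StripZ.incl.{w})).map h ≫ towerCounit X =
        eqToHom (incl_constMap_obj X) :=
  (isRan_towerCounit X _).2 _

/-- The map from the constant diagram to the tower diagram. -/
noncomputable def toTowerDiagram (X : D.obj (K × Strip.{w})) :
    (D.map (constMap K)).obj X ⟶ (D.towerDiagram K).obj X :=
  (exists_toTowerDiagram X).choose

theorem toTowerDiagram_counit (X : D.obj (K × Strip.{w})) :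
    (D.map (midMap K Strip.{w} StripZ.incl.{w})).map (toTowerDiagram X) ≫ towerCounit X =
      eqToHom (incl_constMap_obj X) :=
  (exists_toTowerDiagram X).choose_spec

theorem toTowerDiagram_naturality {X Y : D.obj (K × Strip.{w})} (f : X ⟶ Y) :
    (D.map (constMap K)).map f ≫ toTowerDiagram Y =
      toTowerDiagram X ≫ (D.towerDiagram K).map f := by
  refine (isRan_towerCounit Y).hom_ext ?_
  rw [Functor.map_comp, Functor.map_comp, Category.assoc, Category.assoc, towerCounit_naturality,
    reassoc_of% (toTowerDiagram_counit X), toTowerDiagram_counit, incl_constMap_map]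

/-- The map from the constant sequence to the tower. -/
noncomputable def toTower (X : D.obj (K × Strip.{w})) :
    (D.map (natProj K)).obj X ⟶ (D.tower K).obj X :=
  eqToHom (map_tri_obj (column_constMap K).symm X) ≫
    (D.map (midMap K Strip.{w} StripNat.column.{w})).map (toTowerDiagram X)

theorem toTower_naturality {X Y : D.obj (K × Strip.{w})} (f : X ⟶ Y) :
    (D.map (natProj K)).map f ≫ toTower Y = toTower X ≫ (D.tower K).map f := by
  exact map_tri_naturality (column_constMap K).symm f (toTowerDiagram_naturality f)

/-- The sequence over a point. -/
def natSeq (k : K) (v : Strip.{w}) : NatShape.{w} ⥤ (K × NatShape.{w}) × Strip.{w} :=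
  inFiber k (𝟭 _) v

/-- The sequence over a point is constant after projection. -/
def natSeqHom (k : K) (v : Strip.{w}) :
    natSeq k v ⋙ natProj K ⟶ toPt NatShape.{w} ⋙ pt (k, v) where
  app _ := 𝟙 _

instance (k : K) (v : Strip.{w}) : IsIso (natSeqHom k v) := by
  have : ∀ X, IsIso ((natSeqHom k v).app X) := fun _ => inferInstanceAs (IsIso (𝟙 _))
  exact NatIso.isIso_of_isIso_app _

theorem lanData_natSeq (k : K) (v : Strip.{w}) :
    LanData (natProj K) (pt (k, v)) (natSeq k v) (natSeqHom k v) :=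
  LanData.of_poset (q := CategoryTheory.Prod.fst K Strip.{w})
    (p := fun a : (K × NatShape.{w}) × Strip.{w} => (a.1.2, a.2))
    (isOverPoset_fst_fst (K := K) (P := NatShape.{w}) (Q := Strip.{w})) isOverPoset_fst
    (fun _ => inferInstanceAs (IsIso (𝟙 k)))
    fun a ha => ⟨a.1.2, ⟨le_rfl, ha⟩, fun _ hn => hn.1⟩

theorem isLan_natProj_id (Y : D.obj (K × Strip.{w})) :
    IsLan (natProj K) (𝟙 ((D.map (natProj K)).obj Y)) :=
  isLan_id_of_lanData (fun b => ⟨natSeq b.1 b.2, natSeqHom b.1 b.2, inferInstance,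
    lanData_natSeq b.1 b.2⟩) Y

/-- The unit of the sequential colimit. -/
noncomputable abbrev colimUnit (X : D.obj (K × Strip.{w})) :
    (D.tower K).obj X ⟶ (D.map (natProj K)).obj ((D.towerColim K).obj X) :=
  lanUnit (natProj K) ((D.tower K).obj X)

theorem isLan_colimUnit (X : D.obj (K × Strip.{w})) : IsLan (natProj K) (colimUnit X) :=
  isLan_unit _ _

/-- The composite from the constant sequence on `X` through the tower to the constant sequence on
the colimit descends to a single map, because pullback along `natProj` is fully faithful. -/
theorem exists_toColim (X : D.obj (K × Strip.{w})) :
    ∃ h : X ⟶ (D.towerColim K).obj X, (D.map (natProj K)).map h = toTower X ≫ colimUnit X :=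
  (map_bijective_of_isLan_id (isLan_natProj_id X)).2 _

/-- The map from `X` to the colimit of the tower. -/
noncomputable def toColim (D : Prederivator.{w, v, u} 𝒟) [D.IsDerivator] (K : Type w)
    [SmallCategory K] [𝒟.Has K] : 𝟭 ((D.shift Strip.{w}).obj K) ⟶ D.towerColim K where
  app X := (exists_toColim (D := D) (K := K) X).choose
  naturality X Y f := by
    refine (map_bijective_of_isLan_id (isLan_natProj_id (D := D) (K := K) X)).1 ?_
    have hX := (exists_toColim (D := D) (K := K) X).choose_spec
    have hY := (exists_toColim (D := D) (K := K) Y).choose_spec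
    have h1 : (D.tower K).map f ≫ colimUnit Y = colimUnit X ≫
      (D.map (natProj K)).map ((D.towerColim K).map f) :=
        lanUnit_naturality (natProj K) ((D.tower K).map f)
    dsimp only [Functor.id_map]
    rw [Functor.map_comp, Functor.map_comp, hX, hY, Category.assoc, ← h1,
      ← reassoc_of% toTower_naturality (D := D) (K := K) f]

theorem map_toColim (X : D.obj (K × Strip.{w})) :
    (D.map (natProj K)).map ((toColim D K).app X) = toTower X ≫ colimUnit X :=
  (exists_toColim (D := D) (K := K) X).choose_spec

end unit
end Prederivator

namespace Prederivator

variable {𝒟 : DiagramClass.{w}} {D : Prederivator.{w, v, u} 𝒟}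

/-! ### Comparison of the tower with the straightened tower -/

section abstract

variable {A B M N : Type w} [SmallCategory A] [SmallCategory B] [SmallCategory M] [SmallCategory N]
  [𝒟.Has A] [𝒟.Has B] [𝒟.Has M] [𝒟.Has N]

theorem pull_id_id {a : M ⥤ N} {b : N ⥤ B} {c : M ⥤ A} {d : A ⥤ B} (h : a ⋙ b = c ⋙ d)
    (E : D.obj B) : pull (eqToHom h) (𝟙 ((D.map d).obj E)) = eqToHom (map_sq_obj h E) := by
  have : ∀ {t t' : M ⥤ B} (h : t = t'), (D.map₂ (eqToHom h)).app E =
      eqToHom (map_obj_congr h E) := by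
    rintro t _ rfl
    exact map₂_id_app D _ _
  simp [pull, cell_app, this]

theorem IsLan.exists_iso_of_isLan {u : A ⥤ B} {E E' : D.obj B} {Y : D.obj A}
    {κ : Y ⟶ (D.map u).obj E} (hκ : IsLan u κ) {κ' : Y ⟶ (D.map u).obj E'} (hκ' : IsLan u κ') :
    ∃ m : E ≅ E', κ ≫ (D.map u).map m.hom = κ' := by
  obtain ⟨m, hm⟩ := (hκ E').2 κ'
  have := hκ.isIso hκ' m (𝟙 Y) (by simpa using hm)
  exact ⟨asIso m, hm⟩

/-- Restriction of a cocone along a functor compatible with the projections. -/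
theorem IsLan.comp_of_lanData [D.IsDerivator] {a : N ⥤ A} {p : A ⥤ B} {n : N ⥤ B} (h : n = a ⋙ p)
    {S : D.obj A} {L : D.obj B} {κ : S ⟶ (D.map p).obj L} (hκ : IsLan p κ)
    (hd : ∀ x : B, ∃ (T : Type w) (_ : PartialOrder T) (g : T ⥤ N) (γ : g ⋙ n ⟶ toPt T ⋙ pt x),
      LanData n (pt x) g γ ∧ LanData p (pt x) (g ⋙ a)
        ((eqToHom (congrArg (fun n => g ⋙ n) h.symm) : (g ⋙ a) ⋙ p ⟶ g ⋙ n) ≫ γ)) :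
    IsLan n ((D.map a).map κ ≫ eqToHom (map_tri_obj h L).symm) := by
  subst h
  have h1 : IsLan (a ⋙ p) (push (a := a) (b := p) (c := a ⋙ p) (d := 𝟭 B) (𝟙 _) κ) := by
    refine hκ.push_of_lanData fun x => ?_
    obtain ⟨T, hT, g, γ, h1, h2⟩ := hd x
    refine ⟨T, hT, g, γ, h1, ?_⟩
    intro y f
    obtain ⟨l, ε, h3, h4⟩ := h2 y f
    refine ⟨l, ε, ?_, fun s m hm => h4 s m ?_⟩
    · simpa using h3
    · simpa using hm
  refine h1.of_iso (eqToHom (D.map_id_obj L)) (𝟙 _) ?_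
  rw [push, cell_app, map₂_id_app]
  simp [eqToHom_map]

theorem comp_comparison {p : A ⥤ B} {c : M ⥤ A} {q : M ⥤ B} {l : N ⥤ M} {n : N ⥤ B}
    (hq : q = c ⋙ p) (hn : n = l ⋙ q) (hn' : n = (l ⋙ c) ⋙ p) {X L : D.obj B} {S : D.obj A}
    {T : D.obj M} {i : (D.map p).obj X ⟶ S} {κ : S ⟶ (D.map p).obj L} {η : X ⟶ L}
    (hη : (D.map p).map η = i ≫ κ) {t : (D.map q).obj X ⟶ T} {ρ : (D.map c).obj S ⟶ T}
    (hρ : (D.map c).map i ≫ ρ = eqToHom (map_tri_obj hq X).symm ≫ t) [IsIso ((D.map l).map ρ)] :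
    (eqToHom (map_tri_obj hn X) ≫ (D.map l).map t) ≫ inv ((D.map l).map ρ) ≫
      eqToHom (D.map_comp_obj l c S).symm ≫ (D.map (l ⋙ c)).map κ ≫
        eqToHom (map_tri_obj hn' L).symm = (D.map n).map η := by
  subst hq hn
  have h1 : t = eqToHom (map_tri_obj rfl X) ≫ (D.map c).map i ≫ ρ := by simp [hρ]
  have h2 := (comp_eqToHom_iff _ _ _).1 (map_tri_map hn' η)
  have h3 := D.map_comp_map l c i
  rw [h2, hη, Functor.map_comp, h3, h1]
  simp [eqToHom_map]

end abstract

/-- The comparison map of shapes. -/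
def StripNat.toInt (x : StripNat.{w}) (v : Strip.{w}) : IntStrip.{w} :=
  -- At `v = (i,i)`, stage `k` of the tower corresponds to height `k + i`. The minimum extends this
  -- monotonically to the boundary, where the height does not matter for prespectra since all values
  -- vanish.
  ⟨x.k + min v.i v.j, Strip.ω x.p v⟩

theorem StripNat.toInt_mono {x y : StripNat.{w}} {v v' : Strip.{w}} (h : x ≤ y) (hv : v ≤ v') :
    StripNat.toInt x v ≤ StripNat.toInt y v' :=
  ⟨add_le_add (Int.ofNat_le.2 h.2) (min_le_min hv.1 hv.2), Strip.ω_mono h.1 hv⟩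

theorem Strip.abs_ω' (p : StripNonneg.{w}) (v : Strip.{w}) (hv : |v.i - v.j| = 1) :
    |(Strip.ω p v).i - (Strip.ω p v).j| = 1 := by
  by_cases hp : p.1.i = p.1.j
  · simp only [Strip.ω, hp]
    split_ifs
    · simpa using hv
    · simpa [abs_sub_comm] using hv
  · exact Strip.abs_ω p v hp

theorem Strip.ω_diag (p : StripNonneg.{w}) (i : ℤ) :
    (Strip.ω p (Strip.diag i)).i = i + p.1.i ∧ (Strip.ω p (Strip.diag i)).j = i + p.1.j :=
  ⟨congrArg (· + p.1.i) (ite_self i), congrArg (· + p.1.j) (ite_self i)⟩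

/-- For `p = (a,a)` and `v = (i,i)` the condition `k ≤ a` of `Z` becomes `k + i ≤ a + i`, the
condition of `IntZ`; in all other cases the image is on the boundary. -/
theorem StripZ.toInt_mem (z : StripZ.{w}) (v : Strip.{w}) :
    |(StripNat.toInt z.1 v).v.i - (StripNat.toInt z.1 v).v.j| = 1 ∨
      (StripNat.toInt z.1 v).m ≤ (StripNat.toInt z.1 v).v.i := by
  by_cases hv : |v.i - v.j| = 1
  · exact Or.inl (Strip.abs_ω' _ _ hv)
  by_cases hp : z.1.p.1.i = z.1.p.1.j
  · right
    rw [Strip.eq_diag hv]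
    have h := z.2 hp
    change (z.1.k : ℤ) + min v.i v.i ≤ (Strip.ω z.1.p (Strip.diag v.i)).i
    rw [(Strip.ω_diag _ _).1, min_self]
    omega
  · exact Or.inl (Strip.abs_ω _ _ hp)

section compare

variable (K : Type w) [SmallCategory K] [𝒟.Has K]

/-- The comparison functor. -/
def compare : (K × StripNat.{w}) × Strip.{w} ⥤ (K × IntStrip.{w}) × Pt.{w} where
  obj x := ((x.1.1, StripNat.toInt x.1.2 x.2), PUnit.unit)
  map f := CategoryTheory.Prod.mkHom (CategoryTheory.Prod.mkHom f.1.1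
    (homOfLE (StripNat.toInt_mono (leOfHom f.1.2) (leOfHom f.2)))) (𝟙 _)

/-- The comparison functor on the initial parts. -/
def compareZ : (K × StripZ.{w}) × Strip.{w} ⥤ (K × IntZ.{w}) × Pt.{w} where
  obj x := ((x.1.1, ⟨StripNat.toInt x.1.2.1 x.2, StripZ.toInt_mem _ _⟩), PUnit.unit)
  map {x y} f := CategoryTheory.Prod.mkHom (CategoryTheory.Prod.mkHom f.1.1
    (homOfLE (show StripNat.toInt x.1.2.1 x.2 ≤ StripNat.toInt y.1.2.1 y.2 from
      StripNat.toInt_mono (leOfHom f.1.2) (leOfHom f.2)))) (𝟙 _)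

theorem incl_compare : midMap K Strip.{w} StripZ.incl.{w} ⋙ compare K =
    compareZ K ⋙ intIncl K := rfl

theorem compare_intProj : constMap K = compare K ⋙ intProj K := rfl

theorem natProj_eq :
    natProj K = (midMap K Strip.{w} StripNat.column.{w} ⋙ compare K) ⋙ intProj K :=
  (column_constMap K).symm

variable {K}

theorem compareZ_obj (X : D.obj (K × Strip.{w})) :
    (D.map (compareZ K)).obj ((D.map (intIncl K)).obj ((D.map (intProj K)).obj X)) =
      (D.map (midMap K Strip.{w} StripZ.ζ.{w})).obj
        ((D.map (twist Strip.ω Strip.ω_mono K)).obj X) :=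
  (congrArg (D.map (compareZ K)).obj (D.map_comp_obj (intIncl K) (intProj K) X)).symm.trans
    (map_sq_obj (a := compareZ K) (b := intIncl K ⋙ intProj K)
      (c := midMap K Strip.{w} StripZ.ζ.{w}) (d := twist Strip.ω Strip.ω_mono K) rfl X)

variable [D.IsDerivator]

/-- The map `ρ` extends the identity over `Z`. Its compatibility with the maps from the constant
diagram is also checked over `Z`, where all of them are identities. -/
theorem exists_comparison (X : D.obj (K × Strip.{w})) :
    ∃ ρ : (D.map (compare K)).obj (straight D K X) ⟶ (D.towerDiagram K).obj X,
      (D.map (midMap K Strip.{w} StripZ.incl.{w})).map ρ ≫ towerCounit X =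
          pull (eqToHom (incl_compare K)) (straightCounit X) ≫ eqToHom (compareZ_obj X) ∧
        (D.map (compare K)).map (toStraight X) ≫ ρ =
          eqToHom (map_tri_obj (compare_intProj K) X).symm ≫ toTowerDiagram X := by
  obtain ⟨ρ, hρ⟩ := (isRan_towerCounit X ((D.map (compare K)).obj (straight D K X))).2
    (pull (eqToHom (incl_compare K)) (straightCounit X) ≫ eqToHom (compareZ_obj X))
  dsimp only at hρ
  refine ⟨ρ, hρ, (isRan_towerCounit X).hom_ext ?_⟩
  have h1 := map_pull (eqToHom (incl_compare K))
    ((toStraight_counit X).trans (Category.comp_id (𝟙 _)).symm)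
  rw [pull_id_id] at h1
  rw [Functor.map_comp, Functor.map_comp, Category.assoc, Category.assoc, hρ,
    toTowerDiagram_counit, reassoc_of% h1, eqToHom_map]
  simp

/-- For `v` on the boundary both values are zero. For `v = (i,i)` translation by `i` identifies the
slice of `Z` with an initial part of the slice of `IntZ`, so both values are limits over the same
poset. -/
theorem isIso_map_pt_comparison (hpt : D.IsPointed) {X : D.obj (K × Strip.{w})}
    (hX : D.IsPrespectrum K X)
    {ρ : (D.map (compare K)).obj (straight D K X) ⟶ (D.towerDiagram K).obj X}
    (hρ : (D.map (midMap K Strip.{w} StripZ.incl.{w})).map ρ ≫ towerCounit X =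
      pull (eqToHom (incl_compare K)) (straightCounit X) ≫ eqToHom (compareZ_obj X))
    (k : K) (n : ℕ) (v : Strip.{w}) :
    IsIso ((D.map (pt ((k, (⟨StripNonneg.zero, n⟩ : StripNat.{w})), v))).map ρ) := by
  let S := {z : StripZ.{w} // n ≤ z.1.k}
  let g : S ⥤ (K × StripZ.{w}) × Strip.{w} :=
    inFiber k (Monotone.functor (f := Subtype.val) fun _ _ h => h) v
  let x : Pt.{w} ⥤ (K × StripNat.{w}) × Strip.{w} := pt ((k, ⟨StripNonneg.zero, n⟩), v)
  let γ : toPt S ⋙ x ⟶ g ⋙ midMap K Strip.{w} StripZ.incl.{w} :=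
    { app := fun s => CategoryTheory.Prod.mkHom (CategoryTheory.Prod.mkHom (𝟙 k)
        (homOfLE ⟨s.1.1.p.2, s.2⟩)) (𝟙 v)
      naturality := fun _ _ _ => midHom_ext rfl }
  have h1 : RanData (midMap K Strip.{w} StripZ.incl.{w}) x g γ :=
    ranData_midMap _ (fun _ => inferInstanceAs (IsIso (𝟙 k))) fun a v' h1 h2 =>
      ⟨⟨a, h1.2⟩, le_rfl, h2, fun s hs _ => hs⟩
  have h2 := (isRan_towerCounit X).restrict h1
  by_cases hv : |v.i - v.j| = 1
  · have h3 : IsZero ((D.map x).obj ((D.towerDiagram K).obj X)) := by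
      refine hpt.isZero_of_isRan h2 (hpt.isZero_of_pointwise fun s => ?_)
      exact (((hX.isZero_at inferInstance k (Strip.abs_ω' s.1.1.p v hv)).of_iso
        (ptMapIso (twist Strip.ω Strip.ω_mono K) ((k, s.1.1.p), v) X).symm).of_iso
          (ptMapIso (midMap K Strip.{w} StripZ.ζ.{w}) ((k, s.1), v) _).symm).of_iso
            (ptMapIso g s _).symm
    have h4 : IsZero ((D.map x).obj ((D.map (compare K)).obj (straight D K X))) := by
      have h5 := Strip.abs_ω' StripNonneg.zero v hv
      exact ((hX.isZero_at inferInstance k h5).of_iso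
        (straightAt X k ⟨StripNat.toInt ⟨StripNonneg.zero, n⟩ v, Or.inl h5⟩)).of_iso
          (ptMapIso (compare K) ((k, ⟨StripNonneg.zero, n⟩), v) _).symm
    exact isIso_of_isInitial h4.isInitial h3.isInitial _
  · have h3 : RanData (intIncl K) (x ⋙ compare K) (g ⋙ compareZ K)
        (Functor.whiskerRight γ (compare K) ≫
          Functor.whiskerLeft g (eqToHom (incl_compare K))) := by
      refine ranData_midMap _ (fun s => ?_) fun a v' h1 h2 => ?_
      · exact inferInstanceAs (IsIso (𝟙 k ≫ 𝟙 k))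
      · have hx : ∀ z : StripNat.{w}, StripNat.toInt z v ≤ a.1 ↔
            (z.k : ℤ) ≤ a.1.m - v.i ∧ z.p.1.i ≤ a.1.v.i - v.i ∧ z.p.1.j ≤ a.1.v.j - v.i := by
          intro z
          rw [Strip.eq_diag hv]
          change ((z.k : ℤ) + min v.i v.i ≤ a.1.m ∧ (Strip.ω z.p (Strip.diag v.i)).i ≤ a.1.v.i ∧
            (Strip.ω z.p (Strip.diag v.i)).j ≤ a.1.v.j) ↔ _
          rw [(Strip.ω_diag _ _).1, (Strip.ω_diag _ _).2, min_self]
          dsimp only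
          omega
        obtain ⟨h5, h6, h7⟩ := (hx ⟨StripNonneg.zero, n⟩).1 h1
        change (n : ℤ) ≤ _ at h5
        change 0 ≤ _ at h6
        change 0 ≤ _ at h7
        have h8 := abs_le.1 a.1.v.near
        -- The translation by `i` undone: for diagonal `v` the inequality `toInt z v ≤ a` is a bound
        -- on each coordinate of `z` separately, and `r` attains all three bounds.
        let r : StripNat.{w} := ⟨⟨⟨a.1.v.i - v.i, a.1.v.j - v.i, abs_le.2 ⟨by omega, by omega⟩⟩,
          h6, h7⟩, (a.1.m - v.i).toNat⟩
        have hr : (r.k : ℤ) = a.1.m - v.i := Int.toNat_of_nonneg (by omega)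
        have hr' : r.p.1.i = r.p.1.j → (r.k : ℤ) ≤ r.p.1.i := by
          intro h
          change a.1.v.i - v.i = a.1.v.j - v.i at h
          change (r.k : ℤ) ≤ a.1.v.i - v.i
          have h9 := a.2
          rw [show a.1.v.i - a.1.v.j = 0 by omega] at h9
          simp only [abs_zero, zero_ne_one, false_or] at h9
          omega
        refine ⟨⟨⟨r, hr'⟩, by change n ≤ r.k; omega⟩, (hx r).2 ⟨hr.le, le_rfl, le_rfl⟩,
          le_rfl, fun s hs _ => ?_⟩
        obtain ⟨h9, h10, h11⟩ := (hx _).1 hs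
        exact ⟨⟨h10, h11⟩, by change s.1.1.k ≤ r.k; change (s.1.1.k : ℤ) ≤ _ at h9; omega⟩
    have h4 := (isRan_straightCounit X).restrict_pull h3
    exact h4.isIso h2 _ _ (map_pull γ hρ)

/-- Over `v` the restricted sequence runs through the heights `n + min i j`, which are cofinal, so
the colimit does not change. -/
theorem isLan_natProj_comparison {S : D.obj ((K × IntStrip.{w}) × Pt.{w})}
    {L : D.obj (K × Strip.{w})} {κ : S ⟶ (D.map (intProj K)).obj L} (hκ : IsLan (intProj K) κ) :
    IsLan (natProj K) ((D.map (midMap K Strip.{w} StripNat.column.{w} ⋙ compare K)).map κ ≫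
      eqToHom (map_tri_obj (natProj_eq K) L).symm) :=
  hκ.comp_of_lanData (natProj_eq K) fun x =>
    ⟨NatShape.{w}, inferInstance, natSeq x.1 x.2, natSeqHom x.1 x.2, lanData_natSeq x.1 x.2,
      lanData_intProj (fun n => (CategoryTheory.Prod.fst K Strip.{w}).map_isIso
        ((eqToHom _ ≫ natSeqHom x.1 x.2).app n)) (min x.2.i x.2.j) (fun _ => rfl)
        (fun _ => (Strip.ω_zero x.2).ge)⟩

/-- The colimit of the tower is the colimit of the straightened tower. -/
theorem IsPointed.exists_towerColim_iso (hpt : D.IsPointed) {X L : D.obj (K × Strip.{w})}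
    (hX : D.IsPrespectrum K X) {κ : straight D K X ⟶ (D.map (intProj K)).obj L}
    (hκ : IsLan (intProj K) κ) :
    ∃ (η : X ⟶ L) (θ : (D.towerColim K).obj X ≅ L),
      (D.map (intProj K)).map η = toStraight X ≫ κ ∧ (toColim D K).app X ≫ θ.hom = η := by
  obtain ⟨η, hη⟩ := (map_bijective_of_isLan_id (isLan_intProj_id X)).2 (toStraight X ≫ κ)
  dsimp only at hη
  obtain ⟨ρ, hρ, hρ'⟩ := exists_comparison X
  -- The comparison need not be invertible on the whole tower diagram; the column over the origin is
  -- all that the tower sees.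
  have h1 : IsIso ((D.map (midMap K Strip.{w} StripNat.column.{w})).map ρ) :=
    isIso_map_of_pointwise _ _ fun x => isIso_map_pt_comparison hpt hX hρ x.1.1 x.1.2.down x.2
  have h2 := (isLan_natProj_comparison hκ).of_iso (κ' := inv ((D.map
    (midMap K Strip.{w} StripNat.column.{w})).map ρ) ≫ eqToHom (D.map_comp_obj _ _ _).symm ≫
      (D.map (midMap K Strip.{w} StripNat.column.{w} ⋙ compare K)).map κ ≫
        eqToHom (map_tri_obj (natProj_eq K) L).symm) (𝟙 L)
    (eqToHom (D.map_comp_obj _ _ _) ≫ (D.map (midMap K Strip.{w} StripNat.column.{w})).map ρ)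
    (by simp)
  obtain ⟨θ, hθ⟩ := (isLan_colimUnit X).exists_iso_of_isLan h2
  refine ⟨η, θ, hη, (map_bijective_of_isLan_id (isLan_natProj_id X)).1 ?_⟩
  dsimp only
  rw [Functor.map_comp, map_toColim, Category.assoc, hθ]
  exact comp_comparison (compare_intProj K) (column_constMap K).symm (natProj_eq K) hη hρ'

end compare
end Prederivator

namespace Prederivator

variable {𝒟 : DiagramClass.{w}} {D : Prederivator.{w, v, u} 𝒟}

/-! ### The universal property of the colimit of the tower -/

/-- Maps to `E` are the same as maps after restriction along `f`, and there `m` is invertible. -/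
theorem IsRanExt.precomp_bijective {A B : Type w} [SmallCategory A] [SmallCategory B] [𝒟.Has A]
    [𝒟.Has B] {f : B ⥤ A} {E : D.obj A} (hE : IsRanExt f E) {Z Z' : D.obj A} (m : Z ⟶ Z')
    [IsIso ((D.map f).map m)] : Function.Bijective fun g : Z' ⟶ E => m ≫ g := by
  have h : ∀ Z, Function.Bijective fun g : Z ⟶ E => (D.map f).map g := fun Z => by
    convert hE Z using 2
    exact (Category.comp_id _).symm
  constructor
  · intro g g' hg
    refine (h Z').1 ((cancel_epi ((D.map f).map m)).1 ?_)
    dsimp only at hg ⊢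
    rw [← Functor.map_comp, ← Functor.map_comp, hg]
  · intro g
    obtain ⟨g', hg'⟩ := (h Z').2 (inv ((D.map f).map m) ≫ (D.map f).map g)
    refine ⟨g', (h Z).1 ?_⟩
    dsimp only at hg' ⊢
    rw [Functor.map_comp, hg', IsIso.hom_inv_id_assoc]

section

variable [D.IsDerivator] {K : Type w} [SmallCategory K] [𝒟.Has K]

theorem isRanExt_intProj {Y : D.obj (K × Strip.{w})} (hY : ∀ k v, IsCartSq (sqAt k v) Y) :
    IsRanExt (intIncl K) ((D.map (intProj K)).obj Y) := by
  have := isIso_toStraight hY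
  exact (isRanExt_straight Y).of_iso (inv (toStraight Y))

/-- Maps from the colimit to `Y` are maps from `straight` to the constant diagram on `Y`. This is
right Kan extended from `IntZ`, where `toStraight` is invertible, so they are maps between constant
diagrams, and pullback along `intProj` is fully faithful. -/
theorem IsPointed.toColim_bijective (hpt : D.IsPointed) {X Y : D.obj (K × Strip.{w})}
    (hX : D.IsPrespectrum K X) (hY : ∀ k v, IsCartSq (sqAt k v) Y) :
    Function.Bijective fun f : (D.towerColim K).obj X ⟶ Y => (toColim D K).app X ≫ f := by
  have hκ := isLan_unit (intProj K) (straight D K X)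
  obtain ⟨η, θ, h1, h2⟩ := hpt.exists_towerColim_iso hX hκ
  have h3 : Function.Bijective fun f : (D.lan (intProj K)).obj (straight D K X) ⟶ Y => η ≫ f := by
    rw [← (map_bijective_of_isLan_id (isLan_intProj_id X)).of_comp_iff']
    have h4 := ((isRanExt_intProj hY).precomp_bijective (toStraight X)).comp (hκ Y)
    convert h4 using 1
    funext f
    simp [h1]
  have h5 : (fun f : (D.towerColim K).obj X ⟶ Y => (toColim D K).app X ≫ f) =
      (fun f => η ≫ f) ∘ Iso.homFromEquiv θ := by
    funext f
    simp [Iso.homFromEquiv, ← h2]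
  rw [h5]
  exact h3.comp (Iso.homFromEquiv θ).bijective

theorem IsPointed.isPrespectrum_towerColim (hpt : D.IsPointed) {X : D.obj (K × Strip.{w})}
    (hX : D.IsPrespectrum K X) : D.IsPrespectrum K ((D.towerColim K).obj X) := by
  have hκ := isLan_unit (intProj K) (straight D K X)
  obtain ⟨η, θ, h1, h2⟩ := hpt.exists_towerColim_iso hX hκ
  exact (isPrespectrum_of_isLan hpt hX hκ).of_iso ((D.map _).mapIso θ)

theorem IsPointed.isCartSq_towerColim (hpt : D.IsPointed) (hreg : D.IsRegular)
    {X : D.obj (K × Strip.{w})} (hX : D.IsPrespectrum K X) (k : K) (v : Strip.{w}) :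
    IsCartSq (sqAt k v) ((D.towerColim K).obj X) := by
  have hκ := isLan_unit (intProj K) (straight D K X)
  obtain ⟨η, θ, h1, h2⟩ := hpt.exists_towerColim_iso hX hκ
  exact (isCartSq_of_isLan hpt hreg hX hκ k v).of_iso θ.inv

end
end Prederivator

namespace Prederivator

variable {𝒟 : DiagramClass.{w}} {D : Prederivator.{w, v, u} 𝒟}

/-! ### Base change -/

section abstract

variable {J₁ J₂ K₁ K₂ : Type w} [SmallCategory J₁] [SmallCategory J₂] [SmallCategory K₁]
  [SmallCategory K₂] [𝒟.Has J₁] [𝒟.Has J₂] [𝒟.Has K₁] [𝒟.Has K₂]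

theorem cell_eqToHom_app {a : J₁ ⥤ J₂} {b : J₂ ⥤ K₂} {c : J₁ ⥤ K₁} {d : K₁ ⥤ K₂}
    (h : a ⋙ b = c ⋙ d) (X : D.obj K₂) :
    (D.cell (eqToHom h)).app X = eqToHom (map_sq_obj h X) := by
  have := pull_id_id h X
  rw [pull, CategoryTheory.Functor.map_id] at this
  exact (Category.comp_id _).symm.trans this

variable {Z Z' W W' M M' B B' : Type w} [SmallCategory Z]
    [SmallCategory Z'] [SmallCategory W] [SmallCategory W'] [SmallCategory M] [SmallCategory M']
    [SmallCategory B] [SmallCategory B'] [𝒟.Has Z] [𝒟.Has Z'] [𝒟.Has W] [𝒟.Has W'] [𝒟.Has M]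
    [𝒟.Has M'] [𝒟.Has B] [𝒟.Has B'] {o : W ⥤ B} {o' : W' ⥤ B'} {z : Z ⥤ W} {z' : Z' ⥤ W'}
    {f : Z ⥤ M} {f' : Z' ⥤ M'} {tB : B' ⥤ B} {tW : W' ⥤ W} {tZ : Z' ⥤ Z} {tM : M' ⥤ M}

instance (h : tW ⋙ o = o' ⋙ tB) (X : D.obj B) : IsIso ((D.cell (eqToHom h)).app X) := by
  rw [cell_eqToHom_app]
  infer_instance

theorem isIso_cell_comp {N N' : Type w} [SmallCategory N] [SmallCategory N'] [𝒟.Has N] [𝒟.Has N']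
    {l : N ⥤ M} {l' : N' ⥤ M'} {tN : N' ⥤ N} (hl : tN ⋙ l = l' ⋙ tM) {T : D.obj M} {T' : D.obj M'}
    {s : (D.map tM).obj T ⟶ T'} (hs : IsIso s) :
    IsIso ((D.cell (eqToHom hl)).app T ≫ (D.map l').map s) := by
  infer_instance

theorem map_comp_span {N N' : Type w} [SmallCategory N] [SmallCategory N'] [𝒟.Has N] [𝒟.Has N']
    {l : N ⥤ M} {l' : N' ⥤ M'} {tN : N' ⥤ N} {q : M ⥤ B} {q' : M' ⥤ B'} {n : N ⥤ B} {n' : N' ⥤ B'}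
    (hn : n = l ⋙ q) (hn' : n' = l' ⋙ q') (hl : tN ⋙ l = l' ⋙ tM) (hN : tN ⋙ n = n' ⋙ tB)
    (hM : tM ⋙ q = q' ⋙ tB) {X : D.obj B} {T : D.obj M} {T' : D.obj M'}
    {τ : (D.map q).obj X ⟶ T} {τ' : (D.map q').obj ((D.map tB).obj X) ⟶ T'}
    {s : (D.map tM).obj T ⟶ T'} (hs : (D.map tM).map τ ≫ s = eqToHom (map_sq_obj hM X) ≫ τ') :
    (D.map tN).map (eqToHom (map_tri_obj hn X) ≫ (D.map l).map τ) ≫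
        (D.cell (eqToHom hl)).app T ≫ (D.map l').map s =
      eqToHom (map_sq_obj hN X) ≫ eqToHom (map_tri_obj hn' _) ≫ (D.map l').map τ' := by
  have h1 := map_sq_map hl τ
  have h2 := congrArg (D.map l').map hs
  rw [Functor.map_comp, Functor.map_comp] at h2
  rw [Functor.map_comp, cell_eqToHom_app, Category.assoc, reassoc_of% h1, h2]
  simp [eqToHom_map]

variable [D.HasKan]

/-- The comparison of extensions along a span. -/
noncomputable abbrev spanBaseChange (ho : tW ⋙ o = o' ⋙ tB) (hz : tZ ⋙ z = z' ⋙ tW) (hf : f' ⋙ tM = tZ ⋙ f) (X : D.obj B) :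
    (D.map tM).obj ((D.ran f).obj ((D.map z).obj ((D.map o).obj X))) ⟶
      (D.ran f').obj ((D.map z').obj ((D.map o').obj ((D.map tB).obj X))) :=
  ((D.rightMate (eqToHom hf)).app _ ≫ (D.ran f').map ((D.cell (eqToHom hz)).app _)) ≫
    (D.ran f').map ((D.map z').map ((D.cell (eqToHom ho)).app X))

/-- Maps into the right Kan extension along `f'` are tested against its counit, and there only
identities of the strict 2-functor remain. -/
theorem map_comp_spanBaseChange (ho : tW ⋙ o = o' ⋙ tB) (hz : tZ ⋙ z = z' ⋙ tW)
    (hf : f' ⋙ tM = tZ ⋙ f) {q : M ⥤ B} {q' : M' ⥤ B'} (hq : f ⋙ q = z ⋙ o)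
    (hq' : f' ⋙ q' = z' ⋙ o') (hM : tM ⋙ q = q' ⋙ tB) {X : D.obj B}
    {τ : (D.map q).obj X ⟶ (D.ran f).obj ((D.map z).obj ((D.map o).obj X))}
    (hτ : (D.map f).map τ ≫ ranCounit f _ = eqToHom (map_sq_obj hq X))
    {τ' : (D.map q').obj ((D.map tB).obj X) ⟶
      (D.ran f').obj ((D.map z').obj ((D.map o').obj ((D.map tB).obj X)))}
    (hτ' : (D.map f').map τ' ≫ ranCounit f' _ = eqToHom (map_sq_obj hq' _)) :
    (D.map tM).map τ ≫ spanBaseChange ho hz hf X = eqToHom (map_sq_obj hM X) ≫ τ' := by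
  refine (isRan_counit f' _).hom_ext ?_
  have h1 := map_rightMate_app (eqToHom hf) ((D.map z).obj ((D.map o).obj X))
  have h2 := map_pull (eqToHom hf) (hτ.trans (Category.id_comp _).symm)
  have h3 := fun (Y Y' : D.obj Z') (g : Y ⟶ Y') => ranCounit_naturality f' g
  simp only [spanBaseChange, Functor.map_comp, Category.assoc, h3, reassoc_of% h3, hτ',
    reassoc_of% h1, reassoc_of% h2]
  simp only [pull_id_id, cell_eqToHom_app, eqToHom_map, eqToHom_trans]

theorem isIso_spanBaseChange (ho : tW ⋙ o = o' ⋙ tB) (hz : tZ ⋙ z = z' ⋙ tW)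
    (hf : f' ⋙ tM = tZ ⋙ f) (X : D.obj B) [IsIso (D.rightMate (eqToHom hf))] :
    IsIso (spanBaseChange ho hz hf X) := by
  infer_instance

/-- Tested after pullback along `n'`, which is faithful by `hn'`. Both sides then become the map
`τ'` followed by the unit of the colimit. -/
theorem map_comp_baseChange {n : M ⥤ B} {n' : M' ⥤ B'} (h : tM ⋙ n = n' ⋙ tB)
    [IsIso (D.leftMate (eqToHom h))] {X : D.obj B} {T : D.obj M} {T' : D.obj M'}
    (hn' : ∀ Y, IsLan n' (𝟙 ((D.map n').obj Y)))
    {τ : (D.map n).obj X ⟶ T} {η : X ⟶ (D.lan n).obj T}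
    (hη : (D.map n).map η = τ ≫ lanUnit n T) {τ' : (D.map n').obj ((D.map tB).obj X) ⟶ T'}
    {η' : (D.map tB).obj X ⟶ (D.lan n').obj T'} (hη' : (D.map n').map η' = τ' ≫ lanUnit n' T')
    {b : (D.map tM).obj T ⟶ T'} (hb : (D.map tM).map τ ≫ b = eqToHom (map_sq_obj h X) ≫ τ')
    {c : (D.map tB).obj ((D.lan n).obj T) ⟶ (D.lan n').obj T'}
    (hc : (D.leftMate (eqToHom h)).app T ≫ c = (D.lan n').map b) :
    (D.map tB).map η ≫ c = η' := by
  refine (map_bijective_of_isLan_id (hn' _)).1 ?_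
  dsimp only
  have h1 := lanUnit_leftMate_app (eqToHom h) T
  have h2 := map_sq_map h η
  have h3 := lanUnit_naturality n' b
  rw [push, cell_eqToHom_app] at h1
  rw [← hc, Functor.map_comp, reassoc_of% h1] at h3
  rw [hη, Functor.map_comp, Category.assoc] at h2
  rw [Functor.map_comp, hη']
  rw [← cancel_epi (eqToHom (map_sq_obj h X)), ← reassoc_of% h2, ← h3, reassoc_of% hb]

end abstract

section

variable {J K : Type w} [SmallCategory J] [SmallCategory K] [𝒟.Has J] [𝒟.Has K] [D.IsDerivator]
  (t : J ⥤ K)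

theorem towerBaseChange_app (X : D.obj (K × Strip.{w})) :
    (D.towerBaseChange t).app X = (D.cell (a := (t.prod (𝟭 NatShape.{w})).prod (𝟭 Strip.{w}))
      (b := midMap K Strip.{w} StripNat.column.{w}) (c := midMap J Strip.{w} StripNat.column.{w})
      (d := (t.prod (𝟭 StripNat.{w})).prod (𝟭 Strip.{w})) (eqToHom rfl)).app _ ≫
      (D.map (midMap J Strip.{w} StripNat.column.{w})).map
        (spanBaseChange (o := twist Strip.ω Strip.ω_mono K) (o' := twist Strip.ω Strip.ω_mono J)
          (z := midMap K Strip.{w} StripZ.ζ.{w}) (z' := midMap J Strip.{w} StripZ.ζ.{w})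
          (f := midMap K Strip.{w} StripZ.incl.{w}) (f' := midMap J Strip.{w} StripZ.incl.{w})
          (tB := t.prod (𝟭 Strip.{w})) (tW := (t.prod (𝟭 StripNonneg.{w})).prod (𝟭 Strip.{w}))
          (tZ := (t.prod (𝟭 StripZ.{w})).prod (𝟭 Strip.{w}))
          (tM := (t.prod (𝟭 StripNat.{w})).prod (𝟭 Strip.{w})) rfl rfl rfl X) := by
  simp only [Functor.map_comp, ← Category.assoc]
  rfl

/-- The functor `t` affects the parameter only; the slices on both sides are computed by the same
part of `Z`. -/
theorem isIso_rightMate_tower :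
    IsIso (D.rightMate (a := midMap J Strip.{w} StripZ.incl.{w})
      (b := (t.prod (𝟭 StripNat.{w})).prod (𝟭 Strip.{w}))
      (c := (t.prod (𝟭 StripZ.{w})).prod (𝟭 Strip.{w}))
      (d := midMap K Strip.{w} StripZ.incl.{w}) (eqToHom rfl)) := by
  refine isIso_rightMate fun x => ?_
  let S := {z : StripZ.{w} // x.1.2 ≤ z.1}
  let γ : toPt S ⋙ pt x ⟶ inFiber x.1.1 (Monotone.functor (f := Subtype.val) fun _ _ h => h) x.2 ⋙
      midMap J Strip.{w} StripZ.incl.{w} :=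
    { app := fun s => CategoryTheory.Prod.mkHom (CategoryTheory.Prod.mkHom (𝟙 x.1.1)
        (homOfLE s.2)) (𝟙 x.2)
      naturality := fun _ _ _ => midHom_ext rfl }
  refine ⟨S, inferInstance, _, γ, ?_, ?_⟩
  · exact ranData_midMap _ (fun _ => inferInstanceAs (IsIso (𝟙 x.1.1))) fun a v' h1 h2 =>
      ⟨⟨a, h1⟩, le_rfl, h2, fun s hs _ => hs⟩
  · exact ranData_midMap _
      (fun _ => inferInstanceAs (IsIso (t.map (𝟙 x.1.1) ≫ 𝟙 (t.obj x.1.1)))) fun a v' h1 h2 =>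
        ⟨⟨a, h1⟩, le_rfl, h2, fun s hs _ => hs⟩

theorem isIso_towerBaseChange_app (X : D.obj (K × Strip.{w})) :
    IsIso ((D.towerBaseChange t).app X) := by
  have := isIso_rightMate_tower (D := D) t
  rw [towerBaseChange_app]
  exact isIso_cell_comp _ (isIso_spanBaseChange (o := twist Strip.ω Strip.ω_mono K)
    (o' := twist Strip.ω Strip.ω_mono J) (z := midMap K Strip.{w} StripZ.ζ.{w})
    (z' := midMap J Strip.{w} StripZ.ζ.{w}) (f := midMap K Strip.{w} StripZ.incl.{w})
    (f' := midMap J Strip.{w} StripZ.incl.{w}) (tB := t.prod (𝟭 Strip.{w}))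
    (tW := (t.prod (𝟭 StripNonneg.{w})).prod (𝟭 Strip.{w}))
    (tZ := (t.prod (𝟭 StripZ.{w})).prod (𝟭 Strip.{w}))
    (tM := (t.prod (𝟭 StripNat.{w})).prod (𝟭 Strip.{w})) rfl rfl rfl X)

theorem toTower_towerBaseChange (X : D.obj (K × Strip.{w})) :
    (D.map ((t.prod (𝟭 NatShape.{w})).prod (𝟭 Strip.{w}))).map (toTower X) ≫
        (D.towerBaseChange t).app X =
      eqToHom (map_sq_obj (a := (t.prod (𝟭 NatShape.{w})).prod (𝟭 Strip.{w})) (b := natProj K)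
        (c := natProj J) (d := t.prod (𝟭 Strip.{w})) rfl X) ≫
        toTower ((D.map (t.prod (𝟭 Strip.{w}))).obj X) := by
  rw [towerBaseChange_app]
  exact map_comp_span (column_constMap K).symm (column_constMap J).symm rfl rfl rfl
    (map_comp_spanBaseChange (o := twist Strip.ω Strip.ω_mono K)
      (o' := twist Strip.ω Strip.ω_mono J) (z := midMap K Strip.{w} StripZ.ζ.{w})
      (z' := midMap J Strip.{w} StripZ.ζ.{w}) (f := midMap K Strip.{w} StripZ.incl.{w})
      (f' := midMap J Strip.{w} StripZ.incl.{w}) (tB := t.prod (𝟭 Strip.{w}))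
      (tW := (t.prod (𝟭 StripNonneg.{w})).prod (𝟭 Strip.{w}))
      (tZ := (t.prod (𝟭 StripZ.{w})).prod (𝟭 Strip.{w}))
      (tM := (t.prod (𝟭 StripNat.{w})).prod (𝟭 Strip.{w})) (q := constMap K) (q' := constMap J)
      rfl rfl rfl rfl rfl rfl (toTowerDiagram_counit X) (toTowerDiagram_counit _))

theorem isIso_leftMate_natProj :
    IsIso (D.leftMate (a := (t.prod (𝟭 NatShape.{w})).prod (𝟭 Strip.{w})) (b := natProj K)
      (c := natProj J) (d := t.prod (𝟭 Strip.{w})) (eqToHom rfl)) := by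
  refine isIso_leftMate fun x => ⟨NatShape.{w}, inferInstance, natSeq x.1 x.2,
    natSeqHom x.1 x.2, lanData_natSeq x.1 x.2, ?_⟩
  exact LanData.of_poset (q := CategoryTheory.Prod.fst K Strip.{w})
    (p := fun a : (K × NatShape.{w}) × Strip.{w} => (a.1.2, a.2))
    (isOverPoset_fst_fst (K := K) (P := NatShape.{w}) (Q := Strip.{w})) isOverPoset_fst
    (fun _ => inferInstanceAs (IsIso (𝟙 (t.obj x.1) ≫ t.map (𝟙 x.1))))
    fun a ha => ⟨a.1.2, ⟨le_rfl, ha⟩, fun _ hn => hn.1⟩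

/-- Compatibility of the unit with restriction: it makes the unit a modification, and it determines
the comparison map. -/
theorem toColim_baseChange (X : D.obj (K × Strip.{w}))
    {c : (D.map (t.prod (𝟭 Strip.{w}))).obj ((D.towerColim K).obj X) ⟶
      (D.towerColim J).obj ((D.map (t.prod (𝟭 Strip.{w}))).obj X)}
    (hc : (D.colimBaseChange t).app ((D.tower K).obj X) ≫ c =
      (D.lan (natProj J)).map ((D.towerBaseChange t).app X)) :
    (D.map (t.prod (𝟭 Strip.{w}))).map ((toColim D K).app X) ≫ c =
      (toColim D J).app ((D.map (t.prod (𝟭 Strip.{w}))).obj X) := by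
  have := isIso_leftMate_natProj (D := D) t
  exact map_comp_baseChange (n := natProj K) (n' := natProj J) rfl isLan_natProj_id
    (map_toColim X) (map_toColim _) (toTower_towerBaseChange t X) hc

end
end Prederivator

namespace Prederivator

variable {𝒟 : DiagramClass.{w}}

/-! ### Reflective subprederivators -/

/-- A reflection of the objects of a prederivator to the objects with the property `P`, compatible
with restriction. -/
structure Reflection (E : Prederivator.{w, v, u} 𝒟)
    (P : ∀ (K : Type w) [SmallCategory K] [𝒟.Has K], ObjectProperty (E.obj K)) where
  /-- the reflection -/
  L : ∀ (K : Type w) [SmallCategory K] [𝒟.Has K], E.obj K ⥤ E.obj K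
  prop : ∀ (K : Type w) [SmallCategory K] [𝒟.Has K] (X : E.obj K), P K ((L K).obj X)
  /-- the unit -/
  η : ∀ (K : Type w) [SmallCategory K] [𝒟.Has K], 𝟭 (E.obj K) ⟶ L K
  bijective : ∀ {K : Type w} [SmallCategory K] [𝒟.Has K] (X : E.obj K) {Y : E.obj K}, P K Y →
    Function.Bijective fun f : (L K).obj X ⟶ Y => (show X ⟶ (L K).obj X from (η K).app X) ≫ f
  /-- the compatibility with restriction -/
  γ : ∀ {J K : Type w} [SmallCategory J] [SmallCategory K] [𝒟.Has J] [𝒟.Has K] (t : J ⥤ K),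
    L K ⋙ E.map t ≅ E.map t ⋙ L J
  map_η_γ : ∀ {J K : Type w} [SmallCategory J] [SmallCategory K] [𝒟.Has J] [𝒟.Has K] (t : J ⥤ K)
    (X : E.obj K), (show (E.map t).obj X ⟶ (E.map t).obj ((L K).obj X) from
      (E.map t).map ((η K).app X)) ≫ (γ t).hom.app X = (η J).app ((E.map t).obj X)

namespace Reflection

variable {E : Prederivator.{w, v, u} 𝒟}
  {P : ∀ (K : Type w) [SmallCategory K] [𝒟.Has K], ObjectProperty (E.obj K)} (R : Reflection E P)
  {J K : Type w} [SmallCategory J] [SmallCategory K] [𝒟.Has J] [𝒟.Has K]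

/-- The unit at an object. -/
abbrev unit (X : E.obj K) : X ⟶ (R.L K).obj X := (R.η K).app X

theorem unit_naturality {X Y : E.obj K} (f : X ⟶ Y) :
    f ≫ R.unit Y = R.unit X ≫ (R.L K).map f := (R.η K).naturality f

theorem hom_ext {X Y : E.obj K} (hY : P K Y) {f g : (R.L K).obj X ⟶ Y}
    (h : R.unit X ≫ f = R.unit X ≫ g) : f = g := (R.bijective X hY).1 h

theorem map_unit_γ (t : J ⥤ K) (X : E.obj K) :
    (E.map t).map (R.unit X) ≫ (R.γ t).hom.app X = R.unit ((E.map t).obj X) := R.map_η_γ t X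

/-- Since `γ` is invertible, the restricted unit detects maps to objects of `P` as well as the unit
itself does. The axioms of a morphism then need no further computation of `γ`: both sides agree
after the unit. -/
theorem map_hom_ext (t : J ⥤ K) {X : E.obj K} {Y : E.obj J} (hY : P J Y)
    {f g : (E.map t).obj ((R.L K).obj X) ⟶ Y}
    (h : (E.map t).map (R.unit X) ≫ f = (E.map t).map (R.unit X) ≫ g) : f = g := by
  have h1 := R.map_unit_γ t X
  have h2 : (E.map t).map (R.unit X) = R.unit ((E.map t).obj X) ≫ (R.γ t).inv.app X := by
    rw [← h1, Category.assoc, Iso.hom_inv_id_app]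
    exact (Category.comp_id _).symm
  rw [h2, Category.assoc, Category.assoc] at h
  exact (cancel_epi ((R.γ t).inv.app X)).1 (R.hom_ext hY h)

theorem eqToHom_unit {X Y : E.obj K} (h : X = Y) :
    eqToHom h ≫ R.unit Y = R.unit X ≫ eqToHom (congrArg (R.L K).obj h) := by
  subst h
  simp

theorem γ_id (X : E.obj K) : (R.γ (𝟭 K)).hom.app X =
    eqToHom ((E.map_id_obj _).trans (congrArg (R.L K).obj (E.map_id_obj X).symm)) := by
  refine R.map_hom_ext (𝟭 K) (R.prop K _) ?_
  refine (R.map_unit_γ _ X).trans ?_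
  rw [map_id_map, Category.assoc, Category.assoc, eqToHom_trans, reassoc_of% eqToHom_unit,
    eqToHom_trans, eqToHom_refl]
  exact (Category.comp_id _).symm

theorem γ_comp {I : Type w} [SmallCategory I] [𝒟.Has I] (s : I ⥤ J) (t : J ⥤ K) (X : E.obj K) :
    (R.γ (s ⋙ t)).hom.app X = eqToHom (E.map_comp_obj s t _) ≫ (E.map s).map ((R.γ t).hom.app X) ≫
      (R.γ s).hom.app ((E.map t).obj X) ≫
        eqToHom (congrArg (R.L I).obj (E.map_comp_obj s t X).symm) := by
  refine R.map_hom_ext (s ⋙ t) (R.prop I _) ?_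
  refine (R.map_unit_γ _ X).trans ?_
  have h1 := congrArg (E.map s).map (R.map_unit_γ t X)
  rw [Functor.map_comp] at h1
  rw [map_comp_map, Category.assoc, Category.assoc, eqToHom_trans_assoc, eqToHom_refl,
    Category.id_comp, reassoc_of% h1, reassoc_of% R.map_unit_γ s, reassoc_of% eqToHom_unit,
    eqToHom_trans, eqToHom_refl]
  exact (Category.comp_id _).symm

theorem γ_map₂ {t t' : J ⥤ K} (α : t ⟶ t') (X : E.obj K) :
    (E.map₂ α).app ((R.L K).obj X) ≫ (R.γ t').hom.app X =
      (R.γ t).hom.app X ≫ (R.L J).map ((E.map₂ α).app X) := by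
  refine R.map_hom_ext t (R.prop J _) ?_
  have h := (E.map₂ α).naturality (R.unit X)
  rw [reassoc_of% h, R.map_unit_γ, reassoc_of% R.map_unit_γ, R.unit_naturality]

variable (hP : E.PullbackStable P)

/-- The reflection, as a morphism of prederivators. -/
def morphism : Morphism E (E.sub P hP) where
  app K := (P K).lift (R.L K) (R.prop K)
  γ {J K} _ _ _ _ t := NatIso.ofComponents (fun X => (P J).isoMk ((R.γ t).app X)) fun f =>
    ObjectProperty.hom_ext _ ((R.γ t).hom.naturality f)
  γ_id K _ _ X := (P K).ι.map_injective (by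
    rw [eqToHom_map]
    exact R.γ_id X)
  γ_comp {I J K} _ _ _ _ _ _ s t X := (P I).ι.map_injective (by
    rw [Functor.map_comp, Functor.map_comp, Functor.map_comp, eqToHom_map, eqToHom_map]
    exact R.γ_comp s t X)
  γ_map₂ {J K} _ _ _ _ t t' α X := (P J).ι.map_injective (R.γ_map₂ α X)

theorem exists_counit (Y : E.obj K) (hY : P K Y) :
    ∃ ε : (R.L K).obj Y ⟶ Y, R.unit Y ≫ ε = 𝟙 Y := (R.bijective Y hY).2 (𝟙 Y)

/-- The counit at an object. -/
noncomputable def counit (Y : E.obj K) (hY : P K Y) : (R.L K).obj Y ⟶ Y :=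
  (R.exists_counit Y hY).choose

theorem unit_counit (Y : E.obj K) (hY : P K Y) : R.unit Y ≫ R.counit Y hY = 𝟙 Y :=
  (R.exists_counit Y hY).choose_spec

theorem counit_naturality {X Y : E.obj K} (hX : P K X) (hY : P K Y) (f : X ⟶ Y) :
    (R.L K).map f ≫ R.counit Y hY = R.counit X hX ≫ f := by
  refine R.hom_ext hY ?_
  rw [← reassoc_of% R.unit_naturality, unit_counit, reassoc_of% R.unit_counit X hX,
    Category.comp_id]

theorem γ_counit (t : J ⥤ K) (Y : E.obj K) (hY : P K Y) (hY' : P J ((E.map t).obj Y)) :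
    (R.γ t).hom.app Y ≫ R.counit _ hY' = (E.map t).map (R.counit Y hY) := by
  refine R.map_hom_ext t hY' ?_
  have h := R.map_unit_γ t Y
  rw [reassoc_of% h, unit_counit, ← Functor.map_comp, unit_counit, CategoryTheory.Functor.map_id]

theorem map_unit_counit (X : E.obj K) :
    (R.L K).map (R.unit X) ≫ R.counit _ (R.prop K X) = 𝟙 _ := by
  refine R.hom_ext (R.prop K X) ?_
  rw [← reassoc_of% R.unit_naturality, unit_counit, Category.comp_id]

/-- The reflection is left adjoint to the inclusion. -/
noncomputable def adjunction : MorphismAdjunction (R.morphism hP) (E.subIncl P hP) where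
  unit :=
    { app := fun K _ _ => R.η K
      comm := fun t X => by
        have h := R.map_unit_γ t X
        simpa [morphism, Morphism.comp, Morphism.id, subIncl] using h }
  counit :=
    { app := fun K _ _ =>
        { app := fun Y => ObjectProperty.homMk (R.counit Y.obj Y.property)
          naturality := fun X Y f =>
            ObjectProperty.hom_ext _ (R.counit_naturality X.property Y.property f.hom) }
      comm := fun t Y => ObjectProperty.hom_ext _ (by
        have h := R.γ_counit t Y.obj Y.property (hP t _ Y.property)
        simpa [morphism, Morphism.comp, Morphism.id, subIncl] using h.symm) }
  left_triangle K _ _ X := ObjectProperty.hom_ext _ (R.map_unit_counit X)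
  right_triangle K _ _ Y := R.unit_counit Y.obj Y.property

theorem isLocalization (R : Reflection E P) : (E.subIncl P hP).IsLocalization :=
  ⟨fun K _ _ => ⟨(P K).full_ι, (P K).faithful_ι⟩, R.morphism hP, ⟨R.adjunction hP⟩⟩

end Reflection
end Prederivator

namespace Prederivator

variable {𝒟 : DiagramClass.{w}} {D : Prederivator.{w, v, u} 𝒟} [D.IsDerivator]

/-! ### The localization -/

section

variable {J K : Type w} [SmallCategory J] [SmallCategory K] [𝒟.Has J] [𝒟.Has K] (t : J ⥤ K)

instance isIso_towerBaseChange : IsIso (D.towerBaseChange t) := by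
  have : ∀ X, IsIso ((D.towerBaseChange t).app X) := isIso_towerBaseChange_app t
  exact NatIso.isIso_of_isIso_app _

instance isIso_colimBaseChange : IsIso (D.colimBaseChange t) := isIso_leftMate_natProj t

/-- The compatibility of the colimit of the tower with restriction. -/
noncomputable def towerColimBaseChange :
    D.towerColim K ⋙ (D.shift Strip.{w}).map t ≅ (D.shift Strip.{w}).map t ⋙ D.towerColim J :=
  -- The comparison for colimits points in the opposite direction and has to be inverted.
  (asIso (Functor.whiskerLeft (D.tower K) (D.colimBaseChange t))).symm ≪≫
    Functor.isoWhiskerRight (asIso (D.towerBaseChange t))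
      ((D.shift Strip.{w}).lan (CategoryTheory.Prod.fst J NatShape.{w}))

theorem colimBaseChange_towerColimBaseChange (X : (D.shift Strip.{w}).obj K) :
    (D.colimBaseChange t).app ((D.tower K).obj X) ≫ (towerColimBaseChange t).hom.app X =
      ((D.shift Strip.{w}).lan (CategoryTheory.Prod.fst J NatShape.{w})).map
        ((D.towerBaseChange t).app X) :=
  congrArg (fun α => α.app X) (IsIso.hom_inv_id_assoc
    (Functor.whiskerLeft (D.tower K) (D.colimBaseChange t))
    (Functor.whiskerRight (D.towerBaseChange t)
      ((D.shift Strip.{w}).lan (CategoryTheory.Prod.fst J NatShape.{w}))))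

end

/-- The colimit of the tower is the reflection of prespectra to Ω-spectra. -/
noncomputable def IsPointed.reflection (hpt : D.IsPointed) (hreg : D.IsRegular) :
    Reflection D.Sp D.IsOmegaSpectrum where
  L K := (D.IsPrespectrum K).lift ((D.IsPrespectrum K).ι ⋙ D.towerColim K)
    fun X => hpt.isPrespectrum_towerColim X.property
  prop K _ _ X := (isIso_phi_app_iff_isCartSq D _).2 (hpt.isCartSq_towerColim hreg X.property)
  η K :=
    { app := fun X => ObjectProperty.homMk ((toColim D K).app X.obj)
      naturality := fun X Y f => ObjectProperty.hom_ext _ ((toColim D K).naturality f.hom) }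
  bijective {K} _ _ X Y hY := by
    have h := hpt.toColim_bijective X.property ((isIso_phi_app_iff_isCartSq D _).1 hY)
    exact ⟨fun f g hfg => ObjectProperty.hom_ext _ (h.1 (congrArg (·.hom) hfg)),
      fun f => (h.2 f.hom).imp' ObjectProperty.homMk fun g hg => ObjectProperty.hom_ext _ hg⟩
  γ {J K} _ _ _ _ t := NatIso.ofComponents
    (fun X => (D.IsPrespectrum J).isoMk ((towerColimBaseChange t).app X.obj)) fun f =>
      ObjectProperty.hom_ext _ ((towerColimBaseChange t).hom.naturality f.hom)
  map_η_γ t X := ObjectProperty.hom_ext _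
    (toColim_baseChange t X.obj (colimBaseChange_towerColimBaseChange t X.obj))

end Prederivator

theorem mainTheorem4 {𝒟 : DiagramClass.{w}} (D : Prederivator.{w, v, u} 𝒟) [D.IsDerivator]
    (hpt : D.IsPointed) (hreg : D.IsRegular) :
    -- the Ω-spectra form a subprederivator `St D` of `Sp D`, which is a localization of `Sp D`
    ∃ hSt : D.Sp.PullbackStable D.IsOmegaSpectrum, (D.stIncl hSt).IsLocalization ∧
    -- the left adjoint of the inclusion is the sequential homotopy colimit of the tower
    (∃ (loc : Prederivator.Morphism D.Sp (D.St hSt))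
        (_ : Prederivator.MorphismAdjunction loc (D.stIncl hSt))
        (θ : ∀ (K : Type w) [SmallCategory K] [𝒟.Has K],
          (D.IsPrespectrum K).ι ⋙ D.towerColim K ≅
            loc.app K ⋙ (D.IsOmegaSpectrum K).ι ⋙ (D.IsPrespectrum K).ι),
        D.IsTowerColimIso loc θ) ∧
    -- the objects of the tower are the `Ωⁿ (σ^*)ⁿ X`, its maps are shifts of `φ_X`
    ∀ (K : Type w) [SmallCategory K] [𝒟.Has K] (n : ℕ),
      Nonempty ((D.IsPrespectrum K).ι ⋙ D.towerObj K n ≅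
        (D.IsPrespectrum K).ι ⋙ D.loopShift K n) ∧
      Nonempty (Arrow.mk (Functor.whiskerLeft (D.IsPrespectrum K).ι (D.towerMap K n)) ≅
        Arrow.mk (Functor.whiskerLeft (D.IsPrespectrum K).ι
          (Functor.whiskerRight (D.phi K) (D.loopShift K n)))) := by
  let R := hpt.reflection hreg
  -- The reflection is the colimit of the tower by construction, so `θ` is the identity, and the
  -- condition on it reduces to the defining equation of `towerColimBaseChange`.
  refine ⟨D.isOmegaSpectrum_stable, R.isLocalization _, ⟨R.morphism _, R.adjunction _,
    fun K _ _ => Iso.refl _, fun {J K} _ _ _ _ t X => ?_⟩, fun K _ _ n =>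
      ⟨hpt.nonempty_towerObj_iso K n, hpt.nonempty_towerMap_iso K n⟩⟩
  have h := Prederivator.colimBaseChange_towerColimBaseChange t X.obj
  have h' := ((D.shift Strip.{w}).map t).map_id ((D.towerColim K).obj X.obj)
  exact (congrArg ((D.colimBaseChange t).app _ ≫ ·) ((congrArg (· ≫ _) h').trans
    (Category.id_comp _))).trans (h.trans (Category.comp_id _).symm)
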